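/- For a bounded plane domain $\Omega$ write $0<\lambda_1\le\lambda_2\le\lambda_3\le\cdots$ for the eigenvalues, counted with multiplicity, of the Dirichlet Laplacian on $\Omega$ (that is, $-\Delta u=\lambda u$ weakly in $\Omega$ with $u\in H^1_0(\Omega)\setminus\{0\}$), and write $D$ for the diameter of $\Omega$. Let $T$ be a (nondegenerate) triangular domain, let $E$ be an equilateral triangular domain, and let $n\ge 1$. Then $$(\lambda_1+\cdots+\lambda_n)\,D^2\big|_T \;\ge\; (\lambda_1+\cdots+\lambda_n)\,D^2\big|_E ,$$ with equality if and only if $T$ is equilateral. -/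

import Mathlib

/-- The Euclidean plane. -/
abbrev Plane : Type := EuclideanSpace ℝ (Fin 2)

/-- Test functions on `Ω`: smooth real functions with compact support contained in `Ω`. -/
structure IsTestFunction (Ω : Set Plane) (φ : Plane → ℝ) : Prop where
  contDiff : ContDiff ℝ (⊤ : ℕ∞) φ
  hasCompactSupport : HasCompactSupport φ
  tsupport_subset : tsupport φ ⊆ Ω

/-- `u` belongs to `H¹₀(Ω)`, the closure of the test functions in the `H¹` norm, and `g` is its
(weak) gradient: some sequence of test functions converges to `u` in `L²(Ω)` while its gradients
converge to `g` in `L²(Ω)`. -/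
def IsH10WithGradient (Ω : Set Plane) (u : MeasureTheory.Lp ℝ 2 (MeasureTheory.volume.restrict Ω))
    (g : MeasureTheory.Lp Plane 2 (MeasureTheory.volume.restrict Ω)) : Prop :=
  ∃ φ : ℕ → Plane → ℝ, (∀ k, IsTestFunction Ω (φ k)) ∧
    Filter.Tendsto (fun k => MeasureTheory.eLpNorm (fun x => φ k x - u x) 2
      (MeasureTheory.volume.restrict Ω)) Filter.atTop (nhds 0) ∧
    Filter.Tendsto (fun k => MeasureTheory.eLpNorm (fun x => gradient (φ k) x - g x) 2
      (MeasureTheory.volume.restrict Ω)) Filter.atTop (nhds 0)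

/-- `u` is an eigenfunction of the Dirichlet Laplacian on `Ω` with eigenvalue `μ`: a nonzero
element of `H¹₀(Ω)` with `-Δu = μ u` in the weak sense. -/
def IsDirichletEigenfunction (Ω : Set Plane) (μ : ℝ)
    (u : MeasureTheory.Lp ℝ 2 (MeasureTheory.volume.restrict Ω)) : Prop :=
  u ≠ 0 ∧ ∃ g : MeasureTheory.Lp Plane 2 (MeasureTheory.volume.restrict Ω),
    IsH10WithGradient Ω u g ∧
    ∀ φ : Plane → ℝ, IsTestFunction Ω φ →
      ∫ x in Ω, inner ℝ (g x) (gradient φ x) = μ * ∫ x in Ω, u x * φ x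

/-- The `j`-th eigenvalue `λ_j` (`j = 1, 2, …`) of the Dirichlet Laplacian on `Ω`, in increasing
order and counted with multiplicity: the least `t` such that there are `j` linearly independent
eigenfunctions whose eigenvalues are at most `t`. (The value at `j = 0` is meaningless.) -/
noncomputable def dirichletEigenvalue (Ω : Set Plane) (j : ℕ) : ℝ :=
  sInf {t : ℝ | ∃ u : Fin j → MeasureTheory.Lp ℝ 2 (MeasureTheory.volume.restrict Ω),
    LinearIndependent ℝ u ∧ ∀ i, ∃ μ : ℝ, μ ≤ t ∧ IsDirichletEigenfunction Ω μ (u i)}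

/-- The scale-invariant quantity `(λ_1 + ⋯ + λ_n) D²` of `Ω`, where `D` is the diameter. -/
noncomputable def eigenvalueSumDiamSq (Ω : Set Plane) (n : ℕ) : ℝ :=
  (∑ j ∈ Finset.Icc 1 n, dirichletEigenvalue Ω j) * Metric.diam Ω ^ 2

/-!
Normalize the equilateral triangle of side `D`, by Lamé's formula, so that its eigenvalues are
`16π² / (9D²)` times the values of `p² + pq + q²` at `p, q ≥ 1`, and let
`R(t) = ∑ (t - p² - pq - q²)₊` be the Riesz mean of these values (`rieszFull`). If `t` is the `n`-th
value then the first `n` values have sum exactly `n t - R(t)`, so Lamé's functions as eigenfunctions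
give an upper bound for the equilateral triangle
(`sum_dirichletEigenvalue_equilateral_le`). For an arbitrary triangle it therefore suffices to bound
`(λ₁ + ⋯ + λₙ) D²` from below by `16π² / 9 * F * (n t - R(t))` for every `t`, with a factor `F ≥ 1`
that is `1` only for equilateral triangles. Since eigenvalues decrease when the domain grows, and
stretching the middle side to the length of the longest side does not change the diameter, this is
needed only for isosceles triangles with two sides `D` and base `√s * D`, `s ≤ 1`
(`exists_shape_le_sum_dirichletEigenvalue`); there `F = shapeFactor s`.

The lower bound transplants test functions to triangles with known spectrum. In suitable linear
coordinates the equilateral triangle, and the right triangle that is half of it, are fundamental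
alcoves of a finite group acting on the torus. A test function on an alcove, extended antisymmetrically
under the group, has antisymmetric Fourier coefficients, and Parseval's identity together with
Bessel's inequality for each frequency yields a Berezin inequality
`∑ (t ‖φⱼ‖² - energy φⱼ) ≤ C * (Riesz mean at t)` for families with Gram matrix at most `C`
(`sum_sub_rootEnergy_le`). Affine maps carry it to any triangle: the equilateral alcove bounds the sum
of the directional energies along the three sides (`sum_sub_symmEnergy_le`), and each of the two ways
to label half an equilateral triangle bounds a combination with weight `3` on one side
(`sum_sub_halfEnergy_le`). The Dirichlet energy on the isosceles triangle is a combination of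
directional energies along the sides, and dominates a positive combination of these bounds
(`le_sum_gradEnergy`). The two kinds of bounds involve different Riesz means, `R` and that of the part
`p > q`, and are brought together by `rieszHalf_le_rieszFull`, which compares the second mean at
`11 t / 6` with `11 / 6 * R(t)`. Asymptotically there is room to spare; lattice refinement makes the
asymptotics effective for large `t`, and small `t` are checked by evaluation in the kernel.

The bound on test functions passes to eigenvalues through the closed form `sobolevGraph`, the closure
of the pairs `(φ, ∇φ)` (`le_sum_dirichletEigenvalue`). The compactness of the embedding
`H¹₀ ⊆ L²`, hence the existence of eigenfunctions, follows from the same bound: it limits the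
size of orthonormal families of bounded energy.

Equality forces `F = 1`, hence an equilateral triangle. The converse is the inequality with the two
triangles exchanged.
-/


/-! ### Riesz means of the two lattice spectra -/

/-- The norm form `p² + pq + q²` of the hexagonal lattice. -/
def hexNorm (p q : ℕ) : ℕ := p ^ 2 + p * q + q ^ 2

lemma hexNorm_mono {p q p' q' : ℕ} (hp : p ≤ p') (hq : q ≤ q') : hexNorm p q ≤ hexNorm p' q' := by
  unfold hexNorm; gcongr

lemma hexNorm_comm (p q : ℕ) : hexNorm p q = hexNorm q p := by unfold hexNorm; ring

/-- The index set `{1, …, M}²` of the spectrum of the equilateral triangle. -/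
def latticeBox (M : ℕ) : Finset (ℕ × ℕ) := Finset.Icc 1 M ×ˢ Finset.Icc 1 M

/-- The part `p > q` of `latticeBox M`, which indexes the spectrum of half an equilateral
triangle. -/
def latticeHalfBox (M : ℕ) : Finset (ℕ × ℕ) := (latticeBox M).filter fun x => x.2 < x.1

/-- The Riesz mean `∑ (t - λ)₊` of the lattice spectrum of the equilateral triangle, with the
indices cut off at `M`; the cutoff is immaterial as soon as `t ≤ M²`. -/
noncomputable def rieszFull (M : ℕ) (t : ℝ) : ℝ :=
  ∑ x ∈ latticeBox M, max (t - hexNorm x.1 x.2) 0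

/-- The Riesz mean of the lattice spectrum of half an equilateral triangle. -/
noncomputable def rieszHalf (M : ℕ) (t : ℝ) : ℝ :=
  ∑ x ∈ latticeHalfBox M, max (t - hexNorm x.1 x.2) 0

lemma mem_latticeBox {M : ℕ} {x : ℕ × ℕ} :
    x ∈ latticeBox M ↔ (1 ≤ x.1 ∧ x.1 ≤ M) ∧ (1 ≤ x.2 ∧ x.2 ≤ M) := by
  simp [latticeBox, Finset.mem_product]

lemma mem_latticeHalfBox {M : ℕ} {x : ℕ × ℕ} :
    x ∈ latticeHalfBox M ↔ (1 ≤ x.1 ∧ x.1 ≤ M) ∧ (1 ≤ x.2 ∧ x.2 ≤ M) ∧ x.2 < x.1 := by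
  simp [latticeHalfBox, mem_latticeBox, and_assoc]

lemma le_of_hexNorm_lt {t : ℝ} {M p q : ℕ} (hM : t ≤ (M : ℝ) ^ 2) (h : (hexNorm p q : ℝ) < t) :
    p ≤ M ∧ q ≤ M := by
  have h1 : hexNorm p q < M ^ 2 := by exact_mod_cast h.trans_le hM
  unfold hexNorm at h1
  constructor <;> by_contra! hc <;> nlinarith

lemma rieszFull_le_box {M M' : ℕ} {t : ℝ} (hM : t ≤ (M : ℝ) ^ 2) :
    rieszFull M' t ≤ rieszFull M t := by
  unfold rieszFull
  rw [← Finset.sum_filter_add_sum_filter_not (latticeBox M') (fun x => t ≤ (hexNorm x.1 x.2 : ℝ))]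
  rw [Finset.sum_eq_zero (s := (latticeBox M').filter _) (f := _) (by
    intro x hx
    have := (Finset.mem_filter.1 hx).2
    apply max_eq_right; linarith), zero_add]
  apply Finset.sum_le_sum_of_subset_of_nonneg
  · intro x hx
    obtain ⟨h1, h2⟩ := Finset.mem_filter.1 hx
    have := le_of_hexNorm_lt hM (not_le.1 h2)
    rw [mem_latticeBox] at *
    omega
  · intros; exact le_max_right _ _

lemma rieszHalf_le_box {M M' : ℕ} {t : ℝ} (hM : t ≤ (M : ℝ) ^ 2) :
    rieszHalf M' t ≤ rieszHalf M t := by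
  unfold rieszHalf
  rw [← Finset.sum_filter_add_sum_filter_not (latticeHalfBox M')
    (fun x => t ≤ (hexNorm x.1 x.2 : ℝ))]
  rw [Finset.sum_eq_zero (s := (latticeHalfBox M').filter _) (f := _) (by
    intro x hx
    have := (Finset.mem_filter.1 hx).2
    apply max_eq_right; linarith), zero_add]
  apply Finset.sum_le_sum_of_subset_of_nonneg
  · intro x hx
    obtain ⟨h1, h2⟩ := Finset.mem_filter.1 hx
    have := le_of_hexNorm_lt hM (not_le.1 h2)
    rw [mem_latticeHalfBox] at *
    omega
  · intros; exact le_max_right _ _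

lemma rieszFull_nonneg (M : ℕ) (t : ℝ) : 0 ≤ rieszFull M t :=
  Finset.sum_nonneg fun _ _ => le_max_right _ _

lemma rieszHalf_mono (M : ℕ) {t t' : ℝ} (h : t ≤ t') : rieszHalf M t ≤ rieszHalf M t' :=
  Finset.sum_le_sum fun _ _ => by gcongr

lemma rieszFull_mono (M : ℕ) {t t' : ℝ} (h : t ≤ t') : rieszFull M t ≤ rieszFull M t' :=
  Finset.sum_le_sum fun _ _ => by gcongr

/-- Subdividing each lattice cell into `θ²` cells and moving to the lower corners decreases the
norm form, so the Riesz mean grows at least like `t²` along squares. -/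
lemma pow_four_mul_rieszHalf_le (M θ : ℕ) (T : ℝ) :
    (θ : ℝ) ^ 4 * rieszHalf M T ≤ rieszHalf (θ * M) ((θ : ℝ) ^ 2 * T) := by
  set R := Finset.range θ ×ˢ Finset.range θ
  have h1 : (θ : ℝ) ^ 4 * rieszHalf M T =
      ∑ y ∈ latticeHalfBox M ×ˢ R, (θ : ℝ) ^ 2 * max (T - hexNorm y.1.1 y.1.2) 0 := by
    rw [Finset.sum_product]
    simp only [Finset.sum_const, R, Finset.card_product, Finset.card_range, nsmul_eq_mul]
    rw [rieszHalf, Finset.mul_sum]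
    refine Finset.sum_congr rfl fun x _ => ?_
    push_cast; ring
  rw [h1]
  let F : (ℕ × ℕ) × (ℕ × ℕ) → ℕ × ℕ := fun y => (θ * y.1.1 - y.2.1, θ * y.1.2 - y.2.2)
  have key : ∀ p a : ℕ, 1 ≤ p → a < θ → θ * p = θ * (p - 1) + θ := by
    intro p a hp _
    obtain ⟨p, rfl⟩ := Nat.exists_eq_add_of_le hp
    simp; ring
  have inj1 : ∀ p a p' a' : ℕ, 1 ≤ p → 1 ≤ p' → a < θ → a' < θ → θ * p - a = θ * p' - a' →
      p = p' ∧ a = a' := by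
    intro p a p' a' hp hp' ha ha' h
    have e1 := key p a hp ha
    have e2 := key p' a' hp' ha'
    have hpp : p = p' := by
      rcases lt_trichotomy p p' with hl | hl | hl
      · have : θ * p ≤ θ * (p' - 1) := Nat.mul_le_mul_left _ (by omega)
        omega
      · exact hl
      · have : θ * p' ≤ θ * (p - 1) := Nat.mul_le_mul_left _ (by omega)
        omega
    subst hpp
    refine ⟨rfl, ?_⟩
    omega
  have hinj : Set.InjOn F (latticeHalfBox M ×ˢ R : Finset _) := by
    rintro ⟨⟨p, q⟩, ⟨a, b⟩⟩ h ⟨⟨p', q'⟩, ⟨a', b'⟩⟩ h' e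
    simp only [Finset.coe_product, Set.mem_prod, Finset.mem_coe, mem_latticeHalfBox, R,
      Finset.mem_range] at h h'
    simp only [F, Prod.mk.injEq] at e
    obtain ⟨rfl, rfl⟩ := inj1 p a p' a' (by omega) (by omega) (by omega) (by omega) e.1
    obtain ⟨rfl, rfl⟩ := inj1 q b q' b' (by omega) (by omega) (by omega) (by omega) e.2
    rfl
  calc _ ≤ ∑ y ∈ latticeHalfBox M ×ˢ R,
        max ((θ : ℝ) ^ 2 * T - hexNorm (F y).1 (F y).2) 0 := by
        refine Finset.sum_le_sum fun y _ => ?_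
        have : hexNorm (F y).1 (F y).2 ≤ θ ^ 2 * hexNorm y.1.1 y.1.2 := by
          refine (hexNorm_mono (Nat.sub_le _ _) (Nat.sub_le _ _)).trans (le_of_eq ?_)
          unfold hexNorm; ring
        have this : (hexNorm (F y).1 (F y).2 : ℝ) ≤ (θ : ℝ) ^ 2 * hexNorm y.1.1 y.1.2 := by
          exact_mod_cast this
        rw [mul_max_of_nonneg _ _ (by positivity), mul_zero]
        exact max_le_max (by linarith) le_rfl
    _ = ∑ x ∈ (latticeHalfBox M ×ˢ R).image F, max ((θ : ℝ) ^ 2 * T - hexNorm x.1 x.2) 0 := by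
        rw [Finset.sum_image hinj]
    _ ≤ _ := by
        apply Finset.sum_le_sum_of_subset_of_nonneg
        · intro x hx
          obtain ⟨⟨⟨p, q⟩, ⟨a, b⟩⟩, hy, rfl⟩ := Finset.mem_image.1 hx
          simp only [Finset.mem_product, mem_latticeHalfBox, R, Finset.mem_range] at hy
          obtain ⟨⟨⟨h1, h2⟩, ⟨h3, h4⟩, h5⟩, h6, h7⟩ := hy
          rw [mem_latticeHalfBox]
          simp only [F]
          have e1 := key p a h1 h6
          have e2 := key q b h3 h7
          have e3 : θ * p ≤ θ * M := Nat.mul_le_mul_left _ h2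
          have e4 : θ * q ≤ θ * M := Nat.mul_le_mul_left _ h4
          have e5 : θ * q ≤ θ * (p - 1) := Nat.mul_le_mul_left _ (by omega)
          refine ⟨⟨?_, ?_⟩, ⟨?_, ?_⟩, ?_⟩ <;> omega
        · intros; exact le_max_right _ _

lemma two_mul_rieszHalf_le (M : ℕ) (T : ℝ) : 2 * rieszHalf M T ≤ rieszFull M T := by
  have h1 : rieszHalf M T =
      ∑ x ∈ (latticeBox M).filter (fun x => x.1 < x.2), max (T - hexNorm x.1 x.2) 0 := by
    refine Finset.sum_nbij' Prod.swap Prod.swap ?_ ?_ ?_ ?_ ?_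
    · intro x hx
      simp [mem_latticeHalfBox, mem_latticeBox] at *
      omega
    · intro x hx
      simp [mem_latticeHalfBox, mem_latticeBox] at *
      omega
    · simp
    · simp
    · intro x _
      simp [hexNorm_comm x.1 x.2]
  rw [two_mul]
  nth_rewrite 1 [h1]
  rw [rieszHalf, latticeHalfBox, ← Finset.sum_union]
  · apply Finset.sum_le_sum_of_subset_of_nonneg
    · intro x hx
      simp only [Finset.mem_union, Finset.mem_filter] at hx
      tauto
    · intros; exact le_max_right _ _
  · rw [Finset.disjoint_filter]
    intros; omega

lemma card_filter_floor_div_le (M i : ℕ) {φ : ℝ} (hφ : 0 < φ) :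
    (((Finset.Icc 1 M).filter fun p : ℕ => ⌊(p : ℝ) / φ⌋₊ = i).card : ℝ) ≤ φ + 1 := by
  have hsub : ((Finset.Icc 1 M).filter fun p : ℕ => ⌊(p : ℝ) / φ⌋₊ = i) ⊆
      Finset.Ico ⌈φ * i⌉₊ ⌈φ * (i + 1)⌉₊ := by
    intro p hp
    have h := (Finset.mem_filter.1 hp).2
    have h1 : (i : ℝ) ≤ p / φ := by rw [← h]; exact Nat.floor_le (by positivity)
    have h2 : (p : ℝ) / φ < i + 1 := by rw [← h]; exact Nat.lt_floor_add_one _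
    rw [le_div_iff₀ hφ] at h1
    rw [div_lt_iff₀ hφ] at h2
    rw [Finset.mem_Ico]
    refine ⟨Nat.ceil_le.2 (by linarith), ?_⟩
    rw [Nat.lt_ceil]; linarith
  have h3 := Finset.card_le_card hsub
  rw [Nat.card_Ico] at h3
  have h4 : ⌈φ * i⌉₊ ≤ ⌈φ * (i + 1)⌉₊ := Nat.ceil_mono (by nlinarith)
  have h5 : (((⌈φ * (i + 1)⌉₊ - ⌈φ * i⌉₊ : ℕ)) : ℝ) ≤ φ + 1 := by
    rw [Nat.cast_sub h4]
    have := Nat.ceil_lt_add_one (a := φ * (i + 1)) (by positivity)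
    have := Nat.le_ceil (φ * (i : ℝ))
    linarith
  exact (Nat.cast_le.2 h3).trans h5

/-- Each point of the lattice refined by the factor `φ` is assigned to the lower corner of its
cell; a cell receives at most `(φ + 1)²` points. -/
lemma rieszFull_le_sum_range (M M' : ℕ) {φ t : ℝ} (hφ : 0 < φ) (hM : t ≤ (M : ℝ) ^ 2) :
    rieszFull M' (φ ^ 2 * t) ≤ φ ^ 2 * (φ + 1) ^ 2 *
      ∑ x ∈ Finset.range (M + 1) ×ˢ Finset.range (M + 1), max (t - hexNorm x.1 x.2) 0 := by
  let F : ℕ × ℕ → ℕ × ℕ := fun x => (⌊(x.1 : ℝ) / φ⌋₊, ⌊(x.2 : ℝ) / φ⌋₊)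
  set B := Finset.range (M + 1) ×ˢ Finset.range (M + 1)
  have hterm : ∀ x : ℕ × ℕ, max (φ ^ 2 * t - hexNorm x.1 x.2) 0 ≤
      φ ^ 2 * max (t - hexNorm (F x).1 (F x).2) 0 := by
    intro x
    rw [mul_max_of_nonneg _ _ (by positivity), mul_zero]
    refine max_le_max ?_ le_rfl
    have h1 : φ * ⌊(x.1 : ℝ) / φ⌋₊ ≤ x.1 := by
      have := Nat.floor_le (a := (x.1 : ℝ) / φ) (by positivity)
      rw [le_div_iff₀ hφ] at this; linarith
    have h2 : φ * ⌊(x.2 : ℝ) / φ⌋₊ ≤ x.2 := by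
      have := Nat.floor_le (a := (x.2 : ℝ) / φ) (by positivity)
      rw [le_div_iff₀ hφ] at this; linarith
    have h3 : φ ^ 2 * (hexNorm (F x).1 (F x).2 : ℝ) ≤ hexNorm x.1 x.2 := by
      simp only [hexNorm, F]
      push_cast
      calc _ = (φ * ⌊(x.1 : ℝ) / φ⌋₊) ^ 2 + (φ * ⌊(x.1 : ℝ) / φ⌋₊) * (φ * ⌊(x.2 : ℝ) / φ⌋₊) +
            (φ * ⌊(x.2 : ℝ) / φ⌋₊) ^ 2 := by ring
        _ ≤ _ := by gcongr
    linarith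
  have hsplit : rieszFull M' (φ ^ 2 * t) ≤
      ∑ x ∈ (latticeBox M').filter (fun x => F x ∈ B),
        φ ^ 2 * max (t - hexNorm (F x).1 (F x).2) 0 := by
    rw [rieszFull, ← Finset.sum_filter_add_sum_filter_not (latticeBox M') (fun x => F x ∈ B)]
    rw [Finset.sum_eq_zero (s := (latticeBox M').filter (fun x => ¬ F x ∈ B)), add_zero]
    · exact Finset.sum_le_sum fun x _ => hterm x
    · intro x hx
      have hx := (Finset.mem_filter.1 hx).2
      refine le_antisymm ((hterm x).trans ?_) (le_max_right _ _)
      rw [max_eq_right, mul_zero]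
      by_contra! hc
      have := le_of_hexNorm_lt hM (by linarith)
      apply hx
      simp only [B, Finset.mem_product, Finset.mem_range]
      omega
  refine hsplit.trans ?_
  rw [← Finset.sum_fiberwise_of_maps_to (s := (latticeBox M').filter (fun x => F x ∈ B)) (t := B)
    (g := F) (fun x hx => (Finset.mem_filter.1 hx).2), Finset.mul_sum]
  refine Finset.sum_le_sum fun y _ => ?_
  rw [Finset.sum_congr rfl (g := fun _ => φ ^ 2 * max (t - hexNorm y.1 y.2) 0)
    (fun x hx => by rw [(Finset.mem_filter.1 hx).2]), Finset.sum_const, nsmul_eq_mul]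
  have hcard : ((((latticeBox M').filter (fun x => F x ∈ B)).filter fun x => F x = y).card : ℝ) ≤
      (φ + 1) ^ 2 := by
    have hsub : ((latticeBox M').filter (fun x => F x ∈ B)).filter (fun x => F x = y) ⊆
        ((Finset.Icc 1 M').filter fun p : ℕ => ⌊(p : ℝ) / φ⌋₊ = y.1) ×ˢ
        ((Finset.Icc 1 M').filter fun p : ℕ => ⌊(p : ℝ) / φ⌋₊ = y.2) := by
      intro x hx
      rw [Finset.mem_filter, Finset.mem_filter, mem_latticeBox] at hx
      obtain ⟨⟨h1, _⟩, h2⟩ := hx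
      simp only [Finset.mem_product, Finset.mem_filter, Finset.mem_Icc]
      rw [← h2]
      exact ⟨⟨h1.1, rfl⟩, ⟨h1.2, rfl⟩⟩
    have := Finset.card_le_card hsub
    rw [Finset.card_product] at this
    calc _ ≤ _ := Nat.cast_le.2 this
      _ = _ := Nat.cast_mul _ _
      _ ≤ (φ + 1) * (φ + 1) := mul_le_mul (card_filter_floor_div_le _ _ hφ)
          (card_filter_floor_div_le _ _ hφ) (by positivity) (by positivity)
      _ = _ := by ring
  calc _ ≤ (φ + 1) ^ 2 * (φ ^ 2 * max (t - hexNorm y.1 y.2) 0) :=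
        mul_le_mul_of_nonneg_right hcard (mul_nonneg (by positivity) (le_max_right _ _))
    _ = _ := by ring

lemma sum_max_sq_sub_sq_le (M : ℕ) {r : ℝ} (hr : 0 ≤ r) :
    ∑ i ∈ Finset.Icc 1 M, max (r ^ 2 - (i : ℝ) ^ 2) 0 ≤ 2 / 3 * r ^ 3 := by
  have key : ∀ M : ℕ, ∑ i ∈ Finset.Icc 1 M, max (r ^ 2 - (i : ℝ) ^ 2) 0 ≤
      r ^ 2 * min (M : ℝ) r - (min (M : ℝ) r) ^ 3 / 3 := by
    intro M
    induction M with
    | zero => simp [hr]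
    | succ M ih =>
      rw [Finset.sum_Icc_succ_top (by omega)]
      push_cast
      have hM : (0 : ℝ) ≤ M := Nat.cast_nonneg M
      rcases le_total ((M : ℝ) + 1) r with h | h
      · rw [min_eq_left h, max_eq_left (by nlinarith)]
        rw [min_eq_left (by linarith)] at ih
        nlinarith
      · rw [min_eq_right h, max_eq_right (by nlinarith)]
        rcases le_total (M : ℝ) r with h' | h'
        · rw [min_eq_left h'] at ih
          nlinarith [mul_nonneg (sq_nonneg (r - M)) (by linarith : 0 ≤ 2 * r + M)]
        · rw [min_eq_right h'] at ih
          linarith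
  refine (key M).trans ?_
  rcases le_total (M : ℝ) r with h | h
  · rw [min_eq_left h]
    have hM : (0 : ℝ) ≤ M := Nat.cast_nonneg M
    nlinarith [mul_nonneg (sq_nonneg (r - M)) (by linarith : 0 ≤ 2 * r + M)]
  · rw [min_eq_right h]; nlinarith

/-- The terms with a vanishing index contribute at most `(4/3) r³ + r²`. -/
lemma sum_range_le_rieszFull_add (M : ℕ) {r : ℝ} (hr : 0 ≤ r) :
    ∑ x ∈ Finset.range (M + 1) ×ˢ Finset.range (M + 1), max (r ^ 2 - hexNorm x.1 x.2) 0 ≤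
      rieszFull M (r ^ 2) + (4 / 3 * r ^ 3 + r ^ 2) := by
  have hrange : ∀ f : ℕ → ℝ, ∑ i ∈ Finset.range (M + 1), f i = ∑ i ∈ Finset.Icc 1 M, f i + f 0 := by
    intro f
    rw [Finset.sum_range_succ', Finset.range_eq_Ico, Finset.sum_Ico_add' f 0 M 1]
    rfl
  have hS := sum_max_sq_sub_sq_le M hr
  rw [Finset.sum_product, hrange, hrange]
  simp only [hrange]
  rw [Finset.sum_add_distrib]
  have e1 : rieszFull M (r ^ 2) = ∑ i ∈ Finset.Icc 1 M, ∑ j ∈ Finset.Icc 1 M,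
      max (r ^ 2 - hexNorm i j) 0 := by
    rw [rieszFull, latticeBox, Finset.sum_product]
  have e2 : ∀ i : ℕ, (hexNorm i 0 : ℝ) = (i : ℝ) ^ 2 := fun i => by simp [hexNorm]
  have e3 : ∀ i : ℕ, (hexNorm 0 i : ℝ) = (i : ℝ) ^ 2 := fun i => by simp [hexNorm]
  simp only [e2, e3, ← e1]
  have : max (r ^ 2 - ((0 : ℕ) : ℝ) ^ 2) 0 = r ^ 2 := by
    rw [max_eq_left] <;> simp; positivity
  rw [this]
  linarith

/-- Comparison of the Riesz means at levels `c t` and `t`, up to the boundary terms of the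
larger index set. It is the limit `θ → ∞` of the comparison on lattices refined `θ` times. -/
lemma rieszHalf_le_rieszFull_add (M M' : ℕ) {c r : ℝ} (hc : 0 < c) (hr : 0 ≤ r)
    (hM : r ^ 2 ≤ (M : ℝ) ^ 2) :
    rieszHalf M' (c * r ^ 2) ≤ c ^ 2 / 2 * (rieszFull M (r ^ 2) + (4 / 3 * r ^ 3 + r ^ 2)) := by
  set A := rieszFull M (r ^ 2) + (4 / 3 * r ^ 3 + r ^ 2)
  have hstep : ∀ θ : ℕ, rieszHalf M' (c * r ^ 2) ≤
      c / 2 * (Real.sqrt c + 1 / ((θ : ℝ) + 1)) ^ 2 * A := by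
    intro n
    obtain ⟨θ, hθ, hθ'⟩ : ∃ θ : ℕ, 0 < θ ∧ θ = n + 1 := ⟨n + 1, by omega, rfl⟩
    have hθn : (θ : ℝ) = n + 1 := by rw [hθ']; push_cast; ring
    rw [← hθn]
    have hθ0 : (0 : ℝ) < θ := by exact_mod_cast hθ
    set φ : ℝ := θ * Real.sqrt c with hφ
    have hφ0 : 0 < φ := mul_pos hθ0 (Real.sqrt_pos.2 hc)
    have hφ2 : φ ^ 2 = (θ : ℝ) ^ 2 * c := by rw [hφ, mul_pow, Real.sq_sqrt hc.le]
    have h1 := pow_four_mul_rieszHalf_le M' θ (c * r ^ 2)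
    have h2 := two_mul_rieszHalf_le (θ * M') ((θ : ℝ) ^ 2 * (c * r ^ 2))
    have h3 := rieszFull_le_sum_range M (θ * M') hφ0 hM
    have h4 := sum_range_le_rieszFull_add M hr
    have h5 : (θ : ℝ) ^ 2 * (c * r ^ 2) = φ ^ 2 * r ^ 2 := by rw [hφ2]; ring
    rw [h5] at h1 h2
    have h6 : (θ : ℝ) ^ 4 * rieszHalf M' (c * r ^ 2) ≤ φ ^ 2 * (φ + 1) ^ 2 / 2 * A := by
      have : _ ≤ φ ^ 2 * (φ + 1) ^ 2 * A := mul_le_mul_of_nonneg_left h4 (by positivity)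
      linarith
    have h7 : φ ^ 2 * (φ + 1) ^ 2 / 2 * A =
        (θ : ℝ) ^ 4 * (c / 2 * (Real.sqrt c + 1 / (θ : ℝ)) ^ 2 * A) := by
      rw [hφ2, hφ]; field_simp
    rw [h7] at h6
    exact le_of_mul_le_mul_left h6 (by positivity)
  have hlim : Filter.Tendsto (fun θ : ℕ => c / 2 * (Real.sqrt c + 1 / ((θ : ℝ) + 1)) ^ 2 * A)
      Filter.atTop (nhds (c / 2 * (Real.sqrt c + 0) ^ 2 * A)) :=
    (((tendsto_const_nhds.add tendsto_one_div_add_atTop_nhds_zero_nat).pow 2).const_mul _).mul_const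
      _
  have := ge_of_tendsto' hlim hstep
  rw [add_zero, Real.sq_sqrt hc.le] at this
  linarith [this]

/-! ### The factor in the comparison of the Riesz means -/

/-- `sumTo f n = f 1 + ⋯ + f n`, in a form that the kernel evaluates quickly. -/
def sumTo (f : ℕ → ℕ) (n : ℕ) : ℕ := Nat.rec 0 (fun k acc => f (k + 1) + acc) n

lemma sumTo_eq (f : ℕ → ℕ) (n : ℕ) : sumTo f n = ∑ i ∈ Finset.Icc 1 n, f i := by
  induction n with
  | zero => rfl
  | succ n ih =>
    rw [Finset.sum_Icc_succ_top (by omega), ← ih]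
    exact Nat.add_comm (f (n + 1)) (sumTo f n)

/-- Integer version of `rieszFull`; the truncated subtraction is the positive part. -/
def natRieszFull (m t : ℕ) : ℕ := sumTo (fun p => sumTo (fun q => t - hexNorm p q) m) m

/-- Integer version of `6 * rieszHalf m (11 / 6 * t)`. -/
def natRieszHalf (m t : ℕ) : ℕ :=
  sumTo (fun p => sumTo (fun q => 11 * t - 6 * hexNorm p q) (p - 1)) m

lemma natCast_tsub_eq_max (a b : ℕ) : ((a - b : ℕ) : ℝ) = max ((a : ℝ) - b) 0 := by
  rcases le_total b a with h | h
  · rw [Nat.cast_sub h, max_eq_left]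
    have : (b : ℝ) ≤ a := by exact_mod_cast h
    linarith
  · rw [Nat.sub_eq_zero_of_le h, max_eq_right]
    · simp
    have : (a : ℝ) ≤ b := by exact_mod_cast h
    linarith

lemma natCast_natRieszFull (m t : ℕ) : (natRieszFull m t : ℝ) = rieszFull m t := by
  simp only [natRieszFull, sumTo_eq, rieszFull, latticeBox, Finset.sum_product]
  push_cast [natCast_tsub_eq_max]
  rfl

lemma rieszHalf_eq_sum (m : ℕ) (T : ℝ) : rieszHalf m T =
    ∑ p ∈ Finset.Icc 1 m, ∑ q ∈ Finset.Icc 1 (p - 1), max (T - hexNorm p q) 0 := by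
  rw [rieszHalf, Finset.sum_sigma']
  refine Finset.sum_nbij' (fun x => ⟨x.1, x.2⟩) (fun x => (x.1, x.2)) ?_ ?_ ?_ ?_ ?_
  · intro x hx
    rw [mem_latticeHalfBox] at hx
    simp only [Finset.mem_sigma, Finset.mem_Icc]
    omega
  · rintro ⟨p, q⟩ hx
    rw [mem_latticeHalfBox]
    simp only [Finset.mem_sigma, Finset.mem_Icc] at *
    omega
  all_goals simp

lemma natCast_natRieszHalf (m t : ℕ) :
    (natRieszHalf m t : ℝ) = 6 * rieszHalf m (11 / 6 * t) := by
  rw [rieszHalf_eq_sum, Finset.mul_sum]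
  simp only [natRieszHalf, sumTo_eq, Finset.mul_sum]
  push_cast [natCast_tsub_eq_max]
  refine Finset.sum_congr rfl fun p _ => Finset.sum_congr rfl fun q _ => ?_
  rw [mul_max_of_nonneg _ _ (by norm_num), mul_zero]
  congr 1
  ring

/-- Checks `rieszHalf (11 / 6 * nx) ≤ 11 / 6 * rieszFull t` for successive intervals `[t, nx]`
until `3400` is reached; `m` is an index cutoff that keeps pace with `√(2 t)`. -/
def rieszCheck (fuel t m : ℕ) : Bool :=
  Nat.rec (fun t _ => decide (3400 ≤ t)) (fun _ ih t m =>
    let nx := t + t / 25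
    let m' := if m * m < 2 * nx then m + 2 else m
    decide (11 * nx ≤ 6 * (m' * m')) && decide (natRieszHalf m' nx ≤ 11 * natRieszFull m' t) &&
      ih (nx + 1) m') fuel t m

lemma rieszHalf_le_of_rieszCheck (M' : ℕ) : ∀ fuel t m : ℕ, rieszCheck fuel t m = true →
    ∀ s M : ℕ, t ≤ s → s < 3400 → s ≤ M ^ 2 →
      rieszHalf M' (11 / 6 * s) ≤ 11 / 6 * rieszFull M s := by
  intro fuel
  induction fuel with
  | zero =>
    intro t m h s M hs hs' _
    have : 3400 ≤ t := of_decide_eq_true h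
    omega
  | succ fuel ih =>
    intro t m h s M hs hs' hM
    set nx := t + t / 25 with hnx
    set m' := if m * m < 2 * nx then m + 2 else m with hm'
    have h : (decide (11 * nx ≤ 6 * (m' * m')) &&
      decide (natRieszHalf m' nx ≤ 11 * natRieszFull m' t) && rieszCheck fuel (nx + 1) m') = true := h
    simp only [Bool.and_eq_true, decide_eq_true_eq] at h
    obtain ⟨⟨h1, h2⟩, h3⟩ := h
    rcases Nat.lt_or_ge nx s with hlt | hge
    · exact ih (nx + 1) m' h3 s M hlt hs' hM
    · have h1' : (11 : ℝ) * nx ≤ 6 * (m' * m') := by exact_mod_cast h1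
      have h2' : (natRieszHalf m' nx : ℝ) ≤ 11 * natRieszFull m' t := by exact_mod_cast h2
      rw [natCast_natRieszFull, natCast_natRieszHalf] at h2'
      have hs1 : (s : ℝ) ≤ nx := by exact_mod_cast hge
      have hs2 : (t : ℝ) ≤ s := by exact_mod_cast hs
      have hM' : (s : ℝ) ≤ (M : ℝ) ^ 2 := by exact_mod_cast hM
      have e1 : rieszHalf M' (11 / 6 * s) ≤ rieszHalf m' (11 / 6 * s) :=
        rieszHalf_le_box (by nlinarith)
      have e2 : rieszHalf m' (11 / 6 * s) ≤ rieszHalf m' (11 / 6 * nx) :=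
        rieszHalf_mono _ (by linarith)
      have e3 : rieszFull m' t ≤ rieszFull m' s := rieszFull_mono _ hs2
      have e4 : rieszFull m' s ≤ rieszFull M s := rieszFull_le_box hM'
      linarith

lemma rieszCheck_eq_true : rieszCheck 139 1 1 = true := by decide +kernel

lemma le_natRieszFull_ten_thousand :
    14500000 ≤ sumTo (fun p => sumTo (fun q => 10000 - hexNorm p q) (p - 1)) 100 := by
  decide +kernel

lemma le_rieszHalf_ten_thousand : (14500000 : ℝ) ≤ rieszHalf 100 10000 := by
  have h : ((14500000 : ℕ) : ℝ) ≤ _ := Nat.cast_le.2 le_natRieszFull_ten_thousand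
  simp only [sumTo_eq] at h
  rw [rieszHalf_eq_sum]
  push_cast [natCast_tsub_eq_max] at h
  exact h

/-- The Riesz means of the lattice spectra of the half equilateral triangle and of the equilateral
triangle compare with the factor `11 / 6`. The asymptotic ratio would be `2`. -/
theorem rieszHalf_le_rieszFull (t M M' : ℕ) (hM : t ≤ M ^ 2) :
    rieszHalf M' (11 / 6 * t) ≤ 11 / 6 * rieszFull M t := by
  rcases Nat.eq_zero_or_pos t with rfl | ht0
  · have h1 : rieszHalf M' (11 / 6 * ((0 : ℕ) : ℝ)) ≤ rieszHalf 0 (11 / 6 * ((0 : ℕ) : ℝ)) :=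
      rieszHalf_le_box (by simp)
    have h0 : rieszHalf 0 (11 / 6 * ((0 : ℕ) : ℝ)) = 0 := by
      simp [rieszHalf, latticeHalfBox, latticeBox]
    exact h1.trans (h0.le.trans (mul_nonneg (by norm_num) (rieszFull_nonneg _ _)))
  rcases Nat.lt_or_ge t 3400 with ht | ht
  · exact rieszHalf_le_of_rieszCheck M' 139 1 1 rieszCheck_eq_true t M ht0 ht hM
  -- For `t ≥ 3400` the lattice refinement bound has a boundary term of lower order. Applied with the
  -- fixed argument `10000`, where `rieszHalf 100 10000 ≥ 14500000 = 10000² / 2 * 0.29`, it says that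
  -- `rieszFull M t` is at least `0.29 * t²` up to that boundary term, so the term is absorbed by the
  -- gap between the ratio `(11 / 6)² / 2` and the desired `11 / 6`.
  · set r := Real.sqrt t with hr
    have hr0 : 0 ≤ r := Real.sqrt_nonneg _
    have hr2 : r ^ 2 = t := Real.sq_sqrt (Nat.cast_nonneg t)
    have ht' : (3400 : ℝ) ≤ t := by exact_mod_cast ht
    have hr58 : 58 ≤ r := by
      rw [hr]; apply Real.le_sqrt_of_sq_le; norm_num; linarith
    have hM' : r ^ 2 ≤ (M : ℝ) ^ 2 := by rw [hr2]; exact_mod_cast hM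
    have h1 := rieszHalf_le_rieszFull_add M M' (c := 11 / 6) (by norm_num) hr0 hM'
    have hpos : 0 < r ^ 2 := by positivity
    have h2 := rieszHalf_le_rieszFull_add M 100 (c := 10000 / r ^ 2) (by positivity) hr0 hM'
    rw [div_mul_cancel₀ _ hpos.ne'] at h2
    have h3 := le_rieszHalf_ten_thousand.trans h2
    rw [hr2] at h1
    rw [← hr2] at h1 ⊢
    set A := rieszFull M (r ^ 2)
    have h4 : 0.29 * r ^ 4 ≤ A + (4 / 3 * r ^ 3 + r ^ 2) := by
      have h5 : (10000 / r ^ 2) ^ 2 / 2 * (A + (4 / 3 * r ^ 3 + r ^ 2)) =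
          50000000 * (A + (4 / 3 * r ^ 3 + r ^ 2)) / r ^ 4 := by
        field_simp; ring
      rw [h5, le_div_iff₀ (by positivity)] at h3
      linarith
    have h6 : 16 * r ^ 3 + 12 * r ^ 2 ≤ 0.29 * r ^ 4 := by
      have : 16 * r + 12 ≤ 0.29 * r ^ 2 := by nlinarith
      nlinarith [mul_le_mul_of_nonneg_right this hpos.le]
    linarith

/-! ### Parseval's identity for functions that embed in the torus -/

section Parseval

open MeasureTheory

variable {ι : Type*}

/-- An integer vector as a real vector. -/
def intVec (z : ι → ℤ) : ι → ℝ := fun i => (z i : ℝ)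

/-- The half-open unit cube with lower corner `z`. -/
def unitCube (z : ι → ℤ) : Set (ι → ℝ) := {x | ∀ i, x i ∈ Set.Ioc (z i : ℝ) (z i + 1)}

lemma unitCube_disjoint {z z' : ι → ℤ} (h : z ≠ z') : Disjoint (unitCube z) (unitCube z') := by
  rw [Set.disjoint_left]
  intro x hx hx'
  apply h
  funext i
  have h1 := hx i
  have h2 := hx' i
  have h3 : (z i : ℝ) < z' i + 1 := h1.1.trans_le h2.2
  have h4 : (z' i : ℝ) < z i + 1 := h2.1.trans_le h1.2
  have h3 : z i < z' i + 1 := by exact_mod_cast h3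
  have h4 : z' i < z i + 1 := by exact_mod_cast h4
  omega

lemma mem_unitCube_ceil (x : ι → ℝ) : x ∈ unitCube fun i => ⌈x i⌉ - 1 := by
  intro i
  push_cast
  exact ⟨by linarith [Int.ceil_lt_add_one (x i)], by linarith [Int.le_ceil (x i)]⟩

variable [Fintype ι]

/-- The circle `ℝ / ℤ` carries the Haar measure of total mass one, as in the theory of Fourier
series on `UnitAddTorus`. -/
noncomputable local instance : MeasureSpace UnitAddCircle := ⟨AddCircle.haarAddCircle⟩

local instance : Measure.IsAddHaarMeasure (volume : Measure UnitAddCircle) :=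
  inferInstanceAs (Measure.IsAddHaarMeasure AddCircle.haarAddCircle)

local instance : IsProbabilityMeasure (volume : Measure UnitAddCircle) :=
  inferInstanceAs (IsProbabilityMeasure AddCircle.haarAddCircle)

/-- The character `x ↦ exp (2πi k·x)`. -/
noncomputable def planeWave (k : ι → ℤ) (x : ι → ℝ) : ℂ :=
  Complex.exp (2 * Real.pi * Complex.I * ∑ i, (k i : ℂ) * (x i : ℂ))

/-- The Fourier coefficient `∫ exp (-2πi k·x) f x dx`, with the integral over the whole space. -/
noncomputable def latticeCoeff (f : (ι → ℝ) → ℂ) (k : ι → ℤ) : ℂ := ∫ x, planeWave (-k) x * f x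

lemma mFourier_coe (k : ι → ℤ) (x : ι → ℝ) :
    UnitAddTorus.mFourier k (fun i => (x i : UnitAddCircle)) = planeWave k x := by
  simp only [UnitAddTorus.mFourier, ContinuousMap.coe_mk, fourier_coe_apply, planeWave,
    Finset.mul_sum, Complex.exp_sum]
  refine Finset.prod_congr rfl fun i _ => ?_
  congr 1
  push_cast
  ring

lemma planeWave_add_intVec (k : ι → ℤ) (x : ι → ℝ) (z : ι → ℤ) :
    planeWave k (x + intVec z) = planeWave k x := by
  rw [← mFourier_coe, ← mFourier_coe]
  congr 1
  funext i
  simp [intVec]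

lemma continuous_planeWave (k : ι → ℤ) : Continuous (planeWave k) := by
  unfold planeWave; fun_prop

lemma measurableSet_unitCube (z : ι → ℤ) : MeasurableSet (unitCube z) := by
  have : unitCube z = Set.univ.pi fun i => Set.Ioc (z i : ℝ) (z i + 1) := by
    ext x; simp [unitCube]
  rw [this]
  exact MeasurableSet.univ_pi fun _ => measurableSet_Ioc

/-- The integer points `z` with `-N ≤ z < N`. -/
noncomputable def intBox (ι : Type*) [Fintype ι] (N : ℕ) : Finset (ι → ℤ) :=
  open Classical in Fintype.piFinset fun _ => Finset.Ico (-(N : ℤ)) N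

lemma ceil_mem_intBox {N : ℕ} {x : ι → ℝ} (hx : ∀ i, |x i| < N) :
    (fun i => ⌈x i⌉ - 1) ∈ intBox ι N := by
  classical
  rw [intBox, Fintype.mem_piFinset]
  intro i
  obtain ⟨h1, h2⟩ := abs_lt.1 (hx i)
  rw [Finset.mem_Ico]
  constructor
  · have : (-(N : ℤ)) < ⌈x i⌉ := Int.lt_ceil.2 (by push_cast; exact h1)
    omega
  · have : ⌈x i⌉ ≤ (N : ℤ) := Int.ceil_le.2 (by push_cast; exact h2.le)
    omega

lemma integral_eq_setIntegral_sum_translates {E : Type*} [NormedAddCommGroup E] [NormedSpace ℝ E]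
    {g : (ι → ℝ) → E} (hg : Integrable g) {N : ℕ} (hN : ∀ x, g x ≠ 0 → ∀ i, |x i| < N) :
    ∫ x, g x = ∫ x in unitCube 0, ∑ z ∈ intBox ι N, g (x + intVec z) := by
  have h1 : ∫ x, g x = ∫ x in ⋃ z ∈ intBox ι N, unitCube z, g x := by
    symm
    apply setIntegral_eq_integral_of_forall_compl_eq_zero
    intro x hx
    by_contra hne
    apply hx
    simp only [Set.mem_iUnion]
    exact ⟨_, ceil_mem_intBox (hN x hne), mem_unitCube_ceil x⟩
  rw [h1, integral_biUnion_finset _ (fun z _ => measurableSet_unitCube z)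
    (fun z _ z' _ h => unitCube_disjoint h) (fun z _ => hg.integrableOn)]
  rw [integral_finsetSum _ (fun z _ => ((hg.comp_add_right (intVec z)).integrableOn))]
  refine Finset.sum_congr rfl fun z _ => ?_
  have hpre : (fun x : ι → ℝ => x + intVec z) ⁻¹' unitCube z = unitCube 0 := by
    ext x
    simp only [unitCube, Set.mem_preimage, Set.mem_ofPred_eq, Pi.add_apply, intVec, Set.mem_Ioc,
      Pi.zero_apply, Int.cast_zero, zero_add]
    refine forall_congr' fun i => ?_
    constructor <;> rintro ⟨h1, h2⟩ <;> constructor <;> linarith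
  rw [← hpre]
  exact ((measurePreserving_add_right volume (intVec z)).setIntegral_preimage_emb
    (measurableEmbedding_addRight (intVec z)) g (unitCube z)).symm

/-- **Parseval's identity** for a compactly supported function whose support meets each coset of
the integer lattice at most once. -/
theorem hasSum_sq_latticeCoeff {f : (ι → ℝ) → ℂ} (hf : Continuous f) (hc : HasCompactSupport f)
    (hinj : ∀ x (z : ι → ℤ), f x ≠ 0 → f (x + intVec z) ≠ 0 → z = 0) :
    HasSum (fun k : ι → ℤ => ‖latticeCoeff f k‖ ^ 2) (∫ x, ‖f x‖ ^ 2) := by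
  classical
  obtain ⟨N, hN⟩ : ∃ N : ℕ, ∀ x, f x ≠ 0 → ∀ i, |x i| < N := by
    obtain ⟨R, hR⟩ := hc.isCompact.isBounded.exists_norm_le
    obtain ⟨N, hN⟩ := exists_nat_gt R
    refine ⟨N, fun x hx i => ?_⟩
    have h1 : ‖x‖ ≤ R := hR x (subset_tsupport f hx)
    have h2 : |x i| ≤ ‖x‖ := by rw [← Real.norm_eq_abs]; exact norm_le_pi_norm x i
    linarith
  obtain ⟨C, hC⟩ := hc.exists_bound_of_continuous hf
  set per : (ι → ℝ) → ℂ := fun x => ∑ z ∈ intBox ι N, f (x + intVec z) with hper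
  have hperc : Continuous per := by
    apply continuous_finsetSum
    intro z _
    exact hf.comp (continuous_id.add continuous_const)
  have hperb : ∀ x, ‖per x‖ ≤ (intBox ι N).card * C := by
    intro x
    refine (norm_sum_le _ _).trans ?_
    refine (Finset.sum_le_card_nsmul _ _ C fun z _ => hC _).trans ?_
    rw [nsmul_eq_mul]
  let F : UnitAddTorus ι → ℂ := fun θ => per (UnitAddTorus.measurableEquivPiIoc (0 : ι → ℝ) θ).1
  have hFm : Measurable F :=
    hperc.measurable.comp
      (measurable_subtype_coe.comp (UnitAddTorus.measurableEquivPiIoc (0 : ι → ℝ)).measurable)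
  have hF : MemLp F 2 (volume : Measure (UnitAddTorus ι)) :=
    MemLp.of_bound hFm.aestronglyMeasurable _ (Filter.Eventually.of_forall fun θ => hperb _)
  have hFx : ∀ x ∈ unitCube (0 : ι → ℤ), F (fun i => (x i : UnitAddCircle)) = per x := by
    intro x hx
    have hx' : ∀ i, x i ∈ Set.Ioc ((0 : ι → ℝ) i) ((0 : ι → ℝ) i + 1) := by
      intro i; simpa using hx i
    have : UnitAddTorus.measurableEquivPiIoc (0 : ι → ℝ) (fun i => (x i : UnitAddCircle)) =
        ⟨x, hx'⟩ := by
      have h : (UnitAddTorus.measurableEquivPiIoc (0 : ι → ℝ)).symm ⟨x, hx'⟩ =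
        fun i => (x i : UnitAddCircle) := rfl
      rw [← h, MeasurableEquiv.apply_symm_apply]
    simp only [F, this]
  have hcube : {x : ι → ℝ | ∀ i, x i ∈ Set.Ioc ((0 : ι → ℝ) i) ((0 : ι → ℝ) i + 1)} =
      unitCube (0 : ι → ℤ) := by
    ext x; simp [unitCube]
  have hP := UnitAddTorus.hasSum_sq_mFourierCoeff hF.toLp
  have hint : ∫ t, ‖hF.toLp F t‖ ^ 2 = ∫ x, ‖f x‖ ^ 2 := by
    have e1 : ∫ t, ‖hF.toLp F t‖ ^ 2 = ∫ t, ‖F t‖ ^ 2 := by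
      apply integral_congr_ae
      filter_upwards [hF.coeFn_toLp] with t ht
      rw [ht]
    rw [e1, UnitAddTorus.integral_preimage _ (0 : ι → ℝ), hcube]
    have hi : Integrable fun x => ‖f x‖ ^ 2 := by
      apply Continuous.integrable_of_hasCompactSupport (by fun_prop)
      exact hc.comp_left (g := fun z : ℂ => ‖z‖ ^ 2) (by simp)
    rw [integral_eq_setIntegral_sum_translates hi (N := N) (fun x hx => hN x (by
      intro h; apply hx; simp [h]))]
    refine setIntegral_congr_fun (measurableSet_unitCube 0) fun x hx => ?_
    rw [hFx x hx]
    change ‖∑ z ∈ intBox ι N, f (x + intVec z)‖ ^ 2 = _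
    by_cases hall : ∀ z ∈ intBox ι N, f (x + intVec z) = 0
    · rw [Finset.sum_eq_zero hall, Finset.sum_eq_zero (fun z hz => by rw [hall z hz]; simp)]
      simp
    · push Not at hall
      obtain ⟨z₀, hz₀, hne⟩ := hall
      have huniq : ∀ z, z ≠ z₀ → f (x + intVec z) = 0 := by
        intro z hz
        by_contra hzne
        have hxz : x + intVec z = (x + intVec z₀) + intVec (z - z₀) := by
          funext i; simp [intVec]
        rw [hxz] at hzne
        exact hz (sub_eq_zero.1 (hinj _ _ hne hzne))
      rw [Finset.sum_eq_single_of_mem z₀ hz₀ (fun z _ hz => huniq z hz),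
        Finset.sum_eq_single_of_mem z₀ hz₀ (fun z _ hz => by rw [huniq z hz]; simp)]
  rw [hint] at hP
  refine hP.congr_fun fun k => ?_
  congr 2
  have e1 : UnitAddTorus.mFourierCoeff (hF.toLp F) k = UnitAddTorus.mFourierCoeff F k := by
    apply integral_congr_ae
    filter_upwards [hF.coeFn_toLp] with t ht
    rw [ht]
  rw [e1, UnitAddTorus.mFourierCoeff_eq_integral _ _ (0 : ι → ℝ), hcube, latticeCoeff]
  have hi : Integrable fun x => planeWave (-k) x * f x := by
    apply Continuous.integrable_of_hasCompactSupport ((continuous_planeWave _).mul hf)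
    exact hc.mul_left
  rw [integral_eq_setIntegral_sum_translates hi (N := N) (fun x hx => hN x (by
      intro h; apply hx; simp [h]))]
  refine setIntegral_congr_fun (measurableSet_unitCube 0) fun x hx => ?_
  simp only [planeWave_add_intVec, ← Finset.mul_sum]
  rw [hFx x hx, mFourier_coe]
  rfl

/-- The coefficients of a directional derivative. -/
lemma latticeCoeff_fderiv {f : (ι → ℝ) → ℂ} (hf : ContDiff ℝ 1 f) (hc : HasCompactSupport f)
    (k : ι → ℤ) (v : ι → ℝ) :
    latticeCoeff (fun x => fderiv ℝ f x v) k =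
      2 * Real.pi * Complex.I * (∑ i, (k i : ℂ) * (v i : ℂ)) * latticeCoeff f k := by
  have hw : ∀ x, HasFDerivAt (planeWave (-k))
      (planeWave (-k) x • (2 * Real.pi * Complex.I) •
        ∑ i, ((-k) i : ℂ) • (Complex.ofRealCLM.comp (ContinuousLinearMap.proj i : (ι → ℝ) →L[ℝ] ℝ))) x := by
    intro x
    unfold planeWave
    apply HasFDerivAt.cexp
    apply HasFDerivAt.const_mul
    refine HasFDerivAt.fun_sum fun i _ => ?_
    apply HasFDerivAt.const_mul
    exact (Complex.ofRealCLM.comp (ContinuousLinearMap.proj i : (ι → ℝ) →L[ℝ] ℝ)).hasFDerivAt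
  have hwv : ∀ x, fderiv ℝ (planeWave (-k)) x v =
      -(2 * Real.pi * Complex.I * (∑ i, (k i : ℂ) * (v i : ℂ))) * planeWave (-k) x := by
    intro x
    rw [(hw x).fderiv]
    simp [Finset.sum_neg_distrib]
    ring
  have hfd : Continuous fun x => fderiv ℝ f x v := by
    have := hf.continuous_fderiv (by norm_num)
    fun_prop
  have hfdc : HasCompactSupport fun x => fderiv ℝ f x v :=
    (hc.fderiv (𝕜 := ℝ)).comp_left (g := fun L : (ι → ℝ) →L[ℝ] ℂ => L v) (by simp)
  have hwc := continuous_planeWave (-k)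
  have hibp := integral_mul_fderiv_eq_neg_fderiv_mul_of_integrable (μ := volume)
    (f := planeWave (-k)) (g := f) (v := v) (𝕜 := ℂ) ?_ ?_ ?_ ?_ ?_
  · unfold latticeCoeff
    rw [hibp, ← integral_neg, ← integral_const_mul]
    congr 1
    funext x
    rw [hwv]; ring
  · simp only [hwv]
    apply Continuous.integrable_of_hasCompactSupport
    · exact (continuous_const.mul hwc).mul hf.continuous
    · exact hc.mul_left
  · exact Continuous.integrable_of_hasCompactSupport (hwc.mul hfd) hfdc.mul_left
  · exact Continuous.integrable_of_hasCompactSupport (hwc.mul hf.continuous) hc.mul_left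
  · exact fun x _ => (hw x).differentiableAt
  · exact fun x _ => (hf.differentiable (by norm_num)).differentiableAt

end Parseval

/-! ### Antisymmetrization and the Riesz-mean inequality on alcoves -/

section Folding

open MeasureTheory

/-- An integer matrix acting on the real plane. -/
noncomputable def matAct (g : Matrix (Fin 2) (Fin 2) ℤ) : (Fin 2 → ℝ) →L[ℝ] (Fin 2 → ℝ) :=
  LinearMap.toContinuousLinearMap (Matrix.mulVecLin (g.map (Int.cast : ℤ → ℝ)))

lemma matAct_apply_zero (g : Matrix (Fin 2) (Fin 2) ℤ) (x : Fin 2 → ℝ) :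
    matAct g x 0 = g 0 0 * x 0 + g 0 1 * x 1 := by
  simp [matAct, Matrix.mulVec, dotProduct, Fin.sum_univ_two]

lemma matAct_apply_one (g : Matrix (Fin 2) (Fin 2) ℤ) (x : Fin 2 → ℝ) :
    matAct g x 1 = g 1 0 * x 0 + g 1 1 * x 1 := by
  simp [matAct, Matrix.mulVec, dotProduct, Fin.sum_univ_two]

lemma matAct_mul (g h : Matrix (Fin 2) (Fin 2) ℤ) (x : Fin 2 → ℝ) :
    matAct (g * h) x = matAct g (matAct h x) := by
  ext i
  fin_cases i <;>
    simp [matAct_apply_zero, matAct_apply_one, Matrix.mul_apply, Fin.sum_univ_two] <;> ring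

lemma matAct_one (x : Fin 2 → ℝ) : matAct 1 x = x := by
  ext i
  fin_cases i <;> simp [matAct_apply_zero, matAct_apply_one]

lemma matAct_intVec (g : Matrix (Fin 2) (Fin 2) ℤ) (z : Fin 2 → ℤ) :
    matAct g (intVec z) = intVec (g.mulVec z) := by
  ext i
  fin_cases i <;>
    simp [matAct_apply_zero, matAct_apply_one, intVec, Matrix.mulVec, dotProduct, Fin.sum_univ_two]

lemma planeWave_matAct (k : Fin 2 → ℤ) (g : Matrix (Fin 2) (Fin 2) ℤ) (x : Fin 2 → ℝ) :
    planeWave k (matAct g x) = planeWave (Matrix.vecMul k g) x := by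
  simp only [planeWave, Fin.sum_univ_two, matAct_apply_zero, matAct_apply_one, Matrix.vecMul,
    dotProduct]
  congr 2
  push_cast
  ring

lemma integral_comp_matAct {E : Type*} [NormedAddCommGroup E] [NormedSpace ℝ E]
    {g : Matrix (Fin 2) (Fin 2) ℤ} (hg : g.det * g.det = 1) {F : (Fin 2 → ℝ) → E}
    (hF : Continuous F) : ∫ x, F (matAct g x) = ∫ x, F x := by
  have hdet : LinearMap.det ((matAct g : (Fin 2 → ℝ) →L[ℝ] (Fin 2 → ℝ)) :
      (Fin 2 → ℝ) →ₗ[ℝ] (Fin 2 → ℝ)) = (g.det : ℝ) := by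
    have : ((matAct g : (Fin 2 → ℝ) →L[ℝ] (Fin 2 → ℝ)) : (Fin 2 → ℝ) →ₗ[ℝ] (Fin 2 → ℝ)) =
      Matrix.toLin' (g.map (Int.cast : ℤ → ℝ)) := rfl
    rw [this, LinearMap.det_toLin']
    simp [Matrix.det_fin_two]
  have habs : |(g.det : ℝ)| = 1 := by
    have : (g.det : ℝ) * g.det = 1 := by exact_mod_cast hg
    rcases mul_self_eq_one_iff.1 this with h | h <;> simp [h]
  have hmap := Real.map_linearMap_volume_pi_eq_smul_volume_pi (f :=
    ((matAct g : (Fin 2 → ℝ) →L[ℝ] (Fin 2 → ℝ)) : (Fin 2 → ℝ) →ₗ[ℝ] (Fin 2 → ℝ)))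
    (by rw [hdet]; intro h; rw [h] at habs; simp at habs)
  rw [hdet, abs_inv, habs] at hmap
  simp only [inv_one, ENNReal.ofReal_one, one_smul] at hmap
  nth_rewrite 2 [← hmap]
  rw [integral_map]
  · rfl
  · exact (matAct g).continuous.aemeasurable
  · exact hF.aestronglyMeasurable

/-- The twelve automorphisms of the hexagonal lattice, written in a basis of simple coroots. -/
def hexSymmetries : Finset (Matrix (Fin 2) (Fin 2) ℤ) :=
  {!![1, 0; 0, 1], !![0, -1; 1, -1], !![-1, 1; -1, 0],
   !![-1, 1; 0, 1], !![1, 0; 1, -1], !![0, -1; -1, 0],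
   !![-1, 0; 0, -1], !![0, 1; -1, 1], !![1, -1; 1, 0],
   !![1, -1; 0, -1], !![-1, 0; -1, 1], !![0, 1; 1, 0]}

/-- The Weyl group of type `A₂`: the symmetries generated by the reflections in two sides of the
equilateral triangle. -/
def triSymmetries : Finset (Matrix (Fin 2) (Fin 2) ℤ) :=
  {!![1, 0; 0, 1], !![0, -1; 1, -1], !![-1, 1; -1, 0],
   !![-1, 1; 0, 1], !![1, 0; 1, -1], !![0, -1; -1, 0]}

/-- The norm form of the hexagonal lattice on frequencies. -/
def freqNorm (k : Fin 2 → ℤ) : ℤ := k 0 ^ 2 + k 0 * k 1 + k 1 ^ 2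

/-- The invariant Dirichlet form: half the sum of the squared derivatives in the three
root directions. -/
noncomputable def rootForm (L : (Fin 2 → ℝ) →L[ℝ] ℂ) : ℝ :=
  (‖L ![1, 0]‖ ^ 2 + ‖L ![0, 1]‖ ^ 2 + ‖L ![1, 1]‖ ^ 2) / 2

lemma det_mul_det_of_mem {g : Matrix (Fin 2) (Fin 2) ℤ} (hg : g ∈ hexSymmetries) :
    g.det * g.det = 1 := by
  revert g; decide

lemma matAct_mem_roots {g : Matrix (Fin 2) (Fin 2) ℤ} (v : Fin 2 → ℝ) :
    matAct g v = ![g 0 0 * v 0 + g 0 1 * v 1, g 1 0 * v 0 + g 1 1 * v 1] := by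
  ext i
  fin_cases i <;> simp [matAct_apply_zero, matAct_apply_one]

lemma rootForm_comp_matAct {g : Matrix (Fin 2) (Fin 2) ℤ} (hg : g ∈ hexSymmetries)
    (L : (Fin 2 → ℝ) →L[ℝ] ℂ) : rootForm (L.comp (matAct g)) = rootForm L := by
  have h1 : L ![-1, 0] = -L ![1, 0] := by rw [← map_neg]; simp
  have h2 : L ![0, -1] = -L ![0, 1] := by rw [← map_neg]; simp
  have h3 : L ![-1, -1] = -L ![1, 1] := by rw [← map_neg]; simp
  simp only [hexSymmetries, Finset.mem_insert, Finset.mem_singleton] at hg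
  rcases hg with rfl | rfl | rfl | rfl | rfl | rfl | rfl | rfl | rfl | rfl | rfl | rfl <;>
    simp [rootForm, matAct_mem_roots, h1, h2, h3] <;> ring

lemma freqNorm_vecMul {g : Matrix (Fin 2) (Fin 2) ℤ} (hg : g ∈ hexSymmetries) (k : Fin 2 → ℤ) :
    freqNorm (Matrix.vecMul k g) = freqNorm k := by
  simp only [hexSymmetries, Finset.mem_insert, Finset.mem_singleton] at hg
  rcases hg with rfl | rfl | rfl | rfl | rfl | rfl | rfl | rfl | rfl | rfl | rfl | rfl <;>
    simp [freqNorm, Matrix.vecMul, dotProduct, Fin.sum_univ_two] <;> ring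

/-- The integral of the Dirichlet form of `f`. -/
noncomputable def rootEnergy (f : (Fin 2 → ℝ) → ℂ) : ℝ := ∫ x, rootForm (fderiv ℝ f x)

/-- The antisymmetrization `∑ det g • f ∘ g` over a set of matrices. -/
noncomputable def signedFold (G : Finset (Matrix (Fin 2) (Fin 2) ℤ)) (f : (Fin 2 → ℝ) → ℂ)
    (x : Fin 2 → ℝ) : ℂ := ∑ g ∈ G, (g.det : ℂ) * f (matAct g x)

/-- A group `G` of symmetries of the hexagonal lattice with an alcove `A`, all of whose images
under `G` and integer translations are disjoint, and with a set `K` of frequencies that meets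
every orbit that is not fixed by a reflection. -/
structure IsFolding (G : Finset (Matrix (Fin 2) (Fin 2) ℤ)) (A : Set (Fin 2 → ℝ))
    (K : Set (Fin 2 → ℤ)) : Prop where
  subset : G ⊆ hexSymmetries
  one_mem : 1 ∈ G
  mul_mem : ∀ g ∈ G, ∀ h ∈ G, g * h ∈ G
  exists_inv : ∀ g ∈ G, ∃ h ∈ G, g * h = 1 ∧ h * g = 1
  disjoint : ∀ y ∈ A, ∀ g ∈ G, ∀ z, matAct g y + intVec z ∈ A → g = 1 ∧ z = 0
  cover : ∀ k, (∃ g ∈ G, g.det = -1 ∧ Matrix.vecMul k g = k) ∨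
    ∃ k₀ ∈ K, ∃ g ∈ G, k = Matrix.vecMul k₀ g
  free : ∀ k ∈ K, ∀ g ∈ G, ∀ h ∈ G, Matrix.vecMul k g = Matrix.vecMul k h → g = h

variable {G : Finset (Matrix (Fin 2) (Fin 2) ℤ)} {A : Set (Fin 2 → ℝ)} {K : Set (Fin 2 → ℤ)}
  {f : (Fin 2 → ℝ) → ℂ}

lemma IsFolding.eq_of_mem (hG : IsFolding G A K) {g h : Matrix (Fin 2) (Fin 2) ℤ} (hg : g ∈ G)
    (hh : h ∈ G) {x : Fin 2 → ℝ} {z : Fin 2 → ℤ} (hgx : matAct g x ∈ A)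
    (hhx : matAct h (x + intVec z) ∈ A) : g = h ∧ z = 0 := by
  obtain ⟨g', hg', h1, h2⟩ := hG.exists_inv g hg
  have hx : x = matAct g' (matAct g x) := by rw [← matAct_mul, h2, matAct_one]
  rw [map_add, matAct_intVec, hx, ← matAct_mul] at hhx
  obtain ⟨h3, h4⟩ := hG.disjoint _ hgx _ (hG.mul_mem h hh g' hg') _ hhx
  have hgh : h = g := by
    have : h * g' * g = g := by rw [h3, one_mul]
    rwa [mul_assoc, h2, mul_one] at this
  refine ⟨hgh.symm, ?_⟩
  rw [hgh] at h4
  have : Matrix.mulVec g' (Matrix.mulVec g z) = 0 := by rw [h4, Matrix.mulVec_zero]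
  rwa [Matrix.mulVec_mulVec, h2, Matrix.one_mulVec] at this

lemma map_sum_of_unique {α M N : Type*} [AddCommMonoid M] [AddCommMonoid N] (s : Finset α)
    (a : α → M) (Φ : M → N) (hΦ : Φ 0 = 0)
    (h : ∀ i ∈ s, ∀ j ∈ s, a i ≠ 0 → a j ≠ 0 → i = j) :
    Φ (∑ i ∈ s, a i) = ∑ i ∈ s, Φ (a i) := by
  by_cases hall : ∀ i ∈ s, a i = 0
  · rw [Finset.sum_eq_zero hall, hΦ, Finset.sum_eq_zero (fun i hi => by rw [hall i hi, hΦ])]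
  · push Not at hall
    obtain ⟨i, hi, hne⟩ := hall
    have h0 : ∀ j ∈ s, j ≠ i → a j = 0 := by
      intro j hj hji
      by_contra hc
      exact hji (h j hj i hi hc hne)
    rw [Finset.sum_eq_single_of_mem i hi h0,
      Finset.sum_eq_single_of_mem i hi (fun j hj hji => by rw [h0 j hj hji, hΦ])]

lemma det_eq_or (hg : G ⊆ hexSymmetries) {g : Matrix (Fin 2) (Fin 2) ℤ} (h : g ∈ G) :
    g.det = 1 ∨ g.det = -1 := by
  have := det_mul_det_of_mem (hg h)
  exact mul_self_eq_one_iff.1 this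

lemma signedFold_matAct (hG : IsFolding G A K) {h : Matrix (Fin 2) (Fin 2) ℤ} (hh : h ∈ G)
    (x : Fin 2 → ℝ) : signedFold G f (matAct h x) = h.det * signedFold G f x := by
  obtain ⟨h', hh', h1, h2⟩ := hG.exists_inv h hh
  unfold signedFold
  rw [Finset.mul_sum]
  refine Finset.sum_nbij' (fun g => g * h) (fun g => g * h') ?_ ?_ ?_ ?_ ?_
  · exact fun g hg => hG.mul_mem g hg h hh
  · exact fun g hg => hG.mul_mem g hg h' hh'
  · intro g _; simp [mul_assoc, h1]
  · intro g _; simp [mul_assoc, h2]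
  · intro g _
    rw [matAct_mul, Matrix.det_mul, Int.cast_mul]
    have : (h.det : ℂ) * h.det = 1 := by exact_mod_cast det_mul_det_of_mem (hG.subset hh)
    linear_combination (-(g.det : ℂ) * f (matAct g (matAct h x))) * this

lemma signedFold_contDiff (hf : ContDiff ℝ 1 f) : ContDiff ℝ 1 (signedFold G f) := by
  unfold signedFold
  refine ContDiff.sum fun g _ => contDiff_const.mul (hf.comp (matAct g).contDiff)

lemma latticeCoeff_signedFold_vecMul (hG : IsFolding G A K) (hf : ContDiff ℝ 1 f)
    {h : Matrix (Fin 2) (Fin 2) ℤ} (hh : h ∈ G) (k : Fin 2 → ℤ) :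
    latticeCoeff (signedFold G f) (Matrix.vecMul k h) =
      h.det * latticeCoeff (signedFold G f) k := by
  have hc : (h.det : ℂ) * h.det = 1 := by exact_mod_cast det_mul_det_of_mem (hG.subset hh)
  unfold latticeCoeff
  rw [← integral_comp_matAct (det_mul_det_of_mem (hG.subset hh))
    (F := fun x => planeWave (-k) x * signedFold G f x)
    ((continuous_planeWave _).mul (signedFold_contDiff hf).continuous), ← integral_const_mul]
  congr 1
  funext x
  rw [planeWave_matAct, signedFold_matAct hG hh, Matrix.neg_vecMul]
  linear_combination (-(planeWave (-Matrix.vecMul k h) x) * signedFold G f x) * hc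

lemma hasCompactSupport_comp_matAct {β : Type*} [Zero β] {f : (Fin 2 → ℝ) → β}
    (hG : IsFolding G A K) (hc : HasCompactSupport f)
    {g : Matrix (Fin 2) (Fin 2) ℤ} (hg : g ∈ G) :
    HasCompactSupport fun x => f (matAct g x) := by
  obtain ⟨g', hg', h1, h2⟩ := hG.exists_inv g hg
  refine HasCompactSupport.of_support_subset_isCompact (hc.isCompact.image (matAct g').continuous) ?_
  intro x hx
  refine ⟨matAct g x, subset_tsupport f hx, ?_⟩
  rw [← matAct_mul, h2, matAct_one]

lemma signedFold_hasCompactSupport (hG : IsFolding G A K) (hc : HasCompactSupport f) :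
    HasCompactSupport (signedFold G f) := by
  have hK : IsCompact (⋃ g ∈ G, tsupport fun x => f (matAct g x)) :=
    G.isCompact_biUnion fun g hg => hasCompactSupport_comp_matAct hG hc hg
  refine HasCompactSupport.of_support_subset_isCompact hK ?_
  intro x hx
  obtain ⟨g, hg, hne⟩ := Finset.exists_ne_zero_of_sum_ne_zero hx
  simp only [Set.mem_iUnion]
  exact ⟨g, hg, subset_tsupport _ (right_ne_zero_of_mul hne)⟩

lemma signedFold_injOn (hG : IsFolding G A K) (hA : tsupport f ⊆ A) (x : Fin 2 → ℝ)
    (z : Fin 2 → ℤ) (hx : signedFold G f x ≠ 0) (hxz : signedFold G f (x + intVec z) ≠ 0) :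
    z = 0 := by
  obtain ⟨g, hg, hne⟩ := Finset.exists_ne_zero_of_sum_ne_zero hx
  obtain ⟨h, hh, hne'⟩ := Finset.exists_ne_zero_of_sum_ne_zero hxz
  exact (hG.eq_of_mem hg hh (hA (subset_tsupport f (right_ne_zero_of_mul hne)))
    (hA (subset_tsupport f (right_ne_zero_of_mul hne')))).2

lemma IsFolding.eq_of_mem' (hG : IsFolding G A K) {g h : Matrix (Fin 2) (Fin 2) ℤ} (hg : g ∈ G)
    (hh : h ∈ G) {x : Fin 2 → ℝ} (hgx : matAct g x ∈ A) (hhx : matAct h x ∈ A) : g = h := by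
  refine (hG.eq_of_mem hg hh (z := 0) hgx ?_).1
  have : x + intVec 0 = x := by funext i; simp [intVec]
  rwa [this]

lemma norm_det_eq_one (hG : IsFolding G A K) {g : Matrix (Fin 2) (Fin 2) ℤ} (hg : g ∈ G) :
    ‖(g.det : ℂ)‖ = 1 := by
  rcases det_eq_or hG.subset hg with h | h <;> simp [h]

lemma integral_norm_signedFold_sq (hG : IsFolding G A K) (hf : Continuous f)
    (hc : HasCompactSupport f) (hA : tsupport f ⊆ A) :
    ∫ x, ‖signedFold G f x‖ ^ 2 = G.card * ∫ x, ‖f x‖ ^ 2 := by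
  have hpt : ∀ x, ‖signedFold G f x‖ ^ 2 = ∑ g ∈ G, ‖f (matAct g x)‖ ^ 2 := by
    intro x
    unfold signedFold
    rw [map_sum_of_unique G (fun g => (g.det : ℂ) * f (matAct g x)) (fun w : ℂ => ‖w‖ ^ 2) (by simp)]
    · refine Finset.sum_congr rfl fun g hg => ?_
      rw [norm_mul, norm_det_eq_one hG hg, one_mul]
    · intro g hg h hh h1 h2
      exact hG.eq_of_mem' hg hh (hA (subset_tsupport f (right_ne_zero_of_mul h1)))
        (hA (subset_tsupport f (right_ne_zero_of_mul h2)))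
  have hsq : Continuous fun x => ‖f x‖ ^ 2 := by fun_prop
  simp only [hpt]
  rw [integral_finsetSum]
  · rw [Finset.sum_congr rfl (fun g hg => integral_comp_matAct
      (det_mul_det_of_mem (hG.subset hg)) hsq), Finset.sum_const, nsmul_eq_mul]
  · intro g hg
    apply Continuous.integrable_of_hasCompactSupport
    · exact hsq.comp (matAct g).continuous
    · exact (hasCompactSupport_comp_matAct hG hc hg).comp_left (g := fun z : ℂ => ‖z‖ ^ 2)
        (by simp)

lemma continuous_rootForm : Continuous rootForm := by
  unfold rootForm; fun_prop

lemma rootForm_zero : rootForm 0 = 0 := by simp [rootForm]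

lemma continuous_rootForm_fderiv (hf : ContDiff ℝ 1 f) :
    Continuous fun x => rootForm (fderiv ℝ f x) :=
  continuous_rootForm.comp (hf.continuous_fderiv (by norm_num))

lemma rootEnergy_signedFold (hG : IsFolding G A K) (hf : ContDiff ℝ 1 f)
    (hc : HasCompactSupport f) (hA : tsupport f ⊆ A) :
    rootEnergy (signedFold G f) = G.card * rootEnergy f := by
  have hdiff : Differentiable ℝ f := hf.differentiable (by norm_num)
  have hfd : ∀ x, fderiv ℝ (signedFold G f) x =
      ∑ g ∈ G, (g.det : ℂ) • (fderiv ℝ f (matAct g x)).comp (matAct g) := by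
    intro x
    have : HasFDerivAt (signedFold G f)
        (∑ g ∈ G, (g.det : ℂ) • (fderiv ℝ f (matAct g x)).comp (matAct g)) x := by
      unfold signedFold
      refine HasFDerivAt.fun_sum fun g _ => ?_
      apply HasFDerivAt.const_mul
      exact (hdiff (matAct g x)).hasFDerivAt.comp x (matAct g).hasFDerivAt
    exact this.fderiv
  have hsupp : ∀ y, fderiv ℝ f y ≠ 0 → y ∈ A := fun y hy =>
    hA (support_fderiv_subset ℝ hy)
  have hpt : ∀ x, rootForm (fderiv ℝ (signedFold G f) x) =
      ∑ g ∈ G, rootForm (fderiv ℝ f (matAct g x)) := by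
    intro x
    rw [hfd, map_sum_of_unique G _ rootForm rootForm_zero]
    · refine Finset.sum_congr rfl fun g hg => ?_
      rw [← rootForm_comp_matAct (hG.subset hg) (fderiv ℝ f (matAct g x))]
      rcases det_eq_or hG.subset hg with h | h <;> simp [h, rootForm]
    · intro g hg h hh h1 h2
      refine hG.eq_of_mem' (x := x) hg hh (hsupp _ fun h0 => h1 ?_) (hsupp _ fun h0 => h2 ?_) <;>
        · rw [h0, ContinuousLinearMap.zero_comp]
          exact ContinuousLinearMap.ext fun v => mul_zero _
  unfold rootEnergy
  simp only [hpt]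
  rw [integral_finsetSum]
  · rw [Finset.sum_congr rfl (fun g hg => integral_comp_matAct
      (det_mul_det_of_mem (hG.subset hg)) (continuous_rootForm_fderiv hf)), Finset.sum_const,
      nsmul_eq_mul]
  · intro g hg
    apply Continuous.integrable_of_hasCompactSupport
    · exact (continuous_rootForm_fderiv hf).comp (matAct g).continuous
    · exact hasCompactSupport_comp_matAct hG ((hc.fderiv (𝕜 := ℝ)).comp_left rootForm_zero) hg

lemma hasSum_rootEnergy (hf : ContDiff ℝ 1 f) (hc : HasCompactSupport f)
    (hinj : ∀ x (z : Fin 2 → ℤ), x ∈ tsupport f → x + intVec z ∈ tsupport f → z = 0) :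
    HasSum (fun k : Fin 2 → ℤ => 4 * Real.pi ^ 2 * freqNorm k * ‖latticeCoeff f k‖ ^ 2)
      (rootEnergy f) := by
  have hdir : ∀ v : Fin 2 → ℝ, HasSum (fun k : Fin 2 → ℤ =>
      4 * Real.pi ^ 2 * (k 0 * v 0 + k 1 * v 1) ^ 2 * ‖latticeCoeff f k‖ ^ 2)
      (∫ x, ‖fderiv ℝ f x v‖ ^ 2) := by
    intro v
    have hfd : Continuous fun x => fderiv ℝ f x v := by
      have := hf.continuous_fderiv (by norm_num)
      fun_prop
    have hfdc : HasCompactSupport fun x => fderiv ℝ f x v :=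
      (hc.fderiv (𝕜 := ℝ)).comp_left (g := fun L : (Fin 2 → ℝ) →L[ℝ] ℂ => L v) (by simp)
    have hmem : ∀ y, fderiv ℝ f y v ≠ 0 → y ∈ tsupport f := by
      intro y hy
      apply support_fderiv_subset ℝ
      intro h0
      apply hy
      change fderiv ℝ f y = 0 at h0
      rw [h0]; rfl
    have := hasSum_sq_latticeCoeff hfd hfdc (fun x z h1 h2 => hinj x z (hmem _ h1) (hmem _ h2))
    refine this.congr_fun fun k => ?_
    rw [latticeCoeff_fderiv hf hc, norm_mul, mul_pow]
    congr 1
    have : (2 * Real.pi * Complex.I * ∑ i, (k i : ℂ) * (v i : ℂ)) =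
        ((2 * Real.pi * (k 0 * v 0 + k 1 * v 1) : ℝ) : ℂ) * Complex.I := by
      rw [Fin.sum_univ_two]; push_cast; ring
    rw [this, norm_mul, Complex.norm_I, mul_one, Complex.norm_real, Real.norm_eq_abs, sq_abs]
    ring
  have hi : ∀ v : Fin 2 → ℝ, Integrable fun x => ‖fderiv ℝ f x v‖ ^ 2 := by
    intro v
    have := hf.continuous_fderiv (by norm_num)
    apply Continuous.integrable_of_hasCompactSupport (by fun_prop)
    exact (hc.fderiv (𝕜 := ℝ)).comp_left (g := fun L : (Fin 2 → ℝ) →L[ℝ] ℂ => ‖L v‖ ^ 2) (by simp)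
  have h := (((hdir ![1, 0]).add (hdir ![0, 1])).add (hdir ![1, 1])).div_const 2
  have hE : rootEnergy f = (((∫ x, ‖fderiv ℝ f x ![1, 0]‖ ^ 2) + ∫ x, ‖fderiv ℝ f x ![0, 1]‖ ^ 2) +
      ∫ x, ‖fderiv ℝ f x ![1, 1]‖ ^ 2) / 2 := by
    have e1 := integral_add (hi ![1, 0]) (hi ![0, 1])
    have e2 := integral_add ((hi ![1, 0]).add (hi ![0, 1])) (hi ![1, 1])
    simp only [Pi.add_apply] at e2
    rw [← e1, ← e2, ← integral_div]
    rfl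
  rw [hE]
  refine h.congr_fun fun k => ?_
  simp [freqNorm]
  ring

/-- A frequency in `K` occurs with at most the weight of a normalized mode of the alcove. -/
lemma norm_latticeCoeff_signedFold_sq_le (hG : IsFolding G A K) (hf : ContDiff ℝ 1 f)
    (hc : HasCompactSupport f) (hA : tsupport f ⊆ A) {k : Fin 2 → ℤ} (hk : k ∈ K) :
    ‖latticeCoeff (signedFold G f) k‖ ^ 2 ≤ ∫ x, ‖f x‖ ^ 2 := by
  classical
  have hP := hasSum_sq_latticeCoeff (signedFold_contDiff (G := G) hf).continuous
    (signedFold_hasCompactSupport hG hc) (signedFold_injOn hG hA)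
  rw [integral_norm_signedFold_sq hG hf.continuous hc hA] at hP
  have h1 := sum_le_hasSum (G.image fun g => Matrix.vecMul k g) (fun _ _ => by positivity) hP
  rw [Finset.sum_image (fun g hg h hh e => hG.free k hk g hg h hh e)] at h1
  rw [Finset.sum_congr rfl (g := fun _ => ‖latticeCoeff (signedFold G f) k‖ ^ 2), Finset.sum_const,
    nsmul_eq_mul] at h1
  · have : (0 : ℝ) < G.card := by exact_mod_cast Finset.card_pos.2 ⟨1, hG.one_mem⟩
    exact le_of_mul_le_mul_left h1 this
  · intro g hg
    rw [latticeCoeff_signedFold_vecMul hG hf hg, norm_mul, norm_det_eq_one hG hg, one_mul]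

lemma sub_rootEnergy_le (hG : IsFolding G A K) (hf : ContDiff ℝ 1 f)
    (hc : HasCompactSupport f) (hA : tsupport f ⊆ A) (T : ℝ) (S : Finset (Fin 2 → ℤ))
    (hS : ∀ k ∈ K, (freqNorm k : ℝ) < T → k ∈ S) :
    T * (∫ x, ‖f x‖ ^ 2) - rootEnergy f / (4 * Real.pi ^ 2) ≤
      ∑ k ∈ S, max (T - freqNorm k) 0 * ‖latticeCoeff (signedFold G f) k‖ ^ 2 := by
  classical
  set w := signedFold G f with hw
  have hsupp : ∀ x, w x ≠ 0 → ∃ g ∈ G, matAct g x ∈ tsupport f := by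
    intro x hx
    obtain ⟨g, hg, hne⟩ := Finset.exists_ne_zero_of_sum_ne_zero hx
    exact ⟨g, hg, subset_tsupport f (right_ne_zero_of_mul hne)⟩
  have htsupp : ∀ x ∈ tsupport w, ∃ g ∈ G, matAct g x ∈ tsupport f := by
    have hcl : IsClosed (⋃ g ∈ G, (matAct g) ⁻¹' tsupport f) :=
      G.finite_toSet.isClosed_biUnion fun g _ => (isClosed_tsupport f).preimage (matAct g).continuous
    have : tsupport w ⊆ ⋃ g ∈ G, (matAct g) ⁻¹' tsupport f := by
      apply closure_minimal _ hcl
      intro x hx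
      obtain ⟨g, hg, h⟩ := hsupp x hx
      simp only [Set.mem_iUnion]
      exact ⟨g, hg, h⟩
    intro x hx
    have := this hx
    simp only [Set.mem_iUnion] at this
    obtain ⟨g, hg, h⟩ := this
    exact ⟨g, hg, h⟩
  have hinj : ∀ x (z : Fin 2 → ℤ), x ∈ tsupport w → x + intVec z ∈ tsupport w → z = 0 := by
    intro x z hx hxz
    obtain ⟨g, hg, h1⟩ := htsupp x hx
    obtain ⟨h, hh, h2⟩ := htsupp _ hxz
    exact (hG.eq_of_mem hg hh (hA h1) (hA h2)).2
  have hwc := signedFold_hasCompactSupport hG hc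
  have hP := hasSum_sq_latticeCoeff (signedFold_contDiff (G := G) hf).continuous hwc
    (signedFold_injOn hG hA)
  have hE := hasSum_rootEnergy (signedFold_contDiff (G := G) hf) hwc hinj
  rw [integral_norm_signedFold_sq hG hf.continuous hc hA] at hP
  rw [rootEnergy_signedFold hG hf hc hA] at hE
  have hpi : (0 : ℝ) < 4 * Real.pi ^ 2 := by positivity
  have hD := (hP.mul_left T).sub (hE.div_const (4 * Real.pi ^ 2))
  have hcard : (0 : ℝ) < G.card := by exact_mod_cast Finset.card_pos.2 ⟨1, hG.one_mem⟩
  set a : (Fin 2 → ℤ) → ℝ := fun k => max (T - freqNorm k) 0 * ‖latticeCoeff w k‖ ^ 2 with ha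
  have hterm : ∀ k, T * ‖latticeCoeff w k‖ ^ 2 -
      4 * Real.pi ^ 2 * freqNorm k * ‖latticeCoeff w k‖ ^ 2 / (4 * Real.pi ^ 2) ≤
      ∑ y ∈ S ×ˢ G, if k = Matrix.vecMul y.1 y.2 then a y.1 else 0 := by
    intro k
    have hnn : 0 ≤ ∑ y ∈ S ×ˢ G, if k = Matrix.vecMul y.1 y.2 then a y.1 else 0 := by
      apply Finset.sum_nonneg
      intro y _
      split_ifs
      · exact mul_nonneg (le_max_right _ _) (by positivity)
      · exact le_rfl
    have e : T * ‖latticeCoeff w k‖ ^ 2 -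
      4 * Real.pi ^ 2 * freqNorm k * ‖latticeCoeff w k‖ ^ 2 / (4 * Real.pi ^ 2) =
      (T - freqNorm k) * ‖latticeCoeff w k‖ ^ 2 := by field_simp
    rw [e]
    rcases hG.cover k with ⟨g, hg, hdet, hfix⟩ | ⟨k₀, hk₀, g, hg, rfl⟩
    · have h1 := latticeCoeff_signedFold_vecMul hG hf hg k
      rw [hfix, hdet, ← hw] at h1
      have h2 : latticeCoeff w k = 0 := by
        push_cast at h1
        linear_combination (1 / 2 : ℂ) * h1
      rw [h2]; simpa using hnn
    · have hnorm : ‖latticeCoeff w (Matrix.vecMul k₀ g)‖ = ‖latticeCoeff w k₀‖ := by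
        rw [hw, latticeCoeff_signedFold_vecMul hG hf hg, norm_mul, norm_det_eq_one hG hg, one_mul]
      rw [freqNorm_vecMul (hG.subset hg), hnorm]
      rcases lt_or_ge (freqNorm k₀ : ℝ) T with hlt | hge
      · have hmem : (k₀, g) ∈ S ×ˢ G := Finset.mem_product.2 ⟨hS k₀ hk₀ hlt, hg⟩
        have := Finset.single_le_sum (f := fun y : (Fin 2 → ℤ) × Matrix (Fin 2) (Fin 2) ℤ =>
          if Matrix.vecMul k₀ g = Matrix.vecMul y.1 y.2 then a y.1 else 0) (by
            intro y _
            split_ifs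
            · exact mul_nonneg (le_max_right _ _) (by positivity)
            · exact le_rfl) hmem
        simp only [if_true] at this
        refine le_trans ?_ this
        simp only [ha]
        gcongr
        exact le_max_left _ _
      · refine le_trans ?_ hnn
        exact mul_nonpos_of_nonpos_of_nonneg (by linarith) (by positivity)
  have hle := hasSum_le_of_sum_le hD (c := G.card * ∑ k ∈ S, a k) (fun B => by
    calc _ ≤ ∑ k ∈ B, ∑ y ∈ S ×ˢ G, (if k = Matrix.vecMul y.1 y.2 then a y.1 else 0) :=
          Finset.sum_le_sum fun k _ => hterm k
      _ = ∑ y ∈ S ×ˢ G, ∑ k ∈ B, (if k = Matrix.vecMul y.1 y.2 then a y.1 else 0) :=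
          Finset.sum_comm
      _ ≤ ∑ y ∈ S ×ˢ G, a y.1 := by
          refine Finset.sum_le_sum fun y _ => ?_
          rw [Finset.sum_ite_eq']
          split_ifs
          · exact le_rfl
          · exact mul_nonneg (le_max_right _ _) (by positivity)
      _ = _ := by
          simp [Finset.sum_product, Finset.mul_sum])
  have e2 : T * (G.card * ∫ x, ‖f x‖ ^ 2) - G.card * rootEnergy f / (4 * Real.pi ^ 2) =
      G.card * (T * (∫ x, ‖f x‖ ^ 2) - rootEnergy f / (4 * Real.pi ^ 2)) := by ring
  rw [e2] at hle
  exact le_of_mul_le_mul_left hle hcard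

/-- The **Berezin inequality** for an alcove: a family of functions whose Gram matrix is at most
`C` has a Riesz mean of energies at most `C` times the Riesz mean of the lattice spectrum. -/
theorem sum_sub_rootEnergy_le (hG : IsFolding G A K) {n : ℕ} {f : Fin n → (Fin 2 → ℝ) → ℂ}
    (hf : ∀ j, ContDiff ℝ 1 (f j)) (hc : ∀ j, HasCompactSupport (f j))
    (hA : ∀ j, tsupport (f j) ⊆ A) {C : ℝ} (hC0 : 0 ≤ C)
    (hC : ∀ t : Fin n → ℂ, ∫ x, ‖∑ j, t j * f j x‖ ^ 2 ≤ C * ∑ j, ‖t j‖ ^ 2)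
    (T : ℝ) (S : Finset (Fin 2 → ℤ)) (hSK : ∀ k ∈ S, k ∈ K)
    (hS : ∀ k ∈ K, (freqNorm k : ℝ) < T → k ∈ S) :
    ∑ j, (T * (∫ x, ‖f j x‖ ^ 2) - rootEnergy (f j) / (4 * Real.pi ^ 2)) ≤
      C * ∑ k ∈ S, max (T - freqNorm k) 0 := by
  have hbessel : ∀ k ∈ K, ∑ j, ‖latticeCoeff (signedFold G (f j)) k‖ ^ 2 ≤ C := by
    intro k hk
    set c : Fin n → ℂ := fun j => latticeCoeff (signedFold G (f j)) k with hc'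
    set t : Fin n → ℂ := fun j => (starRingEnd ℂ) (c j) with ht
    set F : (Fin 2 → ℝ) → ℂ := fun x => ∑ j, t j * f j x with hF
    have hFd : ContDiff ℝ 1 F := ContDiff.sum fun j _ => contDiff_const.mul (hf j)
    have hsub : Function.support F ⊆ ⋃ j ∈ (Finset.univ : Finset (Fin n)), tsupport (f j) := by
      intro x hx
      obtain ⟨j, hj, hne⟩ := Finset.exists_ne_zero_of_sum_ne_zero hx
      simp only [Set.mem_iUnion]
      exact ⟨j, hj, subset_tsupport _ (right_ne_zero_of_mul hne)⟩
    have hKc : IsCompact (⋃ j ∈ (Finset.univ : Finset (Fin n)), tsupport (f j)) :=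
      Finset.univ.isCompact_biUnion fun j _ => hc j
    have hFc : HasCompactSupport F := HasCompactSupport.of_support_subset_isCompact hKc hsub
    have hFA : tsupport F ⊆ A := by
      refine (closure_minimal hsub hKc.isClosed).trans ?_
      simp only [Set.iUnion_subset_iff]
      exact fun j _ => hA j
    have hcoef : latticeCoeff (signedFold G F) k = ∑ j, t j * c j := by
      simp only [hc', latticeCoeff]
      have hpt : ∀ x, planeWave (-k) x * signedFold G F x =
          ∑ j, t j * (planeWave (-k) x * signedFold G (f j) x) := by
        intro x
        simp only [signedFold, hF, Finset.mul_sum]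
        rw [Finset.sum_comm]
        refine Finset.sum_congr rfl fun j _ => Finset.sum_congr rfl fun g _ => ?_
        ring
      simp only [hpt]
      rw [integral_finsetSum]
      · exact Finset.sum_congr rfl fun j _ => integral_const_mul _ _
      · intro j _
        apply Integrable.const_mul
        exact ((continuous_planeWave _).mul
          (signedFold_contDiff (hf j)).continuous).integrable_of_hasCompactSupport
          (signedFold_hasCompactSupport hG (hc j)).mul_left
    have hsum : ∑ j, t j * c j = ((∑ j, ‖c j‖ ^ 2 : ℝ) : ℂ) := by
      push_cast
      exact Finset.sum_congr rfl fun j _ => Complex.conj_mul' (c j)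
    have h1 := norm_latticeCoeff_signedFold_sq_le hG hFd hFc hFA hk
    rw [hcoef, hsum, Complex.norm_real, Real.norm_eq_abs, sq_abs] at h1
    have h2 := h1.trans (hC t)
    have h3 : ∑ j, ‖t j‖ ^ 2 = ∑ j, ‖c j‖ ^ 2 := by simp [ht]
    rw [h3] at h2
    set s := ∑ j, ‖c j‖ ^ 2
    have hs : 0 ≤ s := Finset.sum_nonneg fun _ _ => by positivity
    rcases hs.eq_or_lt with h0 | h0
    · rwa [← h0]
    · nlinarith
  calc _ ≤ ∑ j, ∑ k ∈ S, max (T - freqNorm k) 0 * ‖latticeCoeff (signedFold G (f j)) k‖ ^ 2 :=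
        Finset.sum_le_sum fun j _ => sub_rootEnergy_le hG (hf j) (hc j) (hA j) T S hS
    _ = ∑ k ∈ S, max (T - freqNorm k) 0 * ∑ j, ‖latticeCoeff (signedFold G (f j)) k‖ ^ 2 := by
        rw [Finset.sum_comm]
        simp only [Finset.mul_sum]
    _ ≤ ∑ k ∈ S, max (T - freqNorm k) 0 * C :=
        Finset.sum_le_sum fun k hk => mul_le_mul_of_nonneg_left (hbessel k (hSK k hk))
          (le_max_right _ _)
    _ = _ := by rw [← Finset.sum_mul, mul_comm]

end Folding

/-! ### The equilateral alcove and its half -/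

section Alcoves

open MeasureTheory

/-- The alcove of the affine Weyl group of type `A₂`: an equilateral triangle for the invariant
form, with vertices `(0, 0)`, `(2/3, 1/3)` and `(1/3, 2/3)`. -/
def triAlcove : Set (Fin 2 → ℝ) := {y | y 1 < 2 * y 0 ∧ y 0 < 2 * y 1 ∧ y 0 + y 1 < 1}

/-- The alcove of type `G₂`: half of `triAlcove`, with vertices `(0, 0)`, `(2/3, 1/3)` and
`(1/2, 1/2)`. -/
def halfAlcove : Set (Fin 2 → ℝ) := {y | y 1 < y 0 ∧ y 0 < 2 * y 1 ∧ y 0 + y 1 < 1}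

/-- The strictly dominant frequencies of type `A₂`. -/
def triChamber : Set (Fin 2 → ℤ) := {k | 1 ≤ k 0 ∧ 1 ≤ k 1}

/-- The strictly dominant frequencies of type `G₂`. -/
def halfChamber : Set (Fin 2 → ℤ) := {k | k 1 < k 0 ∧ 1 ≤ k 1}

lemma vecMul_eq (k : Fin 2 → ℤ) (g : Matrix (Fin 2) (Fin 2) ℤ) :
    Matrix.vecMul k g = ![k 0 * g 0 0 + k 1 * g 1 0, k 0 * g 0 1 + k 1 * g 1 1] := by
  ext i
  fin_cases i <;> simp [Matrix.vecMul, dotProduct, Fin.sum_univ_two]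

lemma fin_two_eq_iff {α : Type*} (k : Fin 2 → α) (a b : α) : k = ![a, b] ↔ k 0 = a ∧ k 1 = b := by
  constructor
  · rintro rfl; simp
  · rintro ⟨rfl, rfl⟩; ext i; fin_cases i <;> rfl

lemma int_mem_of_abs_lt {p : ℤ} (h1 : (-2 : ℝ) < p) (h2 : (p : ℝ) < 2) : -1 ≤ p ∧ p ≤ 1 := by
  have h1 : (-2 : ℤ) < p := by exact_mod_cast h1
  have h2 : p < 2 := by exact_mod_cast h2
  omega

lemma triAlcove_disjoint : ∀ y ∈ triAlcove, ∀ g ∈ triSymmetries, ∀ z,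
    matAct g y + intVec z ∈ triAlcove → g = 1 ∧ z = 0 := by
  intro y hy g hg z hgz
  obtain ⟨h1, h2, h3⟩ := hy
  obtain ⟨h4, h5, h6⟩ := hgz
  simp only [Pi.add_apply, matAct_apply_zero, matAct_apply_one, intVec] at h4 h5 h6
  have hz : z 0 = 0 → z 1 = 0 → z = 0 := by
    intro hp hq
    ext i; fin_cases i
    · exact hp
    · exact hq
  generalize hp : z 0 = p at *
  generalize hq : z 1 = q at *
  simp only [triSymmetries, Finset.mem_insert, Finset.mem_singleton] at hg
  rcases hg with rfl | rfl | rfl | rfl | rfl | rfl <;>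
    simp at h4 h5 h6 <;>
    obtain ⟨hp1, hp2⟩ := int_mem_of_abs_lt (p := p) (by linarith) (by linarith) <;>
    obtain ⟨hq1, hq2⟩ := int_mem_of_abs_lt (p := q) (by linarith) (by linarith) <;>
    interval_cases p <;> interval_cases q <;> norm_num at h4 h5 h6 <;>
    first
    | (exfalso; linarith)
    | exact ⟨by decide, hz rfl rfl⟩

lemma halfAlcove_disjoint : ∀ y ∈ halfAlcove, ∀ g ∈ hexSymmetries, ∀ z,
    matAct g y + intVec z ∈ halfAlcove → g = 1 ∧ z = 0 := by
  intro y hy g hg z hgz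
  obtain ⟨h1, h2, h3⟩ := hy
  obtain ⟨h4, h5, h6⟩ := hgz
  simp only [Pi.add_apply, matAct_apply_zero, matAct_apply_one, intVec] at h4 h5 h6
  have hz : z 0 = 0 → z 1 = 0 → z = 0 := by
    intro hp hq
    ext i; fin_cases i
    · exact hp
    · exact hq
  generalize hp : z 0 = p at *
  generalize hq : z 1 = q at *
  simp only [hexSymmetries, Finset.mem_insert, Finset.mem_singleton] at hg
  rcases hg with rfl | rfl | rfl | rfl | rfl | rfl | rfl | rfl | rfl | rfl | rfl | rfl <;>
    simp at h4 h5 h6 <;>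
    obtain ⟨hp1, hp2⟩ := int_mem_of_abs_lt (p := p) (by linarith) (by linarith) <;>
    obtain ⟨hq1, hq2⟩ := int_mem_of_abs_lt (p := q) (by linarith) (by linarith) <;>
    interval_cases p <;> interval_cases q <;> norm_num at h4 h5 h6 <;>
    first
    | (exfalso; linarith)
    | exact ⟨by decide, hz rfl rfl⟩

lemma triSymmetries_subset : triSymmetries ⊆ hexSymmetries := by decide

lemma triChamber_cover (k : Fin 2 → ℤ) :
    (∃ g ∈ triSymmetries, g.det = -1 ∧ Matrix.vecMul k g = k) ∨
      ∃ k₀ ∈ triChamber, ∃ g ∈ triSymmetries, k = Matrix.vecMul k₀ g := by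
  have hfix : ∀ g ∈ triSymmetries, g.det = -1 →
      k 0 = k 0 * g 0 0 + k 1 * g 1 0 → k 1 = k 0 * g 0 1 + k 1 * g 1 1 →
      (∃ g ∈ triSymmetries, g.det = -1 ∧ Matrix.vecMul k g = k) := fun g hg hd h0 h1 =>
    ⟨g, hg, hd, by rw [vecMul_eq]; exact ((fin_two_eq_iff _ _ _).2 ⟨h0, h1⟩).symm⟩
  have hmem : ∀ p q : ℤ, ∀ g ∈ triSymmetries, 1 ≤ p → 1 ≤ q →
      k 0 = p * g 0 0 + q * g 1 0 → k 1 = p * g 0 1 + q * g 1 1 →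
      ∃ k₀ ∈ triChamber, ∃ g ∈ triSymmetries, k = Matrix.vecMul k₀ g := fun p q g hg hp hq h0 h1 =>
    ⟨![p, q], ⟨hp, hq⟩, g, hg, by rw [vecMul_eq, fin_two_eq_iff]; exact ⟨h0, h1⟩⟩
  rcases lt_trichotomy (k 0) 0 with hp | hp | hp
  · rcases lt_trichotomy (k 0 + k 1) 0 with hs | hs | hs
    · rcases lt_trichotomy (k 1) 0 with hq | hq | hq
      · right
        exact hmem (-k 1) (-k 0) !![0, -1; -1, 0] (by decide) (by omega) (by omega)
          (by simp) (by simp)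
      · left; exact hfix !![1, 0; 1, -1] (by decide) (by decide) (by simp [hq]) (by simp [hq])
      · right
        exact hmem (k 1) (-k 0 - k 1) !![-1, 1; -1, 0] (by decide) (by omega) (by omega)
          (by simp) (by simp)
    · left
      exact hfix !![0, -1; -1, 0] (by decide) (by decide) (by simp; omega) (by simp; omega)
    · right
      exact hmem (-k 0) (k 0 + k 1) !![-1, 1; 0, 1] (by decide) (by omega) (by omega)
        (by simp) (by simp)
  · left; exact hfix !![-1, 1; 0, 1] (by decide) (by decide) (by simp [hp]) (by simp [hp])
  · rcases lt_trichotomy (k 1) 0 with hq | hq | hq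
    · rcases lt_trichotomy (k 0 + k 1) 0 with hs | hs | hs
      · right
        exact hmem (-k 0 - k 1) (k 0) !![0, -1; 1, -1] (by decide) (by omega) (by omega)
          (by simp) (by simp)
      · left
        exact hfix !![0, -1; -1, 0] (by decide) (by decide) (by simp; omega) (by simp; omega)
      · right
        exact hmem (k 0 + k 1) (-k 1) !![1, 0; 1, -1] (by decide) (by omega) (by omega)
          (by simp) (by simp)
    · left; exact hfix !![1, 0; 1, -1] (by decide) (by decide) (by simp [hq]) (by simp [hq])
    · right
      exact hmem (k 0) (k 1) !![1, 0; 0, 1] (by decide) (by omega) (by omega) (by simp) (by simp)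

lemma triSymmetries_mul_mem : ∀ g ∈ triSymmetries, ∀ h ∈ triSymmetries, g * h ∈ triSymmetries := by
  decide

lemma hexSymmetries_mul_mem : ∀ g ∈ hexSymmetries, ∀ h ∈ hexSymmetries, g * h ∈ hexSymmetries := by
  decide +kernel

lemma triSymmetries_exists_inv :
    ∀ g ∈ triSymmetries, ∃ h ∈ triSymmetries, g * h = 1 ∧ h * g = 1 := by decide

lemma hexSymmetries_exists_inv :
    ∀ g ∈ hexSymmetries, ∃ h ∈ hexSymmetries, g * h = 1 ∧ h * g = 1 := by decide +kernel

lemma eq_of_vecMul_eq {G : Finset (Matrix (Fin 2) (Fin 2) ℤ)}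
    (hmul : ∀ g ∈ G, ∀ h ∈ G, g * h ∈ G) (hinv : ∀ g ∈ G, ∃ h ∈ G, g * h = 1 ∧ h * g = 1)
    {k : Fin 2 → ℤ} (hstab : ∀ g ∈ G, Matrix.vecMul k g = k → g = 1)
    {g h : Matrix (Fin 2) (Fin 2) ℤ} (hg : g ∈ G) (hh : h ∈ G)
    (e : Matrix.vecMul k g = Matrix.vecMul k h) : g = h := by
  obtain ⟨h', hh', h1, h2⟩ := hinv h hh
  have h3 : g * h' = 1 := by
    apply hstab _ (hmul g hg h' hh')
    rw [← Matrix.vecMul_vecMul, e, Matrix.vecMul_vecMul, h1, Matrix.vecMul_one]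
  have h4 : g * h' * h = h := by rw [h3, one_mul]
  rwa [mul_assoc, h2, mul_one] at h4

lemma eq_one_of_vecMul_eq {k : Fin 2 → ℤ} (hk : k ∈ halfChamber) {g : Matrix (Fin 2) (Fin 2) ℤ}
    (hg : g ∈ hexSymmetries) (h : Matrix.vecMul k g = k) : g = 1 := by
  obtain ⟨h1, h2⟩ := hk
  rw [vecMul_eq, eq_comm, fin_two_eq_iff] at h
  obtain ⟨h3, h4⟩ := h
  simp only [hexSymmetries, Finset.mem_insert, Finset.mem_singleton] at hg
  rcases hg with rfl | rfl | rfl | rfl | rfl | rfl | rfl | rfl | rfl | rfl | rfl | rfl <;>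
    first
    | decide
    | (exfalso; simp at h3 h4; omega)

lemma eq_one_of_vecMul_eq' {k : Fin 2 → ℤ} (hk : k ∈ triChamber) {g : Matrix (Fin 2) (Fin 2) ℤ}
    (hg : g ∈ triSymmetries) (h : Matrix.vecMul k g = k) : g = 1 := by
  obtain ⟨h1, h2⟩ := hk
  rw [vecMul_eq, eq_comm, fin_two_eq_iff] at h
  obtain ⟨h3, h4⟩ := h
  simp only [triSymmetries, Finset.mem_insert, Finset.mem_singleton] at hg
  rcases hg with rfl | rfl | rfl | rfl | rfl | rfl <;>
    first
    | decide
    | (exfalso; simp at h3 h4; omega)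

lemma isFolding_tri : IsFolding triSymmetries triAlcove triChamber where
  subset := triSymmetries_subset
  one_mem := by decide
  mul_mem := triSymmetries_mul_mem
  exists_inv := triSymmetries_exists_inv
  disjoint := triAlcove_disjoint
  cover := triChamber_cover
  free := fun _ hk _ hg _ hh e => eq_of_vecMul_eq triSymmetries_mul_mem triSymmetries_exists_inv
    (fun _ hg h => eq_one_of_vecMul_eq' hk hg h) hg hh e

lemma halfChamber_cover (k : Fin 2 → ℤ) :
    (∃ g ∈ hexSymmetries, g.det = -1 ∧ Matrix.vecMul k g = k) ∨
      ∃ k₀ ∈ halfChamber, ∃ g ∈ hexSymmetries, k = Matrix.vecMul k₀ g := by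
  set σ : Matrix (Fin 2) (Fin 2) ℤ := !![0, 1; 1, 0] with hσ
  have hσm : σ ∈ hexSymmetries := by decide
  rcases triChamber_cover k with ⟨g, hg, h1, h2⟩ | ⟨k₀, ⟨h1, h2⟩, g, hg, rfl⟩
  · exact Or.inl ⟨g, triSymmetries_subset hg, h1, h2⟩
  · have hg' := triSymmetries_subset hg
    rcases lt_trichotomy (k₀ 0) (k₀ 1) with h | h | h
    · right
      refine ⟨![k₀ 1, k₀ 0], ⟨h, h1⟩, σ * g, hexSymmetries_mul_mem _ hσm _ hg', ?_⟩
      rw [← Matrix.vecMul_vecMul]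
      congr 1
      rw [vecMul_eq, fin_two_eq_iff]
      simp [hσ]
    · left
      obtain ⟨g', hg'', e1, e2⟩ := hexSymmetries_exists_inv g hg'
      refine ⟨g' * (σ * g), hexSymmetries_mul_mem _ hg'' _ (hexSymmetries_mul_mem _ hσm _ hg'),
        ?_, ?_⟩
      · have hdσ : σ.det = -1 := by decide
        rw [Matrix.det_mul, Matrix.det_mul, hdσ]
        have : g'.det * g.det = 1 := by rw [← Matrix.det_mul, e2, Matrix.det_one]
        linear_combination -this
      · rw [Matrix.vecMul_vecMul, ← mul_assoc, e1, one_mul, ← Matrix.vecMul_vecMul]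
        congr 1
        rw [vecMul_eq, eq_comm, fin_two_eq_iff]
        simp [hσ, h]
    · exact Or.inr ⟨k₀, ⟨h, h2⟩, g, hg', rfl⟩

lemma isFolding_half : IsFolding hexSymmetries halfAlcove halfChamber where
  subset := subset_rfl
  one_mem := by decide
  mul_mem := hexSymmetries_mul_mem
  exists_inv := hexSymmetries_exists_inv
  disjoint := halfAlcove_disjoint
  cover := halfChamber_cover
  free := fun _ hk _ hg _ hh e => eq_of_vecMul_eq hexSymmetries_mul_mem hexSymmetries_exists_inv
    (fun _ hg h => eq_one_of_vecMul_eq hk hg h) hg hh e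

/-- A pair of natural numbers as a frequency. -/
def toFreq (x : ℕ × ℕ) : Fin 2 → ℤ := ![(x.1 : ℤ), (x.2 : ℤ)]

lemma toFreq_injective : Function.Injective toFreq := by
  rintro ⟨a, b⟩ ⟨c, d⟩ h
  have h0 := congrFun h 0
  have h1 := congrFun h 1
  simp [toFreq] at h0 h1
  simp [h0, h1]

lemma freqNorm_toFreq (x : ℕ × ℕ) : freqNorm (toFreq x) = hexNorm x.1 x.2 := by
  simp [freqNorm, toFreq, hexNorm]

lemma toFreq_toNat {k : Fin 2 → ℤ} (h0 : 0 ≤ k 0) (h1 : 0 ≤ k 1) :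
    toFreq ((k 0).toNat, (k 1).toNat) = k := by
  rw [eq_comm, toFreq, fin_two_eq_iff]
  simp [h0, h1]

variable {n : ℕ} {f : Fin n → (Fin 2 → ℝ) → ℂ} {C T : ℝ} {M : ℕ}

lemma sum_sub_rootEnergy_le_rieszFull
    (hf : ∀ j, ContDiff ℝ 1 (f j)) (hc : ∀ j, HasCompactSupport (f j))
    (hA : ∀ j, tsupport (f j) ⊆ triAlcove) (hC0 : 0 ≤ C)
    (hC : ∀ t : Fin n → ℂ, ∫ x, ‖∑ j, t j * f j x‖ ^ 2 ≤ C * ∑ j, ‖t j‖ ^ 2)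
    (hM : T ≤ (M : ℝ) ^ 2) :
    ∑ j, (T * (∫ x, ‖f j x‖ ^ 2) - rootEnergy (f j) / (4 * Real.pi ^ 2)) ≤
      C * rieszFull M T := by
  have h := sum_sub_rootEnergy_le isFolding_tri hf hc hA hC0 hC T ((latticeBox M).map
    ⟨toFreq, toFreq_injective⟩) ?_ ?_
  · simpa [rieszFull, freqNorm_toFreq] using h
  · intro k hk
    obtain ⟨x, hx, rfl⟩ := Finset.mem_map.1 hk
    rw [mem_latticeBox] at hx
    simp only [triChamber, Function.Embedding.coeFn_mk, toFreq, Set.mem_ofPred_eq]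
    simp
    omega
  · intro k hk hlt
    obtain ⟨h1, h2⟩ := hk
    have e := toFreq_toNat (k := k) (by omega) (by omega)
    rw [Finset.mem_map]
    refine ⟨_, ?_, e⟩
    rw [← e, freqNorm_toFreq] at hlt
    have := le_of_hexNorm_lt hM (by exact_mod_cast hlt)
    rw [mem_latticeBox]
    simp only at *
    omega

lemma sum_sub_rootEnergy_le_rieszHalf
    (hf : ∀ j, ContDiff ℝ 1 (f j)) (hc : ∀ j, HasCompactSupport (f j))
    (hA : ∀ j, tsupport (f j) ⊆ halfAlcove) (hC0 : 0 ≤ C)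
    (hC : ∀ t : Fin n → ℂ, ∫ x, ‖∑ j, t j * f j x‖ ^ 2 ≤ C * ∑ j, ‖t j‖ ^ 2)
    (hM : T ≤ (M : ℝ) ^ 2) :
    ∑ j, (T * (∫ x, ‖f j x‖ ^ 2) - rootEnergy (f j) / (4 * Real.pi ^ 2)) ≤
      C * rieszHalf M T := by
  have h := sum_sub_rootEnergy_le isFolding_half hf hc hA hC0 hC T ((latticeHalfBox M).map
    ⟨toFreq, toFreq_injective⟩) ?_ ?_
  · simpa [rieszHalf, freqNorm_toFreq] using h
  · intro k hk
    obtain ⟨x, hx, rfl⟩ := Finset.mem_map.1 hk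
    rw [mem_latticeHalfBox] at hx
    simp only [halfChamber, Function.Embedding.coeFn_mk, toFreq, Set.mem_ofPred_eq]
    simp
    omega
  · intro k hk hlt
    obtain ⟨h1, h2⟩ := hk
    have e := toFreq_toNat (k := k) (by omega) (by omega)
    rw [Finset.mem_map]
    refine ⟨_, ?_, e⟩
    rw [← e, freqNorm_toFreq] at hlt
    have := le_of_hexNorm_lt hM (by exact_mod_cast hlt)
    rw [mem_latticeHalfBox]
    simp only at *
    omega

end Alcoves

/-! ### The Berezin inequality on an arbitrary triangle -/

section Transport

open MeasureTheory

/-- The open triangle with vertices `P`, `P + a` and `P + b`. -/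
def openTriangle (P a b : Plane) : Set Plane :=
  {x | ∃ s r : ℝ, 0 < s ∧ 0 < r ∧ s + r < 1 ∧ x = P + (s • a + r • b)}

/-- The integral of the squared derivative of `φ` in the direction `w`. -/
noncomputable def dirEnergy (φ : Plane → ℝ) (w : Plane) : ℝ := ∫ x, (fderiv ℝ φ x w) ^ 2

/-- The Gram matrix of the family `φ` in `L²` is at most `C`. -/
def GramLE {n : ℕ} (φ : Fin n → Plane → ℝ) (C : ℝ) : Prop :=
  ∀ t : Fin n → ℝ, ∫ x, (∑ j, t j * φ j x) ^ 2 ≤ C * ∑ j, t j ^ 2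

lemma exists_integral_comp_eq (P : Plane) (L : (Fin 2 → ℝ) ≃L[ℝ] Plane) :
    ∃ c : ℝ, 0 < c ∧ ∀ F : Plane → ℝ, ∫ x, F (P + L x) = c * ∫ y, F y := by
  have : Measure.IsAddHaarMeasure (Measure.map L (volume : Measure (Fin 2 → ℝ))) :=
    L.isAddHaarMeasure_map volume
  have hc := Measure.isAddLeftInvariant_eq_smul
    (Measure.map L (volume : Measure (Fin 2 → ℝ))) (volume : Measure Plane)
  have hpos := Measure.addHaarScalarFactor_pos_of_isAddHaarMeasure
    (Measure.map L (volume : Measure (Fin 2 → ℝ))) (volume : Measure Plane)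
  generalize Measure.addHaarScalarFactor
    (Measure.map L (volume : Measure (Fin 2 → ℝ))) (volume : Measure Plane) = c at hc hpos
  refine ⟨c, hpos, fun F => ?_⟩
  have h1 : ∫ x, F (P + L x) = ∫ y, F (P + y) ∂(Measure.map L (volume : Measure (Fin 2 → ℝ))) :=
    (integral_map_equiv L.toHomeomorph.toMeasurableEquiv (fun y => F (P + y))).symm
  rw [h1, hc, integral_smul_nnreal_measure, integral_add_left_eq_self, NNReal.smul_def, smul_eq_mul]

/-- The linear isomorphism with prescribed images of the standard basis. -/
lemma exists_equiv_of_linearIndependent {u v : Plane} (h : LinearIndependent ℝ ![u, v]) :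
    ∃ L : (Fin 2 → ℝ) ≃L[ℝ] Plane, ∀ x, L x = x 0 • u + x 1 • v := by
  let b := basisOfLinearIndependentOfCardEqFinrank h (by simp)
  refine ⟨b.equivFun.symm.toContinuousLinearEquiv, fun x => ?_⟩
  simp [b, Module.Basis.equivFun_symm_apply, Fin.sum_univ_two]

lemma IsTestFunction.continuous_fderiv_apply {Ω : Set Plane} {φ : Plane → ℝ}
    (hφ : IsTestFunction Ω φ) (w : Plane) : Continuous fun x => fderiv ℝ φ x w := by
  have := hφ.contDiff.continuous_fderiv (by simp)
  fun_prop

lemma IsTestFunction.integrable_mul_of_continuous {Ω : Set Plane} {φ : Plane → ℝ}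
    (hφ : IsTestFunction Ω φ) {g : Plane → ℝ} (hg : Continuous g) :
    Integrable fun x => g x * φ x :=
  (hg.mul hφ.contDiff.continuous).integrable_of_hasCompactSupport hφ.hasCompactSupport.mul_left

lemma IsTestFunction.hasCompactSupport_fderiv_apply {Ω : Set Plane} {φ : Plane → ℝ}
    (hφ : IsTestFunction Ω φ) (w : Plane) : HasCompactSupport fun x => fderiv ℝ φ x w :=
  (hφ.hasCompactSupport.fderiv (𝕜 := ℝ)).comp_left (g := fun L : Plane →L[ℝ] ℝ => L w) (by simp)

lemma IsTestFunction.integrable_fderiv_sq {Ω : Set Plane} {φ : Plane → ℝ}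
    (hφ : IsTestFunction Ω φ) (w : Plane) : Integrable fun x => (fderiv ℝ φ x w) ^ 2 :=
  (((hφ.continuous_fderiv_apply w).mul (hφ.continuous_fderiv_apply w)).integrable_of_hasCompactSupport
    (hφ.hasCompactSupport_fderiv_apply w).mul_left).congr
    (Filter.Eventually.of_forall fun x => (sq (fderiv ℝ φ x w)).symm)

lemma integral_add_add {f g k : Plane → ℝ} (hf : Integrable f) (hg : Integrable g)
    (hk : Integrable k) :
    ∫ x, (f x + g x + k x) = (∫ x, f x) + (∫ x, g x) + ∫ x, k x := by
  have e := integral_add (hf.add hg) hk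
  rw [← integral_add hf hg]
  exact e

lemma gramLE_complex {n : ℕ} {φ : Fin n → Plane → ℝ} {C : ℝ} (hC : GramLE φ C)
    (hφ : ∀ j, Continuous (φ j)) (hφc : ∀ j, HasCompactSupport (φ j)) (t : Fin n → ℂ) :
    ∫ x, ‖∑ j, t j * (φ j x : ℂ)‖ ^ 2 ≤ C * ∑ j, ‖t j‖ ^ 2 := by
  have hpt : ∀ x, ‖∑ j, t j * (φ j x : ℂ)‖ ^ 2 =
      (∑ j, (t j).re * φ j x) ^ 2 + (∑ j, (t j).im * φ j x) ^ 2 := by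
    intro x
    rw [Complex.sq_norm, Complex.normSq_apply]
    simp [sq]
  have hi : ∀ r : Fin n → ℝ, Integrable fun x => (∑ j, r j * φ j x) ^ 2 := by
    intro r
    have hcs : HasCompactSupport fun x => ∑ j, r j * φ j x := by
      have hKc : IsCompact (⋃ j ∈ (Finset.univ : Finset (Fin n)), tsupport (φ j)) :=
        Finset.univ.isCompact_biUnion fun j _ => hφc j
      refine HasCompactSupport.of_support_subset_isCompact hKc ?_
      intro x hx
      obtain ⟨j, hj, hne⟩ := Finset.exists_ne_zero_of_sum_ne_zero hx
      simp only [Set.mem_iUnion]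
      exact ⟨j, hj, subset_tsupport _ (right_ne_zero_of_mul hne)⟩
    refine Continuous.integrable_of_hasCompactSupport (by fun_prop) ?_
    exact hcs.comp_left (g := fun r : ℝ => r ^ 2) (by simp)
  simp only [hpt]
  rw [integral_add (hi _) (hi _)]
  have h1 := hC fun j => (t j).re
  have h2 := hC fun j => (t j).im
  have h3 : ∑ j, ‖t j‖ ^ 2 = ∑ j, (t j).re ^ 2 + ∑ j, (t j).im ^ 2 := by
    rw [← Finset.sum_add_distrib]
    refine Finset.sum_congr rfl fun j _ => ?_
    rw [Complex.sq_norm, Complex.normSq_apply]; ring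
  rw [h3, mul_add]
  exact add_le_add h1 h2

variable {n : ℕ} {φ : Fin n → Plane → ℝ} {C T : ℝ} {M : ℕ}

/-- Transport of a Riesz-mean inequality on a region `A` of the coordinate plane to its image under
an affine isomorphism. The Jacobian cancels. -/
lemma sum_sub_dirEnergy_le_of_coordinates {A : Set (Fin 2 → ℝ)} {R : ℝ}
    (hA : ∀ f : Fin n → (Fin 2 → ℝ) → ℂ, (∀ j, ContDiff ℝ 1 (f j)) →
      (∀ j, HasCompactSupport (f j)) → (∀ j, tsupport (f j) ⊆ A) → ∀ C : ℝ, 0 ≤ C →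
      (∀ t : Fin n → ℂ, ∫ x, ‖∑ j, t j * f j x‖ ^ 2 ≤ C * ∑ j, ‖t j‖ ^ 2) →
      ∑ j, (T * (∫ x, ‖f j x‖ ^ 2) - rootEnergy (f j) / (4 * Real.pi ^ 2)) ≤ C * R)
    {u v P : Plane} (hind : LinearIndependent ℝ ![u, v]) {Ω : Set Plane}
    (hΩ : ∀ x, P + (x 0 • u + x 1 • v) ∈ Ω → x ∈ A)
    (hφ : ∀ j, IsTestFunction Ω (φ j)) (hC0 : 0 ≤ C) (hC : GramLE φ C) :
    ∑ j, (T * (∫ x, φ j x ^ 2) - (dirEnergy (φ j) u + dirEnergy (φ j) v +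
      dirEnergy (φ j) (u + v)) / 2 / (4 * Real.pi ^ 2)) ≤ C * R := by
  obtain ⟨L, hL⟩ := exists_equiv_of_linearIndependent hind
  obtain ⟨c, hc0, hc⟩ := exists_integral_comp_eq P L
  set f : Fin n → (Fin 2 → ℝ) → ℂ := fun j x => (φ j (P + L x) : ℂ) with hf
  have hdφ : ∀ j, Differentiable ℝ (φ j) := fun j => (hφ j).contDiff.differentiable (by simp)
  have hcd : ∀ j, ContDiff ℝ 1 (f j) := by
    intro j
    have h1 : ContDiff ℝ 1 (φ j) := (hφ j).contDiff.of_le (by exact_mod_cast le_top)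
    have h2 : ContDiff ℝ 1 fun x => φ j (P + L x) :=
      h1.comp (contDiff_const.add L.contDiff)
    exact Complex.ofRealCLM.contDiff.comp h2
  have hts : ∀ j, tsupport (f j) ⊆ (fun x => P + L x) ⁻¹' tsupport (φ j) := by
    intro j
    apply closure_minimal
    · intro x hx
      apply subset_tsupport
      intro h0
      apply hx
      simp only [hf]
      rw [h0, Complex.ofReal_zero]
    · exact (isClosed_tsupport _).preimage (continuous_const.add L.continuous)
  have hcs : ∀ j, HasCompactSupport (f j) := by
    intro j
    have h1 : IsCompact (L.toHomeomorph.trans (Homeomorph.addLeft P) ⁻¹' tsupport (φ j)) :=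
      ((L.toHomeomorph.trans (Homeomorph.addLeft P)).isCompact_preimage).2
        (hφ j).hasCompactSupport
    exact h1.of_isClosed_subset (isClosed_tsupport _) (hts j)
  have htA : ∀ j, tsupport (f j) ⊆ A := by
    intro j x hx
    have : P + L x ∈ Ω := (hφ j).tsupport_subset (hts j hx)
    rw [hL] at this
    exact hΩ x this
  have hfd : ∀ j x w, fderiv ℝ (f j) x w = (fderiv ℝ (φ j) (P + L x) (L w) : ℂ) := by
    intro j x w
    have h1 : HasFDerivAt (fun x => P + L x) (L : (Fin 2 → ℝ) →L[ℝ] Plane) x :=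
      L.hasFDerivAt.const_add P
    have h2 : HasFDerivAt (fun x => φ j (P + L x))
        ((fderiv ℝ (φ j) (P + L x)).comp (L : (Fin 2 → ℝ) →L[ℝ] Plane)) x :=
      (hdφ j (P + L x)).hasFDerivAt.comp x h1
    have h3 := Complex.ofRealCLM.hasFDerivAt.comp x h2
    have h4 : HasFDerivAt (f j) _ x := h3
    rw [h4.fderiv]
    rfl
  have hLe : L ![1, 0] = u ∧ L ![0, 1] = v ∧ L ![1, 1] = u + v := by
    refine ⟨?_, ?_, ?_⟩ <;> rw [hL] <;> simp
  have hE : ∀ j, rootEnergy (f j) = c * ((dirEnergy (φ j) u + dirEnergy (φ j) v +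
      dirEnergy (φ j) (u + v)) / 2) := by
    intro j
    have h0 := hc fun y => ((fderiv ℝ (φ j) y u) ^ 2 +
        (fderiv ℝ (φ j) y v) ^ 2 + (fderiv ℝ (φ j) y (u + v)) ^ 2) / 2
    have h1 : rootEnergy (f j) = ∫ x, ((fderiv ℝ (φ j) (P + L x) u) ^ 2 +
        (fderiv ℝ (φ j) (P + L x) v) ^ 2 + (fderiv ℝ (φ j) (P + L x) (u + v)) ^ 2) / 2 := by
      unfold rootEnergy rootForm
      congr 1
      funext x
      simp only [hfd, hLe, Complex.norm_real, Real.norm_eq_abs, sq_abs]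
    refine h1.trans (h0.trans ?_)
    congr 1
    unfold dirEnergy
    rw [← integral_add_add ((hφ j).integrable_fderiv_sq u) ((hφ j).integrable_fderiv_sq v)
      ((hφ j).integrable_fderiv_sq (u + v)), ← integral_div]
  have hN : ∀ j, ∫ x, ‖f j x‖ ^ 2 = c * ∫ x, φ j x ^ 2 := by
    intro j
    rw [← hc]
    simp [hf]
  have hG : ∀ t : Fin n → ℂ, ∫ x, ‖∑ j, t j * f j x‖ ^ 2 ≤ (c * C) * ∑ j, ‖t j‖ ^ 2 := by
    intro t
    have := hc fun y => ‖∑ j, t j * (φ j y : ℂ)‖ ^ 2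
    simp only [hf]
    rw [this, mul_assoc]
    exact mul_le_mul_of_nonneg_left (gramLE_complex hC (fun j => (hφ j).contDiff.continuous)
      (fun j => (hφ j).hasCompactSupport) t) hc0.le
  have hmain := hA f hcd hcs htA (c * C) (by positivity) hG
  have e : ∑ j, (T * (∫ x, ‖f j x‖ ^ 2) - rootEnergy (f j) / (4 * Real.pi ^ 2)) =
      c * ∑ j, (T * (∫ x, φ j x ^ 2) - (dirEnergy (φ j) u + dirEnergy (φ j) v +
      dirEnergy (φ j) (u + v)) / 2 / (4 * Real.pi ^ 2)) := by
    rw [Finset.mul_sum]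
    refine Finset.sum_congr rfl fun j _ => ?_
    rw [hN, hE]; ring
  rw [e, mul_assoc] at hmain
  exact le_of_mul_le_mul_left hmain hc0

lemma linearIndependent_combination {a b : Plane} (h : LinearIndependent ℝ ![a, b])
    {p q r s : ℝ} (hdet : p * s - q * r ≠ 0) :
    LinearIndependent ℝ ![p • a + q • b, r • a + s • b] := by
  rw [LinearIndependent.pair_iff] at h ⊢
  intro x y hxy
  have h1 : (x * p + y * r) • a + (x * q + y * s) • b = 0 := by
    rw [← hxy]; module
  obtain ⟨h2, h3⟩ := h _ _ h1
  constructor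
  · have : (p * s - q * r) * x = 0 := by linear_combination s * h2 - r * h3
    exact (mul_eq_zero.1 this).resolve_left hdet
  · have : (p * s - q * r) * y = 0 := by linear_combination p * h3 - q * h2
    exact (mul_eq_zero.1 this).resolve_left hdet

lemma mem_openTriangle_iff {P a b : Plane} (h : LinearIndependent ℝ ![a, b]) {s r : ℝ} :
    P + (s • a + r • b) ∈ openTriangle P a b ↔ 0 < s ∧ 0 < r ∧ s + r < 1 := by
  constructor
  · rintro ⟨s', r', h1, h2, h3, h4⟩
    rw [LinearIndependent.pair_iff] at h
    have h5 : (s - s') • a + (r - r') • b = 0 := by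
      have := add_left_cancel h4
      rw [sub_smul, sub_smul, sub_add_sub_comm, this, sub_self]
    obtain ⟨h6, h7⟩ := h _ _ h5
    rw [sub_eq_zero] at h6 h7
    subst h6 h7
    exact ⟨h1, h2, h3⟩
  · rintro ⟨h1, h2, h3⟩
    exact ⟨s, r, h1, h2, h3, rfl⟩

/-- The Berezin inequality on a triangle, for the form that is invariant under the affine
symmetries of the triangle. For an equilateral triangle it is the Dirichlet form. -/
theorem sum_sub_symmEnergy_le {P a b : Plane} (h : LinearIndependent ℝ ![a, b])
    (hφ : ∀ j, IsTestFunction (openTriangle P a b) (φ j)) (hC0 : 0 ≤ C) (hC : GramLE φ C)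
    (hM : T ≤ (M : ℝ) ^ 2) :
    ∑ j, (T * (∫ x, φ j x ^ 2) - 3 * (dirEnergy (φ j) a + dirEnergy (φ j) b +
      dirEnergy (φ j) (a - b)) / (8 * Real.pi ^ 2)) ≤ C * rieszFull M T := by
  have hind := linearIndependent_combination h (p := 2) (q := -1) (r := -1) (s := 2) (by norm_num)
  have key := sum_sub_dirEnergy_le_of_coordinates (A := triAlcove) (T := T) (R := rieszFull M T)
    (fun f h1 h2 h3 C hC0 hC => sum_sub_rootEnergy_le_rieszFull h1 h2 h3 hC0 hC hM)
    (P := P) hind (Ω := openTriangle P a b) (fun x hx => by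
      have e : x 0 • ((2 : ℝ) • a + (-1 : ℝ) • b) + x 1 • ((-1 : ℝ) • a + (2 : ℝ) • b) =
        (2 * x 0 - x 1) • a + (2 * x 1 - x 0) • b := by module
      rw [e, mem_openTriangle_iff h] at hx
      refine ⟨?_, ?_, ?_⟩ <;> linarith) hφ hC0 hC
  refine le_trans (le_of_eq (Finset.sum_congr rfl fun j _ => ?_)) key
  have hi := fun w => (hφ j).integrable_fderiv_sq w
  have hE : dirEnergy (φ j) ((2 : ℝ) • a + (-1 : ℝ) • b) +
      dirEnergy (φ j) ((-1 : ℝ) • a + (2 : ℝ) • b) +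
      dirEnergy (φ j) ((2 : ℝ) • a + (-1 : ℝ) • b + ((-1 : ℝ) • a + (2 : ℝ) • b)) =
      3 * (dirEnergy (φ j) a + dirEnergy (φ j) b + dirEnergy (φ j) (a - b)) := by
    unfold dirEnergy
    rw [← integral_add_add (hi _) (hi _) (hi _), ← integral_add_add (hi _) (hi _) (hi _),
      ← integral_const_mul]
    congr 1
    funext x
    simp only [map_add, map_sub, map_smul, smul_eq_mul]
    ring
  rw [hE]; ring

/-- The Berezin inequality on a triangle, for the form of a half equilateral triangle with short
leg along `a - b` and long leg along `b`. -/
theorem sum_sub_halfEnergy_le {P a b : Plane} (h : LinearIndependent ℝ ![a, b])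
    (hφ : ∀ j, IsTestFunction (openTriangle P a b) (φ j)) (hC0 : 0 ≤ C) (hC : GramLE φ C)
    (hM : T ≤ (M : ℝ) ^ 2) :
    ∑ j, (T * (∫ x, φ j x ^ 2) - 3 * (3 * dirEnergy (φ j) (a - b) + dirEnergy (φ j) b) /
      (4 * Real.pi ^ 2)) ≤ C * rieszHalf M T := by
  have hind := linearIndependent_combination h (p := 3) (q := -2) (r := -3) (s := 4) (by norm_num)
  have key := sum_sub_dirEnergy_le_of_coordinates (A := halfAlcove) (T := T) (R := rieszHalf M T)
    (fun f h1 h2 h3 C hC0 hC => sum_sub_rootEnergy_le_rieszHalf h1 h2 h3 hC0 hC hM)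
    (P := P) hind (Ω := openTriangle P a b) (fun x hx => by
      have e : x 0 • ((3 : ℝ) • a + (-2 : ℝ) • b) + x 1 • ((-3 : ℝ) • a + (4 : ℝ) • b) =
        (3 * x 0 - 3 * x 1) • a + (4 * x 1 - 2 * x 0) • b := by module
      rw [e, mem_openTriangle_iff h] at hx
      refine ⟨?_, ?_, ?_⟩ <;> linarith) hφ hC0 hC
  refine le_trans (le_of_eq (Finset.sum_congr rfl fun j _ => ?_)) key
  have hi := fun w => (hφ j).integrable_fderiv_sq w
  have hE : dirEnergy (φ j) ((3 : ℝ) • a + (-2 : ℝ) • b) +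
      dirEnergy (φ j) ((-3 : ℝ) • a + (4 : ℝ) • b) +
      dirEnergy (φ j) ((3 : ℝ) • a + (-2 : ℝ) • b + ((-3 : ℝ) • a + (4 : ℝ) • b)) =
      18 * dirEnergy (φ j) (a - b) + 6 * dirEnergy (φ j) b := by
    unfold dirEnergy
    rw [← integral_add_add (hi _) (hi _) (hi _),
      ← integral_const_mul, ← integral_const_mul,
      ← integral_add ((hi _).const_mul _) ((hi _).const_mul _)]
    congr 1
    funext x
    simp only [map_add, map_sub, map_smul, smul_eq_mul]
    ring
  rw [hE]; ring

end Transport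

/-! ### The lower bound on isosceles triangles -/

section Isosceles

open MeasureTheory

/-- The Dirichlet energy of a function on the plane. -/
noncomputable def gradEnergy (φ : Plane → ℝ) : ℝ := ∫ x, ‖gradient φ x‖ ^ 2

/-- The factor gained over the equilateral triangle by the isosceles triangle with two sides `1`
and base `√s`. -/
noncomputable def shapeFactor (s : ℝ) : ℝ :=
  if 2 / 7 ≤ s then (1 + 2 * s) / (4 * s - s ^ 2) else 11 / (8 - 2 * s)

lemma one_le_shapeFactor {s : ℝ} (h0 : 0 < s) (h1 : s ≤ 1) : 1 ≤ shapeFactor s := by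
  unfold shapeFactor
  split_ifs with h
  · rw [le_div_iff₀ (by nlinarith)]; nlinarith [sq_nonneg (1 - s)]
  · rw [le_div_iff₀ (by linarith)]; linarith

lemma one_lt_shapeFactor {s : ℝ} (h0 : 0 < s) (h1 : s < 1) : 1 < shapeFactor s := by
  unfold shapeFactor
  split_ifs with h
  · rw [lt_div_iff₀ (by nlinarith)]; nlinarith [mul_pos (sub_pos.2 h1) (sub_pos.2 h1)]
  · rw [lt_div_iff₀ (by linarith)]; linarith

lemma plane_inner (x y : Plane) : inner ℝ x y = x 0 * y 0 + x 1 * y 1 := by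
  rw [PiLp.inner_apply, Fin.sum_univ_two]
  simp [mul_comm]

lemma plane_norm_sq (x : Plane) : ‖x‖ ^ 2 = x 0 ^ 2 + x 1 ^ 2 := by
  rw [← real_inner_self_eq_norm_sq, plane_inner]; ring

/-- The Gram identity in two dimensions. -/
lemma norm_sq_mul_gram (a b w : Plane) :
    ‖w‖ ^ 2 * (‖a‖ ^ 2 * ‖b‖ ^ 2 - inner ℝ a b ^ 2) =
      ‖b‖ ^ 2 * inner ℝ w a ^ 2 - 2 * inner ℝ a b * inner ℝ w a * inner ℝ w b +
        ‖a‖ ^ 2 * inner ℝ w b ^ 2 := by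
  simp only [plane_norm_sq, plane_inner]; ring

lemma norm_sq_of_isosceles {a b w : Plane} {D s : ℝ} (hD : 0 < D) (ha : ‖a‖ = D) (hb : ‖b‖ = D)
    (hab : ‖a - b‖ ^ 2 = s * D ^ 2) :
    s * (1 - s / 4) * D ^ 2 * ‖w‖ ^ 2 = (1 - s / 2) * inner ℝ w (a - b) ^ 2 +
      s / 2 * (inner ℝ w a ^ 2 + inner ℝ w b ^ 2) := by
  have h1 := norm_sub_sq_real a b
  rw [ha, hb, hab] at h1
  have h2 : inner ℝ a b = D ^ 2 * (1 - s / 2) := by linarith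
  have h3 := norm_sq_mul_gram a b w
  rw [ha, hb, h2] at h3
  rw [inner_sub_right]
  have hD2 : D ^ 2 ≠ 0 := by positivity
  apply mul_left_cancel₀ hD2
  linear_combination h3

lemma fderiv_eq_inner_gradient {φ : Plane → ℝ} (x w : Plane) :
    fderiv ℝ φ x w = inner ℝ (gradient φ x) w := by
  rw [gradient, InnerProductSpace.toDual_symm_apply]

lemma gradEnergy_of_isosceles {Ω : Set Plane} {φ : Plane → ℝ} (hφ : IsTestFunction Ω φ)
    {a b : Plane} {D s : ℝ} (hD : 0 < D) (ha : ‖a‖ = D) (hb : ‖b‖ = D)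
    (hab : ‖a - b‖ ^ 2 = s * D ^ 2) :
    s * (1 - s / 4) * D ^ 2 * gradEnergy φ = (1 - s / 2) * dirEnergy φ (a - b) +
      s / 2 * (dirEnergy φ a + dirEnergy φ b) := by
  have hi := fun w => hφ.integrable_fderiv_sq w
  have e := integral_add ((hi (a - b)).const_mul (1 - s / 2))
    (((hi a).add (hi b)).const_mul (s / 2))
  simp only [Pi.add_apply] at e
  unfold gradEnergy dirEnergy
  rw [← integral_const_mul, ← integral_add (hi _) (hi _), ← integral_const_mul,
    ← integral_const_mul, ← e]
  congr 1
  funext x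
  rw [norm_sq_of_isosceles hD ha hb hab]
  simp only [fderiv_eq_inner_gradient]

lemma openTriangle_swap (P a b : Plane) : openTriangle P a b = openTriangle P b a := by
  ext x
  constructor <;> rintro ⟨s, r, h1, h2, h3, rfl⟩ <;>
    exact ⟨r, s, h2, h1, by linarith, by rw [add_comm (s • _)]⟩

lemma dirEnergy_sub_comm (φ : Plane → ℝ) (a b : Plane) :
    dirEnergy φ (a - b) = dirEnergy φ (b - a) := by
  unfold dirEnergy
  congr 1
  funext x
  rw [← neg_sub b a, map_neg, neg_sq]

/-- The energies of a nearly orthonormal family on an isosceles triangle with two longest sides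
`D`, compared with the Riesz mean of the spectrum of the equilateral triangle. -/
theorem le_sum_gradEnergy {n : ℕ} {φ : Fin n → Plane → ℝ} {C : ℝ} {P a b : Plane} {D s : ℝ}
    (hD : 0 < D) (ha : ‖a‖ = D) (hb : ‖b‖ = D) (hab : ‖a - b‖ ^ 2 = s * D ^ 2) (hs0 : 0 < s)
    (hs1 : s ≤ 1) (hind : LinearIndependent ℝ ![a, b])
    (hφ : ∀ j, IsTestFunction (openTriangle P a b) (φ j)) (hC0 : 0 ≤ C) (hC : GramLE φ C)
    (t : ℕ) :
    16 * Real.pi ^ 2 / 9 * shapeFactor s * (t * (∑ j, ∫ x, φ j x ^ 2) - C * rieszFull t t) ≤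
      D ^ 2 * ∑ j, gradEnergy (φ j) := by
  have hπ : 0 < Real.pi ^ 2 := by positivity
  set X := t * (∑ j, ∫ x, φ j x ^ 2) - C * rieszFull t t with hX
  set p := ∑ j, dirEnergy (φ j) (a - b) with hp
  set q := ∑ j, dirEnergy (φ j) a with hq
  set r := ∑ j, dirEnergy (φ j) b with hr
  have htt : (t : ℝ) ≤ (t : ℝ) ^ 2 := by
    rcases Nat.eq_zero_or_pos t with h | h
    · simp [h]
    · have : (1 : ℝ) ≤ t := by exact_mod_cast h
      nlinarith
  have htt' : (t : ℕ) ≤ t ^ 2 := by exact_mod_cast htt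
  have hM : (11 / 6 * t : ℝ) ≤ ((2 * t : ℕ) : ℝ) ^ 2 := by push_cast; nlinarith
  have e1 := sum_sub_symmEnergy_le hind hφ hC0 hC htt
  have e2 := sum_sub_halfEnergy_le hind hφ hC0 hC hM
  have hind' : LinearIndependent ℝ ![b, a] := by
    rw [LinearIndependent.pair_iff] at hind ⊢
    intro x y h
    rw [add_comm] at h
    exact (hind y x h).symm
  have hφ' : ∀ j, IsTestFunction (openTriangle P b a) (φ j) := by
    rw [openTriangle_swap]; exact hφ
  have e3 := sum_sub_halfEnergy_le hind' hφ' hC0 hC hM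
  have hR := mul_le_mul_of_nonneg_left (rieszHalf_le_rieszFull t t (2 * t) htt') hC0
  -- `f1` compares with the equilateral triangle, and `f2` is the sum of the comparisons with half an
  -- equilateral triangle, its hypotenuse being `a` or `b`. The energy on the isosceles triangle is a
  -- nonnegative combination of the two exactly when `s ≥ 2 / 7`; below, `f1` is dropped and the
  -- remaining multiple of `p` is nonnegative.
  have f1 : 8 * Real.pi ^ 2 / 3 * X ≤ p + q + r := by
    rw [Finset.sum_sub_distrib, ← Finset.mul_sum, ← Finset.sum_div, ← Finset.mul_sum,
      Finset.sum_add_distrib, Finset.sum_add_distrib, ← hp, ← hq, ← hr] at e1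
    have : X ≤ 3 * (q + r + p) / (8 * Real.pi ^ 2) := by linarith
    rw [le_div_iff₀ (by positivity)] at this
    linarith
  have f2 : 44 * Real.pi ^ 2 / 9 * X ≤ 6 * p + q + r := by
    rw [Finset.sum_sub_distrib, ← Finset.mul_sum, ← Finset.sum_div, ← Finset.mul_sum,
      Finset.sum_add_distrib, ← Finset.mul_sum, ← hp, ← hr] at e2
    simp only [dirEnergy_sub_comm _ b a] at e3
    rw [Finset.sum_sub_distrib, ← Finset.mul_sum, ← Finset.sum_div, ← Finset.mul_sum,
      Finset.sum_add_distrib, ← Finset.mul_sum, ← hp, ← hq] at e3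
    have h1 : 3 * (3 * p + r) / (4 * Real.pi ^ 2) + 3 * (3 * p + q) / (4 * Real.pi ^ 2) =
        3 * (6 * p + q + r) / (4 * Real.pi ^ 2) := by ring
    have : 11 / 3 * X ≤ 3 * (6 * p + q + r) / (4 * Real.pi ^ 2) := by rw [← h1]; linarith
    rw [le_div_iff₀ (by positivity)] at this
    linarith
  have hE : s * (1 - s / 4) * (D ^ 2 * ∑ j, gradEnergy (φ j)) =
      (1 - s / 2) * p + s / 2 * (q + r) := by
    rw [hp, hq, hr, ← Finset.sum_add_distrib, Finset.mul_sum, Finset.mul_sum, Finset.mul_sum,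
      Finset.mul_sum, ← Finset.sum_add_distrib]
    refine Finset.sum_congr rfl fun j _ => ?_
    rw [← gradEnergy_of_isosceles (hφ j) hD ha hb hab]; ring
  have hp0 : 0 ≤ p := Finset.sum_nonneg fun j _ => integral_nonneg fun x => by positivity
  have hpos : 0 < s * (1 - s / 4) := mul_pos hs0 (by linarith)
  refine le_of_mul_le_mul_left ?_ hpos
  rw [hE]
  unfold shapeFactor
  split_ifs with h
  · have g : s * (1 - s / 4) * (16 * Real.pi ^ 2 / 9 * ((1 + 2 * s) / (4 * s - s ^ 2)) * X) =
        4 * Real.pi ^ 2 / 9 * (1 + 2 * s) * X := by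
      have : 4 * s - s ^ 2 ≠ 0 := by nlinarith
      rw [show s * (1 - s / 4) = (4 * s - s ^ 2) / 4 by ring]
      generalize 4 * s - s ^ 2 = y at this ⊢
      field_simp
      ring
    rw [g]
    have g1 := mul_le_mul_of_nonneg_left f1 (by linarith : 0 ≤ (7 * s - 2) / 10)
    have g2 := mul_le_mul_of_nonneg_left f2 (by linarith : 0 ≤ (1 - s) / 5)
    linarith
  · have g : s * (1 - s / 4) * (16 * Real.pi ^ 2 / 9 * (11 / (8 - 2 * s)) * X) =
        22 * Real.pi ^ 2 / 9 * s * X := by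
      have : 8 - 2 * s ≠ 0 := by linarith
      rw [show s * (1 - s / 4) = s * (8 - 2 * s) / 8 by ring]
      generalize 8 - 2 * s = y at this ⊢
      field_simp
      ring
    rw [g]
    have g1 := mul_le_mul_of_nonneg_left f2 (by linarith : 0 ≤ s / 2)
    have g2 : 0 ≤ (1 - 7 * s / 2) * p := mul_nonneg (by linarith) hp0
    linarith

end Isosceles

/-! ### Eigenvectors of a closed form with compact embedding -/

section Form

variable {H G : Type*} [NormedAddCommGroup H] [InnerProductSpace ℝ H] [NormedAddCommGroup G]
  [InnerProductSpace ℝ G]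

/-- `V` is a form domain, encoded as the space of pairs `(u, ∇u)`. The vector `u` is an eigenvector
of the form `⟪∇u, ∇v⟫` with eigenvalue `μ`. -/
def IsFormEigenvector (V : Submodule ℝ (WithLp 2 (H × G))) (μ : ℝ) (u : H) : Prop :=
  u ≠ 0 ∧ ∃ x ∈ V, x.fst = u ∧ ∀ y ∈ V, inner ℝ x.snd y.snd = μ * inner ℝ u y.fst

variable {V : Submodule ℝ (WithLp 2 (H × G))}

lemma IsFormEigenvector.nonneg {μ : ℝ} {u : H} (h : IsFormEigenvector V μ u) : 0 ≤ μ := by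
  obtain ⟨hu, x, hx, rfl, h⟩ := h
  have h1 := h x hx
  rw [real_inner_self_eq_norm_sq, real_inner_self_eq_norm_sq] at h1
  have h2 : 0 < ‖x.fst‖ ^ 2 := by positivity
  by_contra! h3
  nlinarith [sq_nonneg ‖x.snd‖]

lemma fst_sum_smul {ι : Type*} [Fintype ι] (c : ι → ℝ) (x : ι → WithLp 2 (H × G)) :
    (∑ i, c i • x i).fst = ∑ i, c i • (x i).fst := by
  change WithLp.fstL 2 ℝ H G _ = _
  rw [map_sum]
  exact Finset.sum_congr rfl fun i _ => map_smul _ _ _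

/-- On the span of eigenvectors with eigenvalues at most `t`, the form is at most `t`. -/
lemma norm_snd_sq_le {ι : Type*} [Fintype ι] {t : ℝ} {μ : ι → ℝ} (hμ : ∀ i, μ i ≤ t)
    {x : ι → WithLp 2 (H × G)} (hx : ∀ i, x i ∈ V)
    (h : ∀ i, ∀ y ∈ V, inner ℝ (x i).snd y.snd = μ i * inner ℝ (x i).fst y.fst) (c : ι → ℝ) :
    ‖(∑ i, c i • x i).snd‖ ^ 2 ≤ t * ‖(∑ i, c i • x i).fst‖ ^ 2 := by
  have hf : (∑ i, c i • x i).fst = ∑ i, c i • (x i).fst := fst_sum_smul c x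
  have hs : (∑ i, c i • x i).snd = ∑ i, c i • (x i).snd := by
    change WithLp.sndL 2 ℝ H G _ = _
    rw [map_sum]
    exact Finset.sum_congr rfl fun i _ => map_smul _ _ _
  -- Eigenvectors with different eigenvalues are orthogonal, so `t ‖u‖² - ‖∇u‖²` is a square norm.
  have key : ∀ i k, (t - μ i) * inner ℝ (x i).fst (x k).fst =
      √(t - μ i) * √(t - μ k) * inner ℝ (x i).fst (x k).fst := by
    intro i k
    by_cases hik : μ i = μ k
    · rw [← hik, Real.mul_self_sqrt (sub_nonneg.2 (hμ i))]
    · have h1 := h i _ (hx k)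
      have h2 := h k _ (hx i)
      rw [real_inner_comm, h1, real_inner_comm (x i).fst (x k).fst] at h2
      have h3 : (μ i - μ k) * inner ℝ (x i).fst (x k).fst = 0 := by linarith
      rw [(mul_eq_zero.1 h3).resolve_left (sub_ne_zero.2 hik)]
      simp
  have h0 : t * ‖∑ i, c i • (x i).fst‖ ^ 2 - ‖∑ i, c i • (x i).snd‖ ^ 2 =
      ‖∑ i, c i • √(t - μ i) • (x i).fst‖ ^ 2 := by
    simp only [← real_inner_self_eq_norm_sq, sum_inner, inner_sum, real_inner_smul_left,
      real_inner_smul_right, Finset.mul_sum]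
    rw [← Finset.sum_sub_distrib]
    refine Finset.sum_congr rfl fun i _ => ?_
    rw [← Finset.sum_sub_distrib]
    refine Finset.sum_congr rfl fun k _ => ?_
    rw [h k _ (hx i)]
    have := key k i
    linear_combination c i * c k * this
  rw [hf, hs]
  have := sq_nonneg ‖∑ i, c i • √(t - μ i) • (x i).fst‖
  linarith

/-- An orthonormal family with bounds on the form can be enlarged by a vector orthogonal to it. -/
lemma exists_orthonormal_succ {n : ℕ} {t : ℕ → ℝ} {w : Fin n → WithLp 2 (H × G)}
    (hw : ∀ j, w j ∈ V) (hwo : Orthonormal ℝ fun j => (w j).fst)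
    (hwt : ∀ j, ‖(w j).snd‖ ^ 2 ≤ t j) {y : WithLp 2 (H × G)} (hyV : y ∈ V) (hy0 : y.fst ≠ 0)
    (hyo : ∀ j, inner ℝ (w j).fst y.fst = 0) (hyt : ‖y.snd‖ ^ 2 ≤ t n * ‖y.fst‖ ^ 2) :
    ∃ w : Fin (n + 1) → WithLp 2 (H × G), (∀ j, w j ∈ V) ∧
      Orthonormal ℝ (fun j => (w j).fst) ∧ ∀ j, ‖(w j).snd‖ ^ 2 ≤ t j := by
  have hvn : 0 < ‖y.fst‖ := norm_pos_iff.2 hy0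
  refine ⟨Fin.snoc w (‖y.fst‖⁻¹ • y), ?_, ?_, ?_⟩
  · refine Fin.lastCases ?_ fun j => ?_
    · rw [Fin.snoc_last]; exact V.smul_mem _ hyV
    · rw [Fin.snoc_castSucc]; exact hw j
  · rw [orthonormal_iff_ite]
    rw [orthonormal_iff_ite] at hwo
    have hs : inner ℝ (‖y.fst‖⁻¹ • y).fst (‖y.fst‖⁻¹ • y).fst = (1 : ℝ) := by
      rw [WithLp.smul_fst, real_inner_smul_left, real_inner_smul_right,
        real_inner_self_eq_norm_sq]
      field_simp
    have hs' : ∀ j, inner ℝ (w j).fst (‖y.fst‖⁻¹ • y).fst = (0 : ℝ) := fun j => by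
      rw [WithLp.smul_fst, real_inner_smul_right, hyo, mul_zero]
    refine Fin.lastCases ?_ fun i => ?_
    · refine Fin.lastCases ?_ fun j => ?_
      · simp only [Fin.snoc_last, hs, if_true]
      · simp only [Fin.snoc_last, Fin.snoc_castSucc]
        rw [real_inner_comm, hs', if_neg (Fin.castSucc_lt_last j).ne']
    · refine Fin.lastCases ?_ fun j => ?_
      · simp only [Fin.snoc_last, Fin.snoc_castSucc, hs']
        rw [if_neg (Fin.castSucc_lt_last i).ne]
      · simp only [Fin.snoc_castSucc, hwo, Fin.castSucc_inj]
  · refine Fin.lastCases ?_ fun j => ?_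
    · rw [Fin.snoc_last, WithLp.smul_snd, norm_smul, mul_pow, norm_inv, norm_norm, Fin.val_last,
        inv_pow, inv_mul_le_iff₀ (by positivity), mul_comm]
      exact hyt
    · rw [Fin.snoc_castSucc, Fin.val_castSucc]; exact hwt j

/-- Linearly independent eigenvectors with prescribed bounds on their eigenvalues yield an
orthonormal family that satisfies the same bounds on the form. -/
lemma exists_orthonormal_le {n : ℕ} {t : ℕ → ℝ} (h : ∀ j < n, ∃ u : Fin (j + 1) → H,
      LinearIndependent ℝ u ∧ ∀ i, ∃ μ : ℝ, μ ≤ t j ∧ IsFormEigenvector V μ (u i)) :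
    ∃ w : Fin n → WithLp 2 (H × G), (∀ j, w j ∈ V) ∧ Orthonormal ℝ (fun j => (w j).fst) ∧
      ∀ j, ‖(w j).snd‖ ^ 2 ≤ t j := by
  induction n with
  | zero => exact ⟨fun j => j.elim0, fun j => j.elim0, ⟨fun j => j.elim0, fun j => j.elim0⟩,
      fun j => j.elim0⟩
  | succ n ih =>
    obtain ⟨w, hw, hwo, hwt⟩ := ih fun j hj => h j (hj.trans n.lt_succ_self)
    obtain ⟨u, hu, hu'⟩ := h n n.lt_succ_self
    choose μ hμ hu0 x hx hxu he using hu'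
    let f : (Fin (n + 1) → ℝ) →ₗ[ℝ] (Fin n → ℝ) :=
      LinearMap.pi fun j => (innerₛₗ ℝ (w j).fst).comp (Fintype.linearCombination ℝ u)
    have hf : LinearMap.ker f ≠ ⊥ := f.ker_ne_bot_of_finrank_lt (by simp)
    obtain ⟨c, hc, hc0⟩ := Submodule.exists_mem_ne_zero_of_ne_bot hf
    set v := ∑ i, c i • u i with hv
    have hv0 : v ≠ 0 := by
      intro h0
      rw [Fintype.linearIndependent_iff] at hu
      exact hc0 (funext fun i => hu c h0 i)
    have hvo : ∀ j, inner ℝ (w j).fst v = 0 := by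
      intro j
      exact congrFun (LinearMap.mem_ker.1 hc) j
    set y := ∑ i, c i • x i with hy
    have hyf : y.fst = v := by
      rw [hy, hv, fst_sum_smul]
      exact Finset.sum_congr rfl fun i _ => by rw [hxu]
    have hyV : y ∈ V := V.sum_mem fun i _ => V.smul_mem _ (hx i)
    have hyt : ‖y.snd‖ ^ 2 ≤ t n * ‖y.fst‖ ^ 2 :=
      norm_snd_sq_le hμ hx (fun i => by rw [hxu]; exact he i) c
    exact exists_orthonormal_succ hw hwo hwt hyV (by rwa [hyf]) (by rwa [hyf]) hyt

/-- An operator which is arbitrarily small on the complement of finitely many functionals is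
compact. -/
lemma isCompactOperator_of_small {E F : Type*} [NormedAddCommGroup E] [InnerProductSpace ℝ E]
    [CompleteSpace E] [NormedAddCommGroup F] [InnerProductSpace ℝ F] [CompleteSpace F]
    (A : E →L[ℝ] F) (h : ∀ ε > 0, ∃ (m : ℕ) (w : Fin m → F), ∀ v : E,
      (∀ i, inner ℝ (w i) (A v) = 0) → ‖A v‖ ≤ ε * ‖v‖) : IsCompactOperator A := by
  have hcl := isClosed_setOfPred_isCompactOperator (σ₁₂ := RingHom.id ℝ) (M₁ := E) (M₂ := F)
  suffices A ∈ {f : E →L[ℝ] F | IsCompactOperator f} from this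
  rw [← hcl.closure_eq, Metric.mem_closure_iff]
  intro ε hε
  obtain ⟨m, w, hw⟩ := h (ε / 2) (by positivity)
  let U : Submodule ℝ E := Submodule.span ℝ (Set.range fun i => A.adjoint (w i))
  have : FiniteDimensional ℝ U := FiniteDimensional.span_of_finite ℝ (Set.finite_range _)
  refine ⟨A.comp U.starProjection, ?_, ?_⟩
  · have : LocallyCompactSpace U := by
      have := FiniteDimensional.proper ℝ U
      infer_instance
    have h1 : IsCompactOperator (A.comp U.subtypeL) :=
      isCompactOperator_of_locallyCompactSpace_rng _
    exact h1.comp_clm U.orthogonalProjectionOnto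
  · rw [dist_eq_norm]
    refine lt_of_le_of_lt (ContinuousLinearMap.opNorm_le_bound _ (by positivity) fun v => ?_)
      (half_lt_self hε)
    have e : (A - A.comp U.starProjection) v = A (v - U.starProjection v) := by simp
    rw [e]
    refine (hw _ fun i => ?_).trans (mul_le_mul_of_nonneg_left ?_ (by positivity))
    · rw [← ContinuousLinearMap.adjoint_inner_left, real_inner_comm]
      exact U.starProjection_inner_eq_zero v _ (Submodule.subset_span ⟨i, rfl⟩)
    · rw [← Submodule.starProjection_orthogonal_val]
      exact Uᗮ.norm_starProjection_apply_le v

/-- The embedding of the form domain into the Hilbert space. -/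
noncomputable def formEmbedding (V : Submodule ℝ (WithLp 2 (H × G))) : V →L[ℝ] H :=
  (WithLp.fstL 2 ℝ H G).comp V.subtypeL

lemma formEmbedding_apply (v : V) : formEmbedding V v = (v : WithLp 2 (H × G)).fst := rfl

variable [CompleteSpace H] [CompleteSpace G]

/-- If orthonormal families with bounded form have bounded cardinality then the embedding of the
form domain is compact: the members of a maximal family are the functionals needed. -/
lemma isCompactOperator_formEmbedding (hV : IsClosed (V : Set (WithLp 2 (H × G))))
    (hcount : ∀ Λ : ℝ, ∃ N : ℕ, ∀ (n : ℕ) (w : Fin n → WithLp 2 (H × G)), (∀ j, w j ∈ V) →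
      Orthonormal ℝ (fun j => (w j).fst) → (∀ j, ‖(w j).snd‖ ^ 2 ≤ Λ) → n ≤ N) :
    IsCompactOperator (formEmbedding V) := by
  have : CompleteSpace V := hV.completeSpace_coe
  refine isCompactOperator_of_small _ fun ε hε => ?_
  obtain ⟨N, hN⟩ := hcount (ε ^ 2)⁻¹
  let p : ℕ → Prop := fun n => ∃ w : Fin n → WithLp 2 (H × G), (∀ j, w j ∈ V) ∧
      Orthonormal ℝ (fun j => (w j).fst) ∧ ∀ j, ‖(w j).snd‖ ^ 2 ≤ (ε ^ 2)⁻¹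
  have hp0 : p 0 := ⟨fun j => j.elim0, fun j => j.elim0, ⟨fun j => j.elim0, fun j => j.elim0⟩,
      fun j => j.elim0⟩
  have hpN : ∀ n, p n → n ≤ N := fun n ⟨w, h1, h2, h3⟩ => hN n w h1 h2 h3
  obtain ⟨n, hn, hmax⟩ : ∃ n, p n ∧ ¬ p (n + 1) := by
    by_contra! hcon
    have : ∀ n, p n := fun n => Nat.rec hp0 (fun k hk => hcon k hk) n
    exact absurd (hpN _ (this (N + 1))) (by omega)
  obtain ⟨w, hw, hwo, hwt⟩ := hn
  refine ⟨n, fun j => (w j).fst, fun v hv => ?_⟩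
  rw [formEmbedding_apply]
  simp only [formEmbedding_apply] at hv
  obtain ⟨y, hyV⟩ := v
  simp only at hv ⊢
  rcases eq_or_ne y.fst 0 with h0 | h0
  · rw [h0, norm_zero]; positivity
  have hvn : 0 < ‖y.fst‖ := norm_pos_iff.2 h0
  have hbig : (ε ^ 2)⁻¹ * ‖y.fst‖ ^ 2 < ‖y.snd‖ ^ 2 := by
    by_contra! hle
    exact hmax (exists_orthonormal_succ (t := fun _ => (ε ^ 2)⁻¹) hw hwo hwt hyV h0 hv hle)
  have hn2 : ‖y‖ ^ 2 = ‖y.fst‖ ^ 2 + ‖y.snd‖ ^ 2 := WithLp.prod_norm_sq_eq_of_L2 y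
  rw [inv_mul_lt_iff₀ (by positivity)] at hbig
  have h4 : ‖y.fst‖ ^ 2 ≤ (ε * ‖y‖) ^ 2 := by
    rw [mul_pow, hn2]; nlinarith [mul_nonneg (sq_nonneg ε) (sq_nonneg ‖y.fst‖)]
  exact (pow_le_pow_iff_left₀ (norm_nonneg _) (by positivity) two_ne_zero).1 h4

/-- A densely defined closed form with compact embedding on an infinite dimensional space has
arbitrarily many linearly independent eigenvectors. -/
lemma exists_linearIndependent_formEigenvector (hV : IsClosed (V : Set (WithLp 2 (H × G))))
    (hcomp : IsCompactOperator (formEmbedding V))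
    (hdense : ∀ h : H, (∀ v ∈ V, inner ℝ h v.fst = 0) → h = 0)
    (hinf : ¬ FiniteDimensional ℝ H) (j : ℕ) :
    ∃ u : Fin j → H, LinearIndependent ℝ u ∧ ∀ i, ∃ μ : ℝ, IsFormEigenvector V μ (u i) := by
  have : CompleteSpace V := hV.completeSpace_coe
  set A := formEmbedding V with hA
  set K : H →L[ℝ] H := A.comp A.adjoint with hK
  have hKc : IsCompactOperator K := hcomp.comp_clm A.adjoint
  have hKs : K.IsSymmetric := by
    intro x y
    simp only [hK, ContinuousLinearMap.coe_coe, ContinuousLinearMap.comp_apply]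
    rw [← ContinuousLinearMap.adjoint_inner_right, ContinuousLinearMap.adjoint_inner_left]
  have hsp := ContinuousLinearMap.orthogonalComplement_iSup_eigenspaces_eq_bot hKc hKs
  set S : Set H := {u | ∃ μ : ℝ, IsFormEigenvector V μ u} with hS
  have hsub : (⨆ μ, Module.End.eigenspace (K : Module.End ℝ H) μ) ≤ Submodule.span ℝ S := by
    refine iSup_le fun κ u hu => ?_
    rw [Module.End.mem_eigenspace_iff] at hu
    rcases eq_or_ne u 0 with rfl | hu0
    · exact Submodule.zero_mem _
    have hAu : ∀ v : V, inner ℝ (A.adjoint u) v = inner ℝ u (v : WithLp 2 (H × G)).fst := fun v => by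
      rw [ContinuousLinearMap.adjoint_inner_left, hA, formEmbedding_apply]
    have hfst : ((A.adjoint u : V) : WithLp 2 (H × G)).fst = κ • u := hu
    have hκ : κ ≠ 0 := by
      rintro rfl
      rw [zero_smul] at hfst
      have h1 := hAu (A.adjoint u)
      rw [hfst, inner_zero_right, inner_self_eq_zero] at h1
      refine hu0 (hdense u fun v hv => ?_)
      rw [← hAu ⟨v, hv⟩, h1, inner_zero_left]
    refine Submodule.subset_span ⟨κ⁻¹ - 1, hu0, κ⁻¹ • ((A.adjoint u : V) : WithLp 2 (H × G)),
      V.smul_mem _ (A.adjoint u).2, ?_, fun y hy => ?_⟩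
    · rw [WithLp.smul_fst, hfst, smul_smul, inv_mul_cancel₀ hκ, one_smul]
    · have h1 := hAu ⟨y, hy⟩
      rw [Submodule.coe_inner, WithLp.prod_inner_apply] at h1
      change inner ℝ ((A.adjoint u : V) : WithLp 2 (H × G)).fst y.fst +
        inner ℝ ((A.adjoint u : V) : WithLp 2 (H × G)).snd y.snd = inner ℝ u y.fst at h1
      rw [hfst, real_inner_smul_left] at h1
      rw [WithLp.smul_snd, real_inner_smul_left]
      have h2 : inner ℝ ((A.adjoint u : V) : WithLp 2 (H × G)).snd y.snd =
        (1 - κ) * inner ℝ u y.fst := by linarith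
      rw [h2]; field_simp
  have hSinf : ¬ FiniteDimensional ℝ (Submodule.span ℝ S) := by
    intro hfin
    apply hinf
    have h1 : (Submodule.span ℝ S)ᗮ = ⊥ :=
      le_bot_iff.1 (hsp ▸ Submodule.orthogonal_le hsub)
    have h2 : Submodule.span ℝ S = ⊤ := Submodule.orthogonal_eq_bot_iff.1 h1
    rw [h2] at hfin
    exact Module.Finite.equiv (Submodule.topEquiv (R := ℝ) (M := H))
  obtain ⟨b, hbS, hbs, hbl⟩ := exists_linearIndependent ℝ S
  have hb : b.Infinite := by
    intro hbf
    apply hSinf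
    rw [← hbs]
    exact FiniteDimensional.span_of_finite ℝ hbf
  have : Infinite b := hb.to_subtype
  let e : Fin j ↪ b := Fin.valEmbedding.trans (Infinite.natEmbedding b)
  exact ⟨fun i => e i, hbl.comp e e.injective, fun i => hbS (e i).2⟩

end Form

/-! ### The Dirichlet Laplacian as a closed form -/

section Sobolev

open MeasureTheory Filter Topology

variable {Ω : Set Plane}

lemma IsTestFunction.memLp {φ : Plane → ℝ} (hφ : IsTestFunction Ω φ) :
    MemLp φ 2 (volume.restrict Ω) :=
  hφ.contDiff.continuous.memLp_of_hasCompactSupport hφ.hasCompactSupport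

lemma IsTestFunction.continuous_gradient {φ : Plane → ℝ} (hφ : IsTestFunction Ω φ) :
    Continuous (gradient φ) :=
  (InnerProductSpace.toDual ℝ Plane).symm.continuous.comp
    (hφ.contDiff.continuous_fderiv (by simp))

lemma IsTestFunction.memLp_gradient {φ : Plane → ℝ} (hφ : IsTestFunction Ω φ) :
    MemLp (gradient φ) 2 (volume.restrict Ω) :=
  hφ.continuous_gradient.memLp_of_hasCompactSupport
    ((hφ.hasCompactSupport.fderiv (𝕜 := ℝ)).comp_left (map_zero _))

/-- The space of test functions on `Ω`. -/
def testSpace (Ω : Set Plane) : Submodule ℝ (Plane → ℝ) where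
  carrier := {φ | IsTestFunction Ω φ}
  add_mem' := fun {φ ψ} hφ hψ => ⟨hφ.contDiff.add hψ.contDiff,
    hφ.hasCompactSupport.add hψ.hasCompactSupport,
    (tsupport_add φ ψ).trans (Set.union_subset hφ.tsupport_subset hψ.tsupport_subset)⟩
  zero_mem' := ⟨contDiff_const, HasCompactSupport.zero, by simp [tsupport]⟩
  smul_mem' := fun c φ hφ => ⟨contDiff_const.smul hφ.contDiff, hφ.hasCompactSupport.smul_left,
    (tsupport_smul_subset_right (fun _ => c) φ).trans hφ.tsupport_subset⟩

/-- The pair of a test function and its gradient. -/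
noncomputable def testPair (Ω : Set Plane) : testSpace Ω →ₗ[ℝ]
    WithLp 2 (Lp ℝ 2 (volume.restrict Ω) × Lp Plane 2 (volume.restrict Ω)) where
  toFun φ := WithLp.toLp 2 (φ.2.memLp.toLp _, φ.2.memLp_gradient.toLp _)
  map_add' := fun φ ψ => by
    have h : gradient (φ + ψ : Plane → ℝ) = gradient (φ : Plane → ℝ) + gradient (ψ : Plane → ℝ) := by
      funext x
      simp only [gradient, Pi.add_apply]
      rw [fderiv_add (φ.2.contDiff.differentiable (by simp) x)
        (ψ.2.contDiff.differentiable (by simp) x), map_add]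
    rw [← WithLp.toLp_add, Prod.mk_add_mk, ← MemLp.toLp_add, ← MemLp.toLp_add]
    congr 3
  map_smul' := fun c φ => by
    have h : gradient (c • φ : Plane → ℝ) = c • gradient (φ : Plane → ℝ) := by
      funext x
      simp only [gradient, Pi.smul_apply]
      rw [fderiv_const_smul (φ.2.contDiff.differentiable (by simp) x), map_smul]
    rw [RingHom.id_apply, ← WithLp.toLp_smul, Prod.smul_mk, ← MemLp.toLp_const_smul,
      ← MemLp.toLp_const_smul]
    congr 3

/-- The space of pairs `(u, ∇u)` with `u` in `H¹₀(Ω)`. -/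
noncomputable def sobolevGraph (Ω : Set Plane) : Submodule ℝ
    (WithLp 2 (Lp ℝ 2 (volume.restrict Ω) × Lp Plane 2 (volume.restrict Ω))) :=
  (LinearMap.range (testPair Ω)).topologicalClosure

lemma isClosed_sobolevGraph : IsClosed (sobolevGraph Ω : Set (WithLp 2
    (Lp ℝ 2 (volume.restrict Ω) × Lp Plane 2 (volume.restrict Ω)))) :=
  Submodule.isClosed_topologicalClosure _

lemma testPair_mem (φ : testSpace Ω) : testPair Ω φ ∈ sobolevGraph Ω :=
  Submodule.le_topologicalClosure _ ⟨φ, rfl⟩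

lemma coeFn_testPair_fst (φ : testSpace Ω) :
    (testPair Ω φ).fst =ᵐ[volume.restrict Ω] (φ : Plane → ℝ) :=
  φ.2.memLp.coeFn_toLp

lemma coeFn_testPair_snd (φ : testSpace Ω) :
    (testPair Ω φ).snd =ᵐ[volume.restrict Ω] gradient (φ : Plane → ℝ) :=
  φ.2.memLp_gradient.coeFn_toLp

lemma tendsto_testPair_iff {φ : ℕ → testSpace Ω}
    {x : WithLp 2 (Lp ℝ 2 (volume.restrict Ω) × Lp Plane 2 (volume.restrict Ω))} :
    Tendsto (fun k => testPair Ω (φ k)) atTop (𝓝 x) ↔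
      Tendsto (fun k => eLpNorm (fun y => (φ k : Plane → ℝ) y - x.fst y) 2
        (volume.restrict Ω)) atTop (𝓝 0) ∧
      Tendsto (fun k => eLpNorm (fun y => gradient (φ k : Plane → ℝ) y - x.snd y) 2
        (volume.restrict Ω)) atTop (𝓝 0) := by
  have h1 : ∀ k, eLpNorm (⇑(testPair Ω (φ k)).fst - ⇑x.fst) 2 (volume.restrict Ω) =
      eLpNorm (fun y => (φ k : Plane → ℝ) y - x.fst y) 2 (volume.restrict Ω) := fun k =>
    eLpNorm_congr_ae ((coeFn_testPair_fst (φ k)).sub EventuallyEq.rfl)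
  have h2 : ∀ k, eLpNorm (⇑(testPair Ω (φ k)).snd - ⇑x.snd) 2 (volume.restrict Ω) =
      eLpNorm (fun y => gradient (φ k : Plane → ℝ) y - x.snd y) 2 (volume.restrict Ω) := fun k =>
    eLpNorm_congr_ae ((coeFn_testPair_snd (φ k)).sub EventuallyEq.rfl)
  simp only [← h1, ← h2]
  rw [← Lp.tendsto_Lp_iff_tendsto_eLpNorm', ← Lp.tendsto_Lp_iff_tendsto_eLpNorm']
  constructor
  · intro h
    exact ⟨((WithLp.fstL 2 ℝ _ _).continuous.tendsto x).comp h,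
      ((WithLp.sndL 2 ℝ _ _).continuous.tendsto x).comp h⟩
  · rintro ⟨ha, hb⟩
    have := ((WithLp.prodContinuousLinearEquiv 2 ℝ (Lp ℝ 2 (volume.restrict Ω))
      (Lp Plane 2 (volume.restrict Ω))).symm.continuous.tendsto (x.fst, x.snd)).comp
      (ha.prodMk_nhds hb)
    exact this

lemma mem_sobolevGraph_iff_exists_tendsto
    {x : WithLp 2 (Lp ℝ 2 (volume.restrict Ω) × Lp Plane 2 (volume.restrict Ω))} :
    x ∈ sobolevGraph Ω ↔
      ∃ φ : ℕ → testSpace Ω, Tendsto (fun k => testPair Ω (φ k)) atTop (𝓝 x) := by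
  rw [sobolevGraph, ← SetLike.mem_coe, Submodule.topologicalClosure_coe,
    mem_closure_iff_seq_limit]
  constructor
  · rintro ⟨y, hy, hlim⟩
    choose φ hφ using hy
    exact ⟨φ, by simpa only [hφ] using hlim⟩
  · rintro ⟨φ, hφ⟩
    exact ⟨_, fun k => ⟨φ k, rfl⟩, hφ⟩

lemma mem_sobolevGraph_iff
    {x : WithLp 2 (Lp ℝ 2 (volume.restrict Ω) × Lp Plane 2 (volume.restrict Ω))} :
    x ∈ sobolevGraph Ω ↔ IsH10WithGradient Ω x.fst x.snd := by
  rw [mem_sobolevGraph_iff_exists_tendsto]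
  constructor
  · rintro ⟨φ, hφ⟩
    obtain ⟨h1, h2⟩ := tendsto_testPair_iff.1 hφ
    exact ⟨fun k => φ k, fun k => (φ k).2, h1, h2⟩
  · rintro ⟨φ, h0, h1, h2⟩
    exact ⟨fun k => ⟨φ k, h0 k⟩, tendsto_testPair_iff.2 ⟨h1, h2⟩⟩

lemma inner_testPair_fst (u : Lp ℝ 2 (volume.restrict Ω)) (φ : testSpace Ω) :
    inner ℝ u (testPair Ω φ).fst = ∫ x in Ω, u x * (φ : Plane → ℝ) x := by
  rw [L2.inner_def]
  refine integral_congr_ae ?_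
  filter_upwards [coeFn_testPair_fst φ] with x hx
  rw [hx, real_inner_eq_re_inner, RCLike.inner_apply]
  simp [mul_comm]

lemma inner_testPair_snd (g : Lp Plane 2 (volume.restrict Ω)) (φ : testSpace Ω) :
    inner ℝ g (testPair Ω φ).snd = ∫ x in Ω, inner ℝ (g x) (gradient (φ : Plane → ℝ) x) := by
  rw [L2.inner_def]
  refine integral_congr_ae ?_
  filter_upwards [coeFn_testPair_snd φ] with x hx
  rw [hx]

/-- Dirichlet eigenfunctions are the eigenvectors of the Dirichlet form; by density it suffices to
test with test functions. -/
lemma isDirichletEigenfunction_iff {μ : ℝ} {u : Lp ℝ 2 (volume.restrict Ω)} :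
    IsDirichletEigenfunction Ω μ u ↔ IsFormEigenvector (sobolevGraph Ω) μ u := by
  refine and_congr_right fun _ => ?_
  constructor
  · rintro ⟨g, hg, h⟩
    refine ⟨WithLp.toLp 2 (u, g), mem_sobolevGraph_iff.2 hg, rfl, fun y hy => ?_⟩
    obtain ⟨φ, hφ⟩ := mem_sobolevGraph_iff_exists_tendsto.1 hy
    have e : ∀ k, inner ℝ g (testPair Ω (φ k)).snd = μ * inner ℝ u (testPair Ω (φ k)).fst := by
      intro k
      rw [inner_testPair_fst, inner_testPair_snd]
      exact h _ (φ k).2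
    have h1 : Tendsto (fun k => inner ℝ g (testPair Ω (φ k)).snd) atTop (𝓝 (inner ℝ g y.snd)) :=
      tendsto_const_nhds.inner (((WithLp.sndL 2 ℝ _ _).continuous.tendsto y).comp hφ)
    have h2 : Tendsto (fun k => μ * inner ℝ u (testPair Ω (φ k)).fst) atTop
        (𝓝 (μ * inner ℝ u y.fst)) :=
      (tendsto_const_nhds.inner
        (((WithLp.fstL 2 ℝ _ _).continuous.tendsto y).comp hφ)).const_mul μ
    exact tendsto_nhds_unique h1 (h2.congr fun k => (e k).symm)
  · rintro ⟨x, hx, rfl, h⟩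
    refine ⟨x.snd, mem_sobolevGraph_iff.1 hx, fun φ hφ => ?_⟩
    have := h _ (testPair_mem ⟨φ, hφ⟩)
    rw [inner_testPair_fst, inner_testPair_snd] at this
    exact this

lemma setIntegral_eq_integral_of_tsupport {f : Plane → ℝ} (hf : tsupport f ⊆ Ω) :
    ∫ x in Ω, f x = ∫ x, f x :=
  setIntegral_eq_integral_of_forall_compl_eq_zero fun _ hx =>
    image_eq_zero_of_notMem_tsupport fun h => hx (hf h)

lemma inner_testPair_testPair (φ ψ : testSpace Ω) :
    inner ℝ (testPair Ω φ).fst (testPair Ω ψ).fst =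
      ∫ x, (φ : Plane → ℝ) x * (ψ : Plane → ℝ) x := by
  rw [inner_testPair_fst, ← setIntegral_eq_integral_of_tsupport
    ((tsupport_mul_subset_left).trans φ.2.tsupport_subset)]
  refine integral_congr_ae ?_
  filter_upwards [coeFn_testPair_fst φ] with x hx
  rw [hx]

lemma norm_testPair_snd_sq (φ : testSpace Ω) :
    ‖(testPair Ω φ).snd‖ ^ 2 = gradEnergy (φ : Plane → ℝ) := by
  rw [← real_inner_self_eq_norm_sq, inner_testPair_snd, gradEnergy]
  have e : ∫ x in Ω, inner ℝ ((testPair Ω φ).snd x) (gradient (φ : Plane → ℝ) x) =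
      ∫ x in Ω, ‖gradient (φ : Plane → ℝ) x‖ ^ 2 := by
    refine integral_congr_ae ?_
    filter_upwards [coeFn_testPair_snd φ] with x hx
    rw [hx, real_inner_self_eq_norm_sq]
  rw [e]
  refine setIntegral_eq_integral_of_forall_compl_eq_zero fun x hx => ?_
  have h0 : fderiv ℝ (φ : Plane → ℝ) x = 0 :=
    image_eq_zero_of_notMem_tsupport fun h =>
      hx (φ.2.tsupport_subset (tsupport_fderiv_subset ℝ h))
  rw [gradient, h0, map_zero, norm_zero, zero_pow two_ne_zero]

/-- The Gram matrix of a family of test functions, compared with the identity matrix. -/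
lemma gramLE_of_testSpace {n : ℕ} (φ : Fin n → testSpace Ω) :
    GramLE (fun j => (φ j : Plane → ℝ)) (1 + ∑ i, ∑ j, |inner ℝ (testPair Ω (φ i)).fst
      (testPair Ω (φ j)).fst - if i = j then 1 else 0|) := by
  intro t
  set A := fun i j => inner ℝ (testPair Ω (φ i)).fst (testPair Ω (φ j)).fst with hA
  have h1 : ∫ x, (∑ j, t j * (φ j : Plane → ℝ) x) ^ 2 = ∑ i, ∑ j, t i * t j * A i j := by
    have e : ∀ x, (∑ j, t j * (φ j : Plane → ℝ) x) ^ 2 =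
        ∑ i, ∑ j, t i * t j * ((φ i : Plane → ℝ) x * (φ j : Plane → ℝ) x) := by
      intro x
      rw [sq, Finset.sum_mul_sum]
      exact Finset.sum_congr rfl fun i _ => Finset.sum_congr rfl fun j _ => by ring
    have hi : ∀ i j, Integrable fun x => t i * t j * ((φ i : Plane → ℝ) x * (φ j : Plane → ℝ) x) :=
      fun i j => ((φ j).2.integrable_mul_of_continuous (φ i).2.contDiff.continuous).const_mul _
    simp only [e]
    rw [integral_finsetSum _ fun i _ => integrable_finsetSum _ fun j _ => hi i j]
    refine Finset.sum_congr rfl fun i _ => ?_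
    rw [integral_finsetSum _ fun j _ => hi i j]
    refine Finset.sum_congr rfl fun j _ => ?_
    rw [integral_const_mul]
    simp only [hA, inner_testPair_testPair]
  rw [h1]
  have h2 : ∑ i, ∑ j, t i * t j * (if i = j then (1 : ℝ) else 0) = ∑ j, t j ^ 2 := by
    simp [sq]
  have h3 : ∀ i j, |t i * t j| ≤ ∑ k, t k ^ 2 := by
    intro i j
    have hi := Finset.single_le_sum (f := fun k => t k ^ 2) (fun k _ => sq_nonneg _)
      (Finset.mem_univ i)
    have hj := Finset.single_le_sum (f := fun k => t k ^ 2) (fun k _ => sq_nonneg _)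
      (Finset.mem_univ j)
    rw [abs_mul]
    nlinarith [sq_nonneg (|t i| - |t j|), sq_abs (t i), sq_abs (t j)]
  have h4 : ∀ i j, t i * t j * A i j ≤ t i * t j * (if i = j then (1 : ℝ) else 0) +
      |A i j - if i = j then 1 else 0| * ∑ k, t k ^ 2 := by
    intro i j
    have := mul_le_mul_of_nonneg_left (h3 i j) (abs_nonneg (A i j - if i = j then 1 else 0))
    have h5 := le_abs_self ((A i j - if i = j then 1 else 0) * (t i * t j))
    rw [abs_mul] at h5
    linarith
  calc _ ≤ ∑ i, ∑ j, (t i * t j * (if i = j then (1 : ℝ) else 0) +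
      |A i j - if i = j then 1 else 0| * ∑ k, t k ^ 2) :=
        Finset.sum_le_sum fun i _ => Finset.sum_le_sum fun j _ => h4 i j
    _ = _ := by
        simp only [Finset.sum_add_distrib, h2, ← Finset.sum_mul]
        ring

/-- A lower bound on the energies of nearly orthonormal families of test functions passes to
orthonormal families in `H¹₀`. -/
lemma le_sum_norm_snd_sq {α t R : ℝ} {n : ℕ}
    (hB : ∀ (φ : Fin n → Plane → ℝ) (C : ℝ), (∀ j, IsTestFunction Ω (φ j)) → 0 ≤ C → GramLE φ C →
      α * (t * (∑ j, ∫ x, φ j x ^ 2) - C * R) ≤ ∑ j, gradEnergy (φ j))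
    {w : Fin n → WithLp 2 (Lp ℝ 2 (volume.restrict Ω) × Lp Plane 2 (volume.restrict Ω))}
    (hw : ∀ j, w j ∈ sobolevGraph Ω) (hwo : Orthonormal ℝ fun j => (w j).fst) :
    α * (n * t - R) ≤ ∑ j, ‖(w j).snd‖ ^ 2 := by
  have hw' := fun j => mem_sobolevGraph_iff_exists_tendsto.1 (hw j)
  choose φ hφ using hw'
  have h1 : ∀ j, Tendsto (fun k => (testPair Ω (φ j k)).fst) atTop (𝓝 (w j).fst) := fun j =>
    ((WithLp.fstL 2 ℝ _ _).continuous.tendsto _).comp (hφ j)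
  have h2 : ∀ j, Tendsto (fun k => (testPair Ω (φ j k)).snd) atTop (𝓝 (w j).snd) := fun j =>
    ((WithLp.sndL 2 ℝ _ _).continuous.tendsto _).comp (hφ j)
  rw [orthonormal_iff_ite] at hwo
  have hC : Tendsto (fun k => 1 + ∑ i, ∑ j, |inner ℝ (testPair Ω (φ i k)).fst
      (testPair Ω (φ j k)).fst - if i = j then 1 else 0|) atTop (𝓝 1) := by
    have h3 : Tendsto (fun k => 1 + ∑ i, ∑ j, |inner ℝ (testPair Ω (φ i k)).fst
      (testPair Ω (φ j k)).fst - if i = j then 1 else 0|) atTop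
        (𝓝 (1 + ∑ i, ∑ j, |inner ℝ (w i).fst (w j).fst - if i = j then 1 else 0|)) :=
      tendsto_const_nhds.add (tendsto_finsetSum _ fun i _ => tendsto_finsetSum _ fun j _ =>
        (((h1 i).inner (h1 j)).sub tendsto_const_nhds).abs)
    simpa [hwo] using h3
  have hN : Tendsto (fun k => ∑ j, ∫ x, ((φ j k : Plane → ℝ) x) ^ 2) atTop (𝓝 n) := by
    have h3 : Tendsto (fun k => ∑ j, inner ℝ (testPair Ω (φ j k)).fst (testPair Ω (φ j k)).fst)
        atTop (𝓝 (∑ j, inner ℝ (w j).fst (w j).fst)) :=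
      tendsto_finsetSum _ fun j _ => (h1 j).inner (h1 j)
    have h4 : ∑ j, inner ℝ (w j).fst (w j).fst = (n : ℝ) := by simp only [hwo]; simp
    rw [h4] at h3
    refine h3.congr fun k => Finset.sum_congr rfl fun j _ => ?_
    rw [inner_testPair_testPair]
    simp only [sq]
  have hG : Tendsto (fun k => ∑ j, gradEnergy (φ j k : Plane → ℝ)) atTop
      (𝓝 (∑ j, ‖(w j).snd‖ ^ 2)) := by
    simp only [← norm_testPair_snd_sq]
    exact tendsto_finsetSum _ fun j _ => (h2 j).norm.pow 2
  have hL := (((hN.const_mul t).sub (hC.mul_const R)).const_mul α)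
  rw [one_mul, mul_comm t] at hL
  refine le_of_tendsto_of_tendsto' hL hG fun k => ?_
  exact hB (fun j => φ j k) _ (fun j => (φ j k).2)
    (add_nonneg zero_le_one (Finset.sum_nonneg fun i _ => Finset.sum_nonneg fun j _ =>
      abs_nonneg _)) (gramLE_of_testSpace fun j => φ j k)

lemma eq_zero_of_inner_sobolevGraph (hΩ : IsOpen Ω) (h : Lp ℝ 2 (volume.restrict Ω))
    (hh : ∀ v ∈ sobolevGraph Ω, inner ℝ h v.fst = 0) : h = 0 := by
  rw [Lp.eq_zero_iff_ae_eq_zero]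
  have h1 : ∀ᵐ x ∂(volume : Measure Plane), x ∈ Ω → h x = 0 := by
    refine hΩ.ae_eq_zero_of_integral_contDiff_smul_eq_zero
      (locallyIntegrableOn_of_locallyIntegrable_restrict
        ((Lp.memLp h).locallyIntegrable (by norm_num))) fun g h1 h2 h3 => ?_
    have hg : IsTestFunction Ω g := ⟨h1, h2, h3⟩
    have h4 := hh _ (testPair_mem ⟨g, hg⟩)
    rw [inner_testPair_fst] at h4
    rw [← setIntegral_eq_integral_of_tsupport ((tsupport_smul_subset_left g _).trans h3), ← h4]
    simp only [smul_eq_mul, mul_comm]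
  exact (ae_restrict_iff' hΩ.measurableSet).2 h1

lemma not_finiteDimensional_Lp (hΩ : IsOpen Ω) (hne : Ω.Nonempty) (hb : volume Ω ≠ ⊤) :
    ¬ FiniteDimensional ℝ (Lp ℝ 2 (volume.restrict Ω)) := by
  intro hfin
  have hinf : Ω.Infinite := by
    obtain ⟨x, hx⟩ := hne
    exact infinite_of_mem_nhds x (hΩ.mem_nhds hx)
  obtain ⟨s, hs, hcard⟩ := hinf.exists_subset_card_eq
    (Module.finrank ℝ (Lp ℝ 2 (volume.restrict Ω)) + 1)
  obtain ⟨U, hU, hd⟩ := s.finite_toSet.t2_separation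
  have hfm : IsFiniteMeasure (volume.restrict Ω) := ⟨by simpa using lt_top_iff_ne_top.2 hb⟩
  have hpos : ∀ i ∈ s, 0 < (volume.restrict Ω).real (U i) := by
    intro i hi
    refine ENNReal.toReal_pos ?_ (measure_ne_top _ _)
    rw [Measure.restrict_apply (hU i).2.measurableSet]
    exact ((hU i).2.inter hΩ).measure_ne_zero _ ⟨i, (hU i).1, hs hi⟩
  have hli : LinearIndependent ℝ fun i : s => indicatorConstLp (μ := volume.restrict Ω) 2
      (hU i).2.measurableSet (measure_ne_top _ _) (1 : ℝ) := by
    refine linearIndependent_of_ne_zero_of_inner_eq_zero (𝕜 := ℝ) ?_ ?_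
    · intro i h0
      have h1 := L2.real_inner_indicatorConstLp_one_indicatorConstLp_one
        (μ := volume.restrict Ω) (hU i).2.measurableSet (hU i).2.measurableSet
        (measure_ne_top _ _) (measure_ne_top _ _)
      rw [h0, inner_zero_left, Set.inter_self] at h1
      exact (hpos i i.2).ne h1
    · intro i j hij
      rw [L2.real_inner_indicatorConstLp_one_indicatorConstLp_one,
        (hd i.2 j.2 fun h => hij (Subtype.ext h)).inter_eq]
      simp
  have := hli.fintype_card_le_finrank
  rw [Fintype.card_coe, hcard] at this
  omega

/-- A Riesz-mean lower bound on test functions yields the lower bound on sums of eigenvalues. The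
discreteness of the spectrum is part of the claim: it follows from the bound itself. -/
theorem le_sum_dirichletEigenvalue {α : ℝ} {R : ℕ → ℝ} (hα : 0 < α) (hΩ : IsOpen Ω)
    (hne : Ω.Nonempty) (hb : volume Ω ≠ ⊤)
    (hB : ∀ (n : ℕ) (φ : Fin n → Plane → ℝ) (C : ℝ), (∀ j, IsTestFunction Ω (φ j)) → 0 ≤ C →
      GramLE φ C → ∀ t : ℕ,
        α * (t * (∑ j, ∫ x, φ j x ^ 2) - C * R t) ≤ ∑ j, gradEnergy (φ j)) (n t : ℕ) :
    α * (n * t - R t) ≤ ∑ j ∈ Finset.Icc 1 n, dirichletEigenvalue Ω j := by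
  have hW := fun (t : ℕ) (n : ℕ) (w : Fin n → _) => le_sum_norm_snd_sq (n := n) (α := α) (t := t)
    (R := R t) (Ω := Ω) (w := w) fun φ C h1 h2 h3 => hB n φ C h1 h2 h3 t
  have hcomp : IsCompactOperator (formEmbedding (sobolevGraph Ω)) := by
    refine isCompactOperator_formEmbedding isClosed_sobolevGraph fun Λ => ?_
    obtain ⟨t, ht⟩ := exists_nat_ge ((Λ + 1) / α)
    obtain ⟨N, hN⟩ := exists_nat_ge (α * R t)
    refine ⟨N, fun n w hw hwo hwΛ => ?_⟩
    have h1 := hW t n w hw hwo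
    have h2 : ∑ j, ‖(w j).snd‖ ^ 2 ≤ n * Λ := by
      refine (Finset.sum_le_sum fun j _ => hwΛ j).trans ?_
      simp
    rw [div_le_iff₀ hα] at ht
    have h3 : (n : ℝ) * (Λ + 1) ≤ n * (t * α) := mul_le_mul_of_nonneg_left ht n.cast_nonneg
    have h4 : (n : ℝ) ≤ N := by nlinarith
    exact_mod_cast h4
  have hev := exists_linearIndependent_formEigenvector isClosed_sobolevGraph hcomp
    (eq_zero_of_inner_sobolevGraph hΩ) (not_finiteDimensional_Lp hΩ hne hb)
  refine le_of_forall_pos_le_add fun ε hε => ?_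
  have hex : ∀ j < n, ∃ u : Fin (j + 1) → Lp ℝ 2 (volume.restrict Ω), LinearIndependent ℝ u ∧
      ∀ i, ∃ μ : ℝ, μ ≤ dirichletEigenvalue Ω (j + 1) + ε / (n + 1) ∧
        IsFormEigenvector (sobolevGraph Ω) μ (u i) := by
    intro j _
    have hne : {t : ℝ | ∃ u : Fin (j + 1) → Lp ℝ 2 (volume.restrict Ω),
        LinearIndependent ℝ u ∧
          ∀ i, ∃ μ : ℝ, μ ≤ t ∧ IsDirichletEigenfunction Ω μ (u i)}.Nonempty := by
      obtain ⟨u, hu, hu'⟩ := hev (j + 1)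
      choose μ hμ using hu'
      obtain ⟨M, hM⟩ := Finite.exists_le μ
      exact ⟨M, u, hu, fun i => ⟨μ i, hM i, isDirichletEigenfunction_iff.2 (hμ i)⟩⟩
    obtain ⟨τ, ⟨u, hu, hu'⟩, hτ⟩ := exists_lt_of_csInf_lt hne
      (lt_add_of_pos_right (dirichletEigenvalue Ω (j + 1)) (by positivity : 0 < ε / (n + 1)))
    refine ⟨u, hu, fun i => ?_⟩
    obtain ⟨μ, hμ, hμ'⟩ := hu' i
    exact ⟨μ, hμ.trans hτ.le, isDirichletEigenfunction_iff.1 hμ'⟩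
  obtain ⟨w, hw, hwo, hwt⟩ := exists_orthonormal_le
    (t := fun j => dirichletEigenvalue Ω (j + 1) + ε / (n + 1)) hex
  refine (hW t n w hw hwo).trans ((Finset.sum_le_sum fun j _ => hwt j).trans ?_)
  rw [Finset.sum_add_distrib, Finset.sum_const, Finset.card_univ, Fintype.card_fin, nsmul_eq_mul,
    Fin.sum_univ_eq_sum_range (fun j => dirichletEigenvalue Ω (j + 1)),
    Finset.range_eq_Ico, Finset.sum_Ico_add' (fun j => dirichletEigenvalue Ω j) 0 n 1]
  have h1 : (n : ℝ) * (ε / (n + 1)) ≤ ε := by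
    rw [mul_div_assoc', div_le_iff₀ (by positivity)]
    nlinarith
  exact add_le_add (le_of_eq (Finset.sum_congr (by ext; simp) fun _ _ => rfl)) h1

end Sobolev

/-! ### Functions vanishing on the boundary of a polygon belong to `H¹₀` -/

section Cutoff

open MeasureTheory Filter Topology

lemma tendsto_eLpNorm_two_of_bounded {α E : Type*} [MeasurableSpace α] [NormedAddCommGroup E]
    {μ : Measure α} [IsFiniteMeasure μ] {F : ℕ → α → E} {C : ℝ}
    (hm : ∀ k, AEStronglyMeasurable (F k) μ) (hC : ∀ k, ∀ᵐ x ∂μ, ‖F k x‖ ≤ C)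
    (h0 : ∀ᵐ x ∂μ, Tendsto (fun k => F k x) atTop (𝓝 0)) :
    Tendsto (fun k => eLpNorm (F k) 2 μ) atTop (𝓝 0) := by
  have h1 : Tendsto (fun k => ∫⁻ x, ‖F k x‖ₑ ^ (2 : ℝ) ∂μ) atTop (𝓝 (∫⁻ _, 0 ∂μ)) := by
    refine tendsto_lintegral_of_dominated_convergence' (fun _ => ENNReal.ofReal C ^ (2 : ℝ))
      (fun k => (hm k).enorm.pow_const _) (fun k => ?_) ?_ ?_
    · filter_upwards [hC k] with x hx
      gcongr
      rw [← ofReal_norm]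
      exact ENNReal.ofReal_le_ofReal hx
    · rw [lintegral_const]
      exact ENNReal.mul_ne_top (by finiteness) (measure_ne_top _ _)
    · filter_upwards [h0] with x hx
      have h2 := (ENNReal.continuous_rpow_const (y := 2)).tendsto (0 : ENNReal) |>.comp
        (by simpa using hx.enorm)
      simpa [Function.comp_def] using h2
  rw [lintegral_zero] at h1
  have h2 := (ENNReal.continuous_rpow_const (y := 1 / 2)).tendsto (0 : ENNReal) |>.comp h1
  rw [ENNReal.zero_rpow_of_pos (by norm_num)] at h2
  refine h2.congr fun k => ?_
  rw [eLpNorm_eq_lintegral_rpow_enorm_toReal (by norm_num) (by norm_num)]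
  simp

/-- A smooth step function that vanishes on `(-∞, 1]` and equals `1` on `[2, ∞)`. -/
noncomputable def smoothStep (z : ℝ) : ℝ := Real.smoothTransition (z - 1)

lemma contDiff_smoothStep : ContDiff ℝ (⊤ : ℕ∞) smoothStep :=
  Real.smoothTransition.contDiff.comp (contDiff_id.sub contDiff_const)

lemma smoothStep_nonneg (z : ℝ) : 0 ≤ smoothStep z := Real.smoothTransition.nonneg _

lemma smoothStep_le_one (z : ℝ) : smoothStep z ≤ 1 := Real.smoothTransition.le_one _

lemma smoothStep_of_le {z : ℝ} (h : z ≤ 1) : smoothStep z = 0 :=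
  Real.smoothTransition.zero_of_nonpos (by linarith)

lemma smoothStep_of_ge {z : ℝ} (h : 2 ≤ z) : smoothStep z = 1 :=
  Real.smoothTransition.one_of_one_le (by linarith)

/-- The logarithmic derivative bound which makes the step usable as a boundary cutoff. -/
lemma exists_abs_mul_deriv_smoothStep_le : ∃ B, ∀ z, |z * deriv smoothStep z| ≤ B := by
  have hc : Continuous fun z => z * deriv smoothStep z :=
    continuous_id.mul (contDiff_smoothStep.continuous_deriv (by simp))
  refine hc.bounded_above_of_compact_support (HasCompactSupport.intro (isCompact_Icc (a := 1)
    (b := 2)) fun z hz => ?_)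
  have : deriv smoothStep z = 0 := by
    rcases lt_or_ge z 1 with h | h
    · have e : smoothStep =ᶠ[𝓝 z] fun _ => 0 := by
        filter_upwards [Iio_mem_nhds h] with y hy
        exact smoothStep_of_le (le_of_lt hy)
      rw [e.deriv_eq, deriv_const]
    · have h2 : 2 < z := by
        by_contra! h2
        exact hz ⟨h, h2⟩
      have e : smoothStep =ᶠ[𝓝 z] fun _ => 1 := by
        filter_upwards [Ioi_mem_nhds h2] with y hy
        exact smoothStep_of_ge (le_of_lt hy)
      rw [e.deriv_eq, deriv_const]
  rw [this, mul_zero]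

lemma norm_gradient (f : Plane → ℝ) (x : Plane) : ‖gradient f x‖ = ‖fderiv ℝ f x‖ := by
  rw [gradient, LinearIsometryEquiv.norm_map]

variable {ι : Type*} [Fintype ι] {c : ι → ℝ} {ℓ : ι → Plane →L[ℝ] ℝ}

/-- The cutoff function of a polygon given by affine inequalities. -/
noncomputable def polygonCutoff (c : ι → ℝ) (ℓ : ι → Plane →L[ℝ] ℝ) (k : ℕ) (x : Plane) : ℝ :=
  ∏ i, smoothStep ((k + 1) * (c i + ℓ i x))

lemma contDiff_polygonCutoff (k : ℕ) : ContDiff ℝ (⊤ : ℕ∞) (polygonCutoff c ℓ k) :=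
  contDiff_prod fun i _ => contDiff_smoothStep.comp
    (contDiff_const.mul (contDiff_const.add (ℓ i).contDiff))

lemma abs_polygonCutoff_le (k : ℕ) (x : Plane) : |polygonCutoff c ℓ k x| ≤ 1 := by
  have h0 : 0 ≤ polygonCutoff c ℓ k x := Finset.prod_nonneg fun i _ => smoothStep_nonneg _
  rw [abs_of_nonneg h0]
  exact Finset.prod_le_one (fun i _ => smoothStep_nonneg _) fun i _ => smoothStep_le_one _

lemma norm_fderiv_polygonCutoff_le {B : ℝ} (hB : ∀ z, |z * deriv smoothStep z| ≤ B) {k : ℕ}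
    {x : Plane} {y : ℝ} (hx : ∀ i, 0 < c i + ℓ i x) (hy : ∀ i, |y| ≤ c i + ℓ i x) :
    |y| * ‖fderiv ℝ (polygonCutoff c ℓ k) x‖ ≤ B * ∑ i, ‖ℓ i‖ := by
  classical
  have hk : (0 : ℝ) < k + 1 := by positivity
  have h1 : ∀ i, HasFDerivAt (fun x => smoothStep ((k + 1) * (c i + ℓ i x)))
      (deriv smoothStep ((k + 1) * (c i + ℓ i x)) • ((k + 1 : ℝ) • ℓ i)) x := by
    intro i
    have ha : HasFDerivAt (fun x => (k + 1 : ℝ) * (c i + ℓ i x)) ((k + 1 : ℝ) • ℓ i) x :=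
      ((ℓ i).hasFDerivAt.const_add (c i)).const_mul _
    exact (contDiff_smoothStep.differentiable (by simp) _).hasDerivAt.comp_hasFDerivAt x ha
  have h2 := HasFDerivAt.finsetProd (u := Finset.univ) fun i _ => h1 i
  have h3 : fderiv ℝ (polygonCutoff c ℓ k) x = _ := h2.fderiv
  rw [h3, Finset.mul_sum]
  refine (mul_le_mul_of_nonneg_left (norm_sum_le _ _) (abs_nonneg y)).trans ?_
  rw [Finset.mul_sum]
  refine Finset.sum_le_sum fun i _ => ?_
  rw [norm_smul, norm_smul, norm_smul, Real.norm_eq_abs, Real.norm_eq_abs, Real.norm_eq_abs]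
  have hp0 : 0 ≤ ∏ j ∈ Finset.univ.erase i, smoothStep ((k + 1) * (c j + ℓ j x)) :=
    Finset.prod_nonneg fun j _ => smoothStep_nonneg _
  have hp1 : ∏ j ∈ Finset.univ.erase i, smoothStep ((k + 1) * (c j + ℓ j x)) ≤ 1 :=
    Finset.prod_le_one (fun j _ => smoothStep_nonneg _) fun j _ => smoothStep_le_one _
  rw [abs_of_nonneg hp0, abs_of_pos hk]
  have h4 := hB ((k + 1) * (c i + ℓ i x))
  rw [abs_mul, abs_mul, abs_of_pos hk, abs_of_pos (hx i)] at h4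
  set p := ∏ j ∈ Finset.univ.erase i, smoothStep ((k + 1) * (c j + ℓ j x))
  set d := |deriv smoothStep ((k + 1) * (c i + ℓ i x))| with hd
  have hd0 : 0 ≤ d := abs_nonneg _
  calc |y| * (p * (d * ((k + 1) * ‖ℓ i‖))) = p * ((|y| * ((k + 1) * d)) * ‖ℓ i‖) := by ring
    _ ≤ 1 * (((c i + ℓ i x) * ((k + 1) * d)) * ‖ℓ i‖) := by
        gcongr
        exact hy i
    _ = ((k + 1) * (c i + ℓ i x) * d) * ‖ℓ i‖ := by ring
    _ ≤ B * ‖ℓ i‖ := by gcongr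

/-- A smooth function that is bounded by a multiple of the distance to each side of a bounded convex
polygon belongs to `H¹₀` of the polygon. -/
theorem isH10WithGradient_of_abs_le {Ω : Set Plane} (hΩ : Ω = {x | ∀ i, 0 < c i + ℓ i x})
    (hb : Bornology.IsBounded Ω) {f : Plane → ℝ} (hf : ContDiff ℝ (⊤ : ℕ∞) f) {C : ℝ} (hC : 0 < C)
    (hfC : ∀ x ∈ Ω, ∀ i, |f x| ≤ C * (c i + ℓ i x)) (hm : MemLp f 2 (volume.restrict Ω))
    (hg : MemLp (gradient f) 2 (volume.restrict Ω)) :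
    IsH10WithGradient Ω (hm.toLp f) (hg.toLp (gradient f)) := by
  have hfin : IsFiniteMeasure (volume.restrict Ω) := ⟨by simpa using hb.measure_lt_top⟩
  have hmeas : MeasurableSet Ω := by
    rw [hΩ]
    have : {x : Plane | ∀ i, 0 < c i + ℓ i x} = ⋂ i, {x | 0 < c i + ℓ i x} := by
      ext; simp
    rw [this]
    exact MeasurableSet.iInter fun i => (isOpen_lt continuous_const
      (continuous_const.add (ℓ i).continuous)).measurableSet
  obtain ⟨B, hB⟩ := exists_abs_mul_deriv_smoothStep_le
  have hdf : Continuous (fderiv ℝ f) := hf.continuous_fderiv (by simp)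
  obtain ⟨M, hM⟩ : ∃ M, ∀ x ∈ Ω, |f x| ≤ M := by
    obtain ⟨M, hM⟩ := hb.isCompact_closure.exists_bound_of_continuousOn hf.continuous.continuousOn
    exact ⟨M, fun x hx => hM x (subset_closure hx)⟩
  obtain ⟨N, hN⟩ : ∃ N, ∀ x ∈ Ω, ‖fderiv ℝ f x‖ ≤ N := by
    obtain ⟨N, hN⟩ := hb.isCompact_closure.exists_bound_of_continuousOn hdf.continuousOn
    exact ⟨N, fun x hx => hN x (subset_closure hx)⟩
  set χ := polygonCutoff c ℓ with hχ
  have hχs : ∀ k, ContDiff ℝ (⊤ : ℕ∞) (χ k) := fun k => contDiff_polygonCutoff k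
  have hφs : ∀ k, ContDiff ℝ (⊤ : ℕ∞) (χ k * f) := fun k => (hχs k).mul hf
  have hts : ∀ k, tsupport (χ k * f) ⊆ {x | ∀ i, 1 ≤ ((k : ℝ) + 1) * (c i + ℓ i x)} := by
    intro k
    apply closure_minimal
    · intro x hx i
      by_contra! h
      apply hx
      have : χ k x = 0 := Finset.prod_eq_zero (Finset.mem_univ i) (smoothStep_of_le h.le)
      rw [Pi.mul_apply, this, zero_mul]
    · simp only [Set.ofPred_forall]
      exact isClosed_iInter fun i => isClosed_le continuous_const (by fun_prop)
  have htΩ : ∀ k, tsupport (χ k * f) ⊆ Ω := by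
    intro k x hx
    rw [hΩ]
    intro i
    have h1 := hts k hx i
    have hk : (0 : ℝ) < k + 1 := by positivity
    by_contra! h
    nlinarith
  have hev : ∀ x ∈ Ω, ∀ᶠ k : ℕ in atTop, (χ k * f) =ᶠ[𝓝 x] f := by
    intro x hx
    rw [hΩ] at hx
    have h1 : ∀ᶠ k : ℕ in atTop, ∀ i, 2 < ((k : ℝ) + 1) * (c i + ℓ i x) := by
      rw [eventually_all]
      intro i
      have : Tendsto (fun k : ℕ => ((k : ℝ) + 1) * (c i + ℓ i x)) atTop atTop :=
        (tendsto_atTop_add_const_right _ _ tendsto_natCast_atTop_atTop).atTop_mul_const (hx i)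
      exact this.eventually_gt_atTop 2
    filter_upwards [h1] with k hk
    have h2 : ∀ᶠ y in 𝓝 x, ∀ i, 2 < ((k : ℝ) + 1) * (c i + ℓ i y) := by
      rw [eventually_all]
      intro i
      have hcont : Continuous fun y => ((k : ℝ) + 1) * (c i + ℓ i y) := by fun_prop
      exact hcont.continuousAt.eventually (lt_mem_nhds (hk i))
    filter_upwards [h2] with y hy
    have : χ k y = 1 := Finset.prod_eq_one fun i _ => smoothStep_of_ge (hy i).le
    rw [Pi.mul_apply, this, one_mul]
  refine ⟨fun k => χ k * f, fun k => ⟨hφs k, ?_, htΩ k⟩, ?_, ?_⟩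
  · exact (hb.isCompact_closure).of_isClosed_subset (isClosed_tsupport _)
      ((htΩ k).trans subset_closure)
  · have e : ∀ k, eLpNorm (fun x => (χ k * f) x - hm.toLp f x) 2 (volume.restrict Ω) =
        eLpNorm (fun x => (χ k * f) x - f x) 2 (volume.restrict Ω) := fun k =>
      eLpNorm_congr_ae (EventuallyEq.rfl.sub hm.coeFn_toLp)
    simp only [e]
    refine tendsto_eLpNorm_two_of_bounded (C := 2 * M)
      (fun k => ((hφs k).continuous.sub hf.continuous).aestronglyMeasurable) (fun k => ?_) ?_
    · refine (ae_restrict_iff' hmeas).2 (Eventually.of_forall fun x hx => ?_)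
      refine (norm_sub_le _ _).trans ?_
      rw [Pi.mul_apply, norm_mul, Real.norm_eq_abs, Real.norm_eq_abs]
      have h1 := hM x hx
      have h2 := abs_polygonCutoff_le (c := c) (ℓ := ℓ) k x
      nlinarith [abs_nonneg (f x), abs_nonneg (polygonCutoff c ℓ k x)]
    · refine (ae_restrict_iff' hmeas).2 (Eventually.of_forall fun x hx => ?_)
      refine tendsto_const_nhds.congr' ?_
      filter_upwards [hev x hx] with k hk
      rw [hk.self_of_nhds, sub_self]
  · have e : ∀ k, eLpNorm (fun x => gradient (χ k * f) x - hg.toLp (gradient f) x) 2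
        (volume.restrict Ω) =
        eLpNorm (fun x => gradient (χ k * f) x - gradient f x) 2 (volume.restrict Ω) := fun k =>
      eLpNorm_congr_ae (EventuallyEq.rfl.sub hg.coeFn_toLp)
    simp only [e]
    have hgc : ∀ {h : Plane → ℝ}, ContDiff ℝ (⊤ : ℕ∞) h → Continuous (gradient h) := fun hh =>
      (InnerProductSpace.toDual ℝ Plane).symm.continuous.comp (hh.continuous_fderiv (by simp))
    refine tendsto_eLpNorm_two_of_bounded (C := 2 * N + C * (B * ∑ i, ‖ℓ i‖))
      (fun k => ((hgc (hφs k)).sub (hgc hf)).aestronglyMeasurable) (fun k => ?_) ?_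
    · refine (ae_restrict_iff' hmeas).2 (Eventually.of_forall fun x hx => ?_)
      refine (norm_sub_le _ _).trans ?_
      rw [norm_gradient, norm_gradient, fderiv_mul ((hχs k).differentiable (by simp) x)
        (hf.differentiable (by simp) x)]
      have h1 : ‖χ k x • fderiv ℝ f x‖ ≤ N := by
        rw [norm_smul, Real.norm_eq_abs]
        have h1 := hN x hx
        have h2 := abs_polygonCutoff_le (c := c) (ℓ := ℓ) k x
        nlinarith [norm_nonneg (fderiv ℝ f x), abs_nonneg (polygonCutoff c ℓ k x)]
      have h2 : ‖f x • fderiv ℝ (χ k) x‖ ≤ C * (B * ∑ i, ‖ℓ i‖) := by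
        rw [norm_smul, Real.norm_eq_abs]
        have h3 := norm_fderiv_polygonCutoff_le (c := c) (ℓ := ℓ) (k := k) (x := x)
          (y := f x / C) hB (by rw [hΩ] at hx; exact hx) fun i => by
            rw [abs_div, abs_of_pos hC, div_le_iff₀ hC, mul_comm]
            exact hfC x hx i
        rw [abs_div, abs_of_pos hC] at h3
        have h4 := mul_le_mul_of_nonneg_left h3 hC.le
        calc |f x| * ‖fderiv ℝ (χ k) x‖ = C * (|f x| / C * ‖fderiv ℝ (χ k) x‖) := by
              field_simp
          _ ≤ _ := h4
      have h3 := norm_add_le (χ k x • fderiv ℝ f x) (f x • fderiv ℝ (χ k) x)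
      have h4 := hN x hx
      linarith
    · refine (ae_restrict_iff' hmeas).2 (Eventually.of_forall fun x hx => ?_)
      refine tendsto_const_nhds.congr' ?_
      filter_upwards [hev x hx] with k hk
      rw [gradient, gradient, hk.fderiv_eq, sub_self]

end Cutoff

/-! ### The eigenfunctions of the equilateral triangle -/

section Lame

open MeasureTheory Filter Topology

/-- The function `cos + sin`. -/
noncomputable def cas (θ : ℝ) : ℝ := Real.cos θ + Real.sin θ

lemma contDiff_cas {n : WithTop ℕ∞} : ContDiff ℝ n cas := Real.contDiff_cos.add Real.contDiff_sin

lemma hasDerivAt_cas (θ : ℝ) : HasDerivAt cas (-Real.sin θ + Real.cos θ) θ :=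
  (Real.hasDerivAt_cos θ).add (Real.hasDerivAt_sin θ)

lemma abs_cas_sub_cas_le (x y : ℝ) : |cas x - cas y| ≤ 2 * |x - y| := by
  have h := Convex.norm_image_sub_le_of_norm_hasDerivWithin_le (f := cas)
    (f' := fun θ => -Real.sin θ + Real.cos θ) (C := 2) (s := Set.univ) (x := y) (y := x)
    (fun θ _ => (hasDerivAt_cas θ).hasDerivWithinAt) (fun θ _ => by
      rw [Real.norm_eq_abs]
      refine (abs_add_le _ _).trans ?_
      rw [abs_neg]
      linarith [Real.abs_sin_le_one θ, Real.abs_cos_le_one θ]) convex_univ trivial trivial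
  exact h

lemma cas_add_int_mul (θ : ℝ) (n : ℤ) : cas (θ + n * (2 * Real.pi)) = cas θ := by
  rw [cas, cas, Real.cos_add_int_mul_two_pi, Real.sin_add_int_mul_two_pi]

/-- The orbit of the frequency `(p, q)` under the symmetric group of the triangle. -/
def lameFreq (p q : ℤ) : Fin 6 → Fin 2 → ℤ :=
  ![![p, q], ![-p, p + q], ![p + q, -q], ![-(p + q), p], ![q, -(p + q)], ![-q, -p]]

/-- The signs of the elements of the symmetric group, in the order of `lameFreq`. -/
def lameSign : Fin 6 → ℝ := ![1, -1, -1, 1, 1, -1]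

/-- Lamé's eigenfunctions of the equilateral triangle, in the coordinates in which the triangle is
the alcove `triAlcove`. -/
noncomputable def lameCoord (k : ℕ × ℕ) (y : Fin 2 → ℝ) : ℝ :=
  ∑ i, lameSign i * cas (2 * Real.pi * ∑ j, lameFreq k.1 k.2 i j * y j)

lemma linearIndependent_planeWave :
    LinearIndependent ℂ (fun k : Fin 2 → ℤ => planeWave k) := by
  let χ : (Fin 2 → ℤ) → (Multiplicative (Fin 2 → ℝ) →* ℂ) := fun k =>
    { toFun := fun x => planeWave k (Multiplicative.toAdd x)
      map_one' := by simp [planeWave]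
      map_mul' := fun x y => by
        simp only [planeWave, toAdd_mul, ← Complex.exp_add, Pi.add_apply, Complex.ofReal_add,
          Finset.sum_add_distrib, mul_add] }
  have hχ : Function.Injective χ := by
    intro k l h
    funext i
    by_contra hne
    have hkl : ((k i - l i : ℤ) : ℝ) ≠ 0 := by
      exact_mod_cast sub_ne_zero.2 hne
    have h1 : planeWave k (Pi.single i (1 / (2 * ((k i - l i : ℤ) : ℝ)))) =
        planeWave l (Pi.single i (1 / (2 * ((k i - l i : ℤ) : ℝ)))) :=
      DFunLike.congr_fun h (Multiplicative.ofAdd _)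
    set z : ℝ := 1 / (2 * ((k i - l i : ℤ) : ℝ)) with hz
    have hs : ∀ m : Fin 2 → ℤ, ∑ j, (m j : ℂ) * ((Pi.single i z : Fin 2 → ℝ) j : ℂ) = m i * z := by
      intro m
      rw [Finset.sum_eq_single i]
      · simp
      · intro j _ hj; simp [hj]
      · simp
    simp only [planeWave, hs] at h1
    rw [← div_eq_one_iff_eq (Complex.exp_ne_zero _), ← Complex.exp_sub] at h1
    have h2 : (2 * Real.pi * Complex.I * (k i * z) - 2 * Real.pi * Complex.I * (l i * z) : ℂ) =
        Real.pi * Complex.I := by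
      have hkl' : ((k i : ℂ) - l i) ≠ 0 := by exact_mod_cast hkl
      rw [hz]
      push_cast
      field_simp
    rw [h2, Complex.exp_pi_mul_I] at h1
    norm_num at h1
  exact (linearIndependent_monoidHom (Multiplicative (Fin 2 → ℝ)) ℂ).comp χ hχ

/-- The Fourier coefficient as an algebraic functional on all functions. -/
lemma exists_functional_planeWave (m : Fin 2 → ℤ) :
    ∃ Λ : ((Fin 2 → ℝ) → ℂ) →ₗ[ℂ] ℂ, ∀ k, Λ (planeWave k) = if k = m then 1 else 0 := by
  obtain ⟨Λ, hΛ⟩ := LinearMap.exists_extend ((Finsupp.lapply m).comp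
    (linearIndependent_planeWave.repr : _ →ₗ[ℂ] _))
  refine ⟨Λ, fun k => ?_⟩
  have hk : planeWave k ∈ Submodule.span ℂ (Set.range fun k : Fin 2 → ℤ => planeWave k) :=
    Submodule.subset_span ⟨k, rfl⟩
  have h1 := LinearMap.congr_fun hΛ ⟨planeWave k, hk⟩
  rw [LinearMap.comp_apply] at h1
  have h2 : linearIndependent_planeWave.repr ⟨planeWave k, hk⟩ = Finsupp.single k 1 :=
    linearIndependent_planeWave.repr_eq_single k _ rfl
  refine h1.trans ?_
  rw [LinearMap.comp_apply]
  change Finsupp.lapply m (linearIndependent_planeWave.repr ⟨planeWave k, hk⟩) = _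
  rw [h2, Finsupp.lapply_apply, Finsupp.single_apply]

lemma two_mul_cas (m : Fin 2 → ℤ) (y : Fin 2 → ℝ) :
    2 * (cas (2 * Real.pi * ∑ j, m j * y j) : ℂ) =
      (1 - Complex.I) * planeWave m y + (1 + Complex.I) * planeWave (-m) y := by
  have h1 : planeWave m y =
      Complex.exp (((2 * Real.pi * ∑ j, m j * y j : ℝ) : ℂ) * Complex.I) := by
    rw [planeWave]; congr 1; push_cast; ring
  have h2 : planeWave (-m) y =
      Complex.exp (-(((2 * Real.pi * ∑ j, m j * y j : ℝ) : ℂ) * Complex.I)) := by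
    rw [planeWave]; congr 1
    simp only [Pi.neg_apply, Int.cast_neg, neg_mul, Finset.sum_neg_distrib]
    push_cast; ring
  rw [h1, h2, ← neg_mul, Complex.exp_mul_I, Complex.exp_mul_I, Complex.cos_neg, Complex.sin_neg,
    cas]
  generalize (2 * Real.pi * ∑ j, m j * y j : ℝ) = θ
  push_cast
  linear_combination (2 * Complex.sin θ) * Complex.I_mul_I

/-- A linear relation between the functions `lameCoord k` is trivial: in the orbits of frequencies
in the open Weyl chamber, the frequency `m` occurs only for `k = m` and, with the conjugate
coefficient, for `k` the transpose of `m`. -/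
lemma eq_zero_of_sum_lameCoord {s : Finset (ℕ × ℕ)} (hs : ∀ k ∈ s, 1 ≤ k.1 ∧ 1 ≤ k.2)
    {c : ℕ × ℕ → ℝ} (h : ∀ y, ∑ k ∈ s, c k * lameCoord k y = 0) : ∀ k ∈ s, c k = 0 := by
  rintro ⟨p, q⟩ hm
  obtain ⟨hp, hq⟩ := hs _ hm
  simp only at hp hq
  obtain ⟨Λ, hΛ⟩ := exists_functional_planeWave ![(p : ℤ), (q : ℤ)]
  have key : ∀ k ∈ s, Λ (fun y => 2 * (lameCoord k y : ℂ)) =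
      (1 - Complex.I) * (if k = (p, q) then 1 else 0) -
        (1 + Complex.I) * (if k = (q, p) then 1 else 0) := by
    rintro ⟨p', q'⟩ hk
    obtain ⟨hp', hq'⟩ := hs _ hk
    simp only at hp' hq'
    have e : (fun y => 2 * (lameCoord (p', q') y : ℂ)) = ∑ i, (lameSign i : ℂ) •
        ((1 - Complex.I) • planeWave (lameFreq p' q' i) +
          (1 + Complex.I) • planeWave (-lameFreq p' q' i)) := by
      funext y
      rw [lameCoord, Finset.sum_apply]
      push_cast
      rw [Finset.mul_sum]
      refine Finset.sum_congr rfl fun i _ => ?_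
      have := two_mul_cas (lameFreq p' q' i) y
      simp only [Pi.smul_apply, Pi.add_apply, smul_eq_mul]
      rw [← this]; ring
    rw [e]
    simp only [map_smul, map_add, hΛ, Fin.sum_univ_six, lameSign, lameFreq, smul_eq_mul,
      fin_two_eq_iff, Pi.neg_apply, Matrix.cons_val, Prod.mk.injEq, Nat.cast_inj, neg_neg]
    have n1 : ¬ (-(p' : ℤ) = p ∧ (p' : ℤ) + q' = q) := by omega
    have n2 : ¬ ((p' : ℤ) + q' = p ∧ -(q' : ℤ) = q) := by omega
    have n3 : ¬ (-((p' : ℤ) + q') = p ∧ (p' : ℤ) = q) := by omega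
    have n4 : ¬ ((q' : ℤ) = p ∧ -((p' : ℤ) + q') = q) := by omega
    have n5 : ¬ (-(q' : ℤ) = p ∧ -(p' : ℤ) = q) := by omega
    have n6 : ¬ (-(p' : ℤ) = p ∧ -(q' : ℤ) = q) := by omega
    have n7 : ¬ ((p' : ℤ) = p ∧ -((p' : ℤ) + q') = q) := by omega
    have n8 : ¬ (-((p' : ℤ) + q') = p ∧ (q' : ℤ) = q) := by omega
    have n9 : ¬ ((p' : ℤ) + q' = p ∧ -(p' : ℤ) = q) := by omega
    have n10 : ¬ (-(q' : ℤ) = p ∧ (p' : ℤ) + q' = q) := by omega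
    have n11 : ((q' : ℤ) = p ∧ (p' : ℤ) = q) ↔ (p' = q ∧ q' = p) := by omega
    simp only [Nat.cast_inj] at n1 n2 n3 n4 n5 n6 n7 n8 n9 n10 n11
    simp only [n1, n2, n3, n4, n5, n6, n7, n8, n9, n10, n11, if_false]
    push_cast
    ring
  have h0 : ∑ k ∈ s, (c k : ℂ) • (fun y => 2 * (lameCoord k y : ℂ)) = 0 := by
    funext y
    have h1 : ((∑ k ∈ s, c k * lameCoord k y : ℝ) : ℂ) = 0 := by rw [h y, Complex.ofReal_zero]
    push_cast at h1
    rw [Finset.sum_apply]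
    simp only [Pi.smul_apply, smul_eq_mul, Pi.zero_apply]
    rw [← mul_zero (2 : ℂ), ← h1, Finset.mul_sum]
    exact Finset.sum_congr rfl fun k _ => by ring
  have h2 := congrArg Λ h0
  rw [map_sum, map_zero] at h2
  have h3 : ∑ k ∈ s, (c k : ℂ) * ((1 - Complex.I) * (if k = (p, q) then 1 else 0) -
        (1 + Complex.I) * (if k = (q, p) then 1 else 0)) = 0 := by
    refine Eq.trans (Finset.sum_congr rfl fun k hk => ?_) h2
    rw [map_smul, key k hk, smul_eq_mul]
  have h4 : (c (p, q) : ℂ) * (1 - Complex.I) -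
      ((if (q, p) ∈ s then c (q, p) else 0 : ℝ) : ℂ) * (1 + Complex.I) = 0 := by
    rw [← h3]
    simp only [mul_sub, Finset.sum_sub_distrib, mul_ite, mul_one, mul_zero, Finset.sum_ite_eq',
      hm, if_true]
    split_ifs <;> simp
  have hre := congrArg Complex.re h4
  have him := congrArg Complex.im h4
  simp at hre him
  linarith

end Lame

section Equilateral

open MeasureTheory Filter Topology

/-- The linear form `2π m·y` of the coordinates `y` of a point. -/
noncomputable def waveForm (L : (Fin 2 → ℝ) ≃L[ℝ] Plane) (m : Fin 2 → ℤ) : Plane →L[ℝ] ℝ :=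
  ∑ j, (2 * Real.pi * m j) •
    ((ContinuousLinearMap.proj j : (Fin 2 → ℝ) →L[ℝ] ℝ).comp (L.symm : Plane →L[ℝ] (Fin 2 → ℝ)))

lemma waveForm_apply (L : (Fin 2 → ℝ) ≃L[ℝ] Plane) (m : Fin 2 → ℤ) (x : Plane) :
    waveForm L m x = 2 * Real.pi * ∑ j, m j * L.symm x j := by
  simp [waveForm, Fin.sum_univ_two]; ring

/-- Lamé's eigenfunctions on the plane. -/
noncomputable def lameFun (L : (Fin 2 → ℝ) ≃L[ℝ] Plane) (P : Plane) (k : ℕ × ℕ) (x : Plane) : ℝ :=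
  ∑ i, lameSign i * cas (waveForm L (lameFreq k.1 k.2 i) (x - P))

lemma lameFun_eq (L : (Fin 2 → ℝ) ≃L[ℝ] Plane) (P : Plane) (k : ℕ × ℕ) (x : Plane) :
    lameFun L P k x = lameCoord k (L.symm (x - P)) := by
  simp only [lameFun, lameCoord, waveForm_apply]

lemma contDiff_wave (M : Plane →L[ℝ] ℝ) (P : Plane) {n : WithTop ℕ∞} :
    ContDiff ℝ n fun x => cas (M (x - P)) :=
  contDiff_cas.comp (M.contDiff.comp (contDiff_id.sub contDiff_const))

lemma contDiff_lameFun (L : (Fin 2 → ℝ) ≃L[ℝ] Plane) (P : Plane) (k : ℕ × ℕ) {n : WithTop ℕ∞} :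
    ContDiff ℝ n (lameFun L P k) :=
  ContDiff.sum fun _ _ => contDiff_const.mul (contDiff_wave _ P)

lemma gradient_wave (M : Plane →L[ℝ] ℝ) (P x : Plane) :
    gradient (fun x => cas (M (x - P))) x =
      (-Real.sin (M (x - P)) + Real.cos (M (x - P))) • (InnerProductSpace.toDual ℝ Plane).symm M := by
  have h1 : HasFDerivAt (fun x => M (x - P)) M x :=
    M.hasFDerivAt.comp x ((hasFDerivAt_id x).sub_const P)
  have h2 := (hasDerivAt_cas (M (x - P))).comp_hasFDerivAt x h1
  have h3 : fderiv ℝ (fun x => cas (M (x - P))) x = _ := h2.fderiv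
  rw [gradient, h3, map_smul]

/-- A plane wave is a weak eigenfunction of the Laplacian. -/
lemma integral_inner_gradient_wave (M : Plane →L[ℝ] ℝ) (P : Plane) {Ω : Set Plane} {φ : Plane → ℝ}
    (hφ : IsTestFunction Ω φ) :
    ∫ x, inner ℝ (gradient (fun x => cas (M (x - P))) x) (gradient φ x) =
      ‖M‖ ^ 2 * ∫ x, cas (M (x - P)) * φ x := by
  set ξ := (InnerProductSpace.toDual ℝ Plane).symm M with hξ
  set g : Plane → ℝ := fun x => -Real.sin (M (x - P)) + Real.cos (M (x - P)) with hg
  have hMξ : M ξ = ‖M‖ ^ 2 := by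
    rw [← InnerProductSpace.toDual_symm_apply (𝕜 := ℝ), real_inner_self_eq_norm_sq,
      LinearIsometryEquiv.norm_map]
  have hgd : ∀ x, fderiv ℝ g x ξ = -(‖M‖ ^ 2 * cas (M (x - P))) := by
    intro x
    have h1 : HasFDerivAt (fun x => M (x - P)) M x :=
      M.hasFDerivAt.comp x ((hasFDerivAt_id x).sub_const P)
    have h2 : HasFDerivAt g _ x := (h1.sin.neg).add h1.cos
    rw [h2.fderiv]
    simp [hMξ, cas]
    ring
  have hgs : ContDiff ℝ 1 g := by
    simp only [hg]
    fun_prop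
  have hgdc : Continuous fun x => fderiv ℝ g x ξ := by
    have := hgs.continuous_fderiv (by simp)
    fun_prop
  have h1 : ∀ x, inner ℝ (gradient (fun x => cas (M (x - P))) x) (gradient φ x) =
      g x * fderiv ℝ φ x ξ := by
    intro x
    rw [gradient_wave, real_inner_smul_left, fderiv_eq_inner_gradient, real_inner_comm]
  simp only [h1]
  rw [integral_mul_fderiv_eq_neg_fderiv_mul_of_integrable
    (hφ.integrable_mul_of_continuous hgdc)
    ((hgs.continuous.mul (hφ.continuous_fderiv_apply ξ)).integrable_of_hasCompactSupport
      (hφ.hasCompactSupport_fderiv_apply ξ).mul_left)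
    (hφ.integrable_mul_of_continuous hgs.continuous)
    (fun x _ => hgs.differentiable (by simp) x)
    (fun x _ => hφ.contDiff.differentiable (by simp) x), ← integral_neg, ← integral_const_mul]
  congr 1
  funext x
  rw [hgd]; ring

lemma gradient_lameFun (L : (Fin 2 → ℝ) ≃L[ℝ] Plane) (P : Plane) (k : ℕ × ℕ) (x : Plane) :
    gradient (lameFun L P k) x = ∑ i, lameSign i •
      gradient (fun x => cas (waveForm L (lameFreq k.1 k.2 i) (x - P))) x := by
  have h : fderiv ℝ (lameFun L P k) x = ∑ i, lameSign i •
      fderiv ℝ (fun x => cas (waveForm L (lameFreq k.1 k.2 i) (x - P))) x := by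
    refine HasFDerivAt.fderiv (HasFDerivAt.fun_sum fun i _ => ?_)
    exact ((contDiff_wave (n := 1) _ P).differentiable (by simp) x).hasFDerivAt.const_mul _
  rw [gradient, h, map_sum]
  exact Finset.sum_congr rfl fun i _ => map_smul _ _ _

lemma abs_cas_sub_cas_le_of_eq {x y z : ℝ} {n : ℕ} (h : x - y = 2 * Real.pi * (n * z)) :
    |cas x - cas y| ≤ 4 * Real.pi * n * |z| := by
  refine (abs_cas_sub_cas_le x y).trans (le_of_eq ?_)
  rw [h, ← mul_assoc, abs_mul, abs_of_nonneg (by positivity : 0 ≤ 2 * Real.pi * n)]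
  ring

lemma abs_cas_sub_cas_le_of_eq_one_sub {x y z : ℝ} {n : ℕ}
    (h : x - y = 2 * Real.pi * (n * (1 - z))) : |cas x - cas y| ≤ 4 * Real.pi * n * |z| := by
  rw [← cas_add_int_mul y n, abs_sub_comm]
  refine abs_cas_sub_cas_le_of_eq ?_
  push_cast
  linear_combination -h

lemma lameCoord_eq (k : ℕ × ℕ) (y : Fin 2 → ℝ) : lameCoord k y =
    cas (2 * Real.pi * (k.1 * y 0 + k.2 * y 1)) - cas (2 * Real.pi * (-k.1 * y 0 + (k.1 + k.2) * y 1))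
    - cas (2 * Real.pi * ((k.1 + k.2) * y 0 + -k.2 * y 1))
    + cas (2 * Real.pi * (-(k.1 + k.2) * y 0 + k.1 * y 1))
    + cas (2 * Real.pi * (k.2 * y 0 + -(k.1 + k.2) * y 1))
    - cas (2 * Real.pi * (-k.2 * y 0 + -k.1 * y 1)) := by
  simp only [lameCoord, lameSign, lameFreq, Fin.sum_univ_six, Fin.sum_univ_two, Matrix.cons_val]
  push_cast
  ring

/-- Lamé's eigenfunctions vanish linearly on the three mirrors that bound the triangle. -/
lemma abs_lameCoord_le (k : ℕ × ℕ) (y : Fin 2 → ℝ) :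
    |lameCoord k y| ≤ 8 * Real.pi * (k.1 + k.2 : ℕ) * |2 * y 0 - y 1| ∧
    |lameCoord k y| ≤ 8 * Real.pi * (k.1 + k.2 : ℕ) * |2 * y 1 - y 0| ∧
    |lameCoord k y| ≤ 8 * Real.pi * (k.1 + k.2 : ℕ) * |1 - (y 0 + y 1)| := by
  rw [lameCoord_eq]
  set x1 := 2 * Real.pi * (k.1 * y 0 + k.2 * y 1) with h1
  set x2 := 2 * Real.pi * (-k.1 * y 0 + (k.1 + k.2) * y 1) with h2
  set x3 := 2 * Real.pi * ((k.1 + k.2) * y 0 + -k.2 * y 1) with h3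
  set x4 := 2 * Real.pi * (-(k.1 + k.2) * y 0 + k.1 * y 1) with h4
  set x5 := 2 * Real.pi * (k.2 * y 0 + -(k.1 + k.2) * y 1) with h5
  set x6 := 2 * Real.pi * (-k.2 * y 0 + -k.1 * y 1) with h6
  have tri : ∀ u v w A B C : ℝ, |u| ≤ A → |v| ≤ B → |w| ≤ C → |u - v + w| ≤ A + B + C := by
    intro u v w A B C hu hv hw
    rw [abs_le] at *
    constructor <;> linarith
  refine ⟨?_, ?_, ?_⟩
  · have e1 := abs_cas_sub_cas_le_of_eq (x := x1) (y := x2) (z := 2 * y 0 - y 1) (n := k.1)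
      (by rw [h1, h2]; ring)
    have e2 := abs_cas_sub_cas_le_of_eq (x := x3) (y := x4) (z := 2 * y 0 - y 1) (n := k.1 + k.2)
      (by rw [h3, h4]; push_cast; ring)
    have e3 := abs_cas_sub_cas_le_of_eq (x := x5) (y := x6) (z := 2 * y 0 - y 1) (n := k.2)
      (by rw [h5, h6]; ring)
    have := tri _ _ _ _ _ _ e1 e2 e3
    push_cast at *
    refine (le_of_eq (congrArg abs ?_)).trans (this.trans (le_of_eq ?_)) <;> ring
  · have e1 := abs_cas_sub_cas_le_of_eq (x := x1) (y := x3) (z := 2 * y 1 - y 0) (n := k.2)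
      (by rw [h1, h3]; ring)
    have e2 := abs_cas_sub_cas_le_of_eq (x := x2) (y := x5) (z := 2 * y 1 - y 0) (n := k.1 + k.2)
      (by rw [h2, h5]; push_cast; ring)
    have e3 := abs_cas_sub_cas_le_of_eq (x := x4) (y := x6) (z := 2 * y 1 - y 0) (n := k.1)
      (by rw [h4, h6]; ring)
    have := tri _ _ _ _ _ _ e1 e2 e3
    push_cast at *
    refine (le_of_eq (congrArg abs ?_)).trans (this.trans (le_of_eq ?_)) <;> ring
  · have e1 := abs_cas_sub_cas_le_of_eq_one_sub (x := x1) (y := x6) (z := 1 - (y 0 + y 1))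
      (n := k.1 + k.2) (by rw [h1, h6]; push_cast; ring)
    have e2 := abs_cas_sub_cas_le_of_eq_one_sub (x := x2) (y := x4) (z := 1 - (y 0 + y 1))
      (n := k.2) (by rw [h2, h4]; ring)
    have e3 := abs_cas_sub_cas_le_of_eq_one_sub (x := x3) (y := x5) (z := 1 - (y 0 + y 1))
      (n := k.1) (by rw [h3, h5]; ring)
    rw [← abs_neg] at e3
    have := tri _ _ _ _ _ _ e1 e2 e3
    push_cast at *
    refine (le_of_eq (congrArg abs ?_)).trans (this.trans (le_of_eq ?_)) <;> ring

lemma isBounded_openTriangle (P a b : Plane) : Bornology.IsBounded (openTriangle P a b) := by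
  refine (Metric.isBounded_closedBall (x := P) (r := ‖a‖ + ‖b‖)).subset ?_
  rintro x ⟨s, r, hs, hr, hsr, rfl⟩
  rw [mem_closedBall_iff_norm, add_sub_cancel_left]
  refine (norm_add_le _ _).trans ?_
  rw [norm_smul, norm_smul, Real.norm_of_nonneg hs.le, Real.norm_of_nonneg hr.le]
  nlinarith [norm_nonneg a, norm_nonneg b]

lemma memLp_of_isBounded {E : Type*} [NormedAddCommGroup E] {Ω : Set Plane}
    (hb : Bornology.IsBounded Ω) (hm : MeasurableSet Ω) {f : Plane → E} (hf : Continuous f)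
    [SecondCountableTopologyEither Plane E] : MemLp f 2 (volume.restrict Ω) := by
  have : IsFiniteMeasure (volume.restrict Ω) := ⟨by simpa using hb.measure_lt_top⟩
  obtain ⟨M, hM⟩ := hb.isCompact_closure.exists_bound_of_continuousOn hf.continuousOn
  exact MemLp.of_bound hf.aestronglyMeasurable M ((ae_restrict_iff' hm).2
    (Eventually.of_forall fun x hx => hM x (subset_closure hx)))

end Equilateral

section EquilateralSpectrum

open MeasureTheory Filter Topology

variable {P a b : Plane} {D : ℝ} {L : (Fin 2 → ℝ) ≃L[ℝ] Plane}

lemma norm_sq_waveForm (hD : 0 < D) (ha : ‖a‖ = D) (hb : ‖b‖ = D) (hab : ‖a - b‖ = D)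
    (hL : ∀ x, L x = x 0 • ((2 : ℝ) • a + (-1 : ℝ) • b) + x 1 • ((-1 : ℝ) • a + (2 : ℝ) • b))
    (m : Fin 2 → ℤ) : ‖waveForm L m‖ ^ 2 =
      16 * Real.pi ^ 2 / (9 * D ^ 2) * (m 0 ^ 2 + m 0 * m 1 + m 1 ^ 2) := by
  set ξ := (InnerProductSpace.toDual ℝ Plane).symm (waveForm L m) with hξ
  have hM : ∀ y, inner ℝ ξ (L y) = 2 * Real.pi * (m 0 * y 0 + m 1 * y 1) := by
    intro y
    rw [hξ, InnerProductSpace.toDual_symm_apply, waveForm_apply, L.symm_apply_apply,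
      Fin.sum_univ_two]
  have hLa : L ![2 / 3, 1 / 3] = a := by
    rw [hL]; simp only [Matrix.cons_val_zero, Matrix.cons_val_one]; module
  have hLb : L ![1 / 3, 2 / 3] = b := by
    rw [hL]; simp only [Matrix.cons_val_zero, Matrix.cons_val_one]; module
  have h1 := hM ![2 / 3, 1 / 3]
  have h2 := hM ![1 / 3, 2 / 3]
  rw [hLa] at h1
  rw [hLb] at h2
  simp only [Matrix.cons_val_zero, Matrix.cons_val_one] at h1 h2
  have h3 := norm_sq_of_isosceles (w := ξ) hD ha hb (s := 1) (by rw [hab, one_mul])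
  rw [inner_sub_right, h1, h2] at h3
  have h4 : ‖waveForm L m‖ = ‖ξ‖ := by rw [hξ, LinearIsometryEquiv.norm_map]
  rw [h4]
  field_simp
  linear_combination 12 * h3

lemma mem_openTriangle_iff_coord (hind : LinearIndependent ℝ ![a, b])
    (hL : ∀ x, L x = x 0 • ((2 : ℝ) • a + (-1 : ℝ) • b) + x 1 • ((-1 : ℝ) • a + (2 : ℝ) • b))
    (x : Plane) : x ∈ openTriangle P a b ↔ 0 < 2 * L.symm (x - P) 0 - L.symm (x - P) 1 ∧
      0 < 2 * L.symm (x - P) 1 - L.symm (x - P) 0 ∧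
      L.symm (x - P) 0 + L.symm (x - P) 1 < 1 := by
  have hx : x = P + ((2 * L.symm (x - P) 0 - L.symm (x - P) 1) • a +
      (2 * L.symm (x - P) 1 - L.symm (x - P) 0) • b) := by
    have h := hL (L.symm (x - P))
    rw [L.apply_symm_apply] at h
    generalize L.symm (x - P) = y at h ⊢
    rw [sub_eq_iff_eq_add'] at h
    rw [h]
    module
  nth_rewrite 1 [hx]
  rw [mem_openTriangle_iff hind]
  refine and_congr_right fun _ => and_congr_right fun _ => ?_
  constructor <;> intro h <;> linarith

lemma setOf_coord_pos (hind : LinearIndependent ℝ ![a, b])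
    (hL : ∀ x, L x = x 0 • ((2 : ℝ) • a + (-1 : ℝ) • b) + x 1 • ((-1 : ℝ) • a + (2 : ℝ) • b)) :
    ∃ (c : Fin 3 → ℝ) (ℓ : Fin 3 → Plane →L[ℝ] ℝ),
      openTriangle P a b = {x | ∀ i, 0 < c i + ℓ i x} ∧ ∀ x,
        c 0 + ℓ 0 x = 2 * L.symm (x - P) 0 - L.symm (x - P) 1 ∧
        c 1 + ℓ 1 x = 2 * L.symm (x - P) 1 - L.symm (x - P) 0 ∧
        c 2 + ℓ 2 x = 1 - (L.symm (x - P) 0 + L.symm (x - P) 1) := by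
  let y : Fin 2 → Plane →L[ℝ] ℝ := fun j =>
    (ContinuousLinearMap.proj j : (Fin 2 → ℝ) →L[ℝ] ℝ).comp (L.symm : Plane →L[ℝ] (Fin 2 → ℝ))
  have hy : ∀ x j, y j x = L.symm x j := fun x j => rfl
  have hc : ∀ x,
      (-(2 * y 0 P - y 1 P)) + ((2 : ℝ) • y 0 - y 1) x = 2 * L.symm (x - P) 0 - L.symm (x - P) 1 ∧
      (-(2 * y 1 P - y 0 P)) + ((2 : ℝ) • y 1 - y 0) x = 2 * L.symm (x - P) 1 - L.symm (x - P) 0 ∧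
      (1 + (y 0 P + y 1 P)) + (-(y 0 + y 1)) x = 1 - (L.symm (x - P) 0 + L.symm (x - P) 1) := by
    intro x
    simp only [map_sub, ← hy, sub_apply, add_apply, neg_apply, smul_apply, smul_eq_mul]
    refine ⟨?_, ?_, ?_⟩ <;> ring
  refine ⟨![-(2 * y 0 P - y 1 P), -(2 * y 1 P - y 0 P), 1 + (y 0 P + y 1 P)],
    ![(2 : ℝ) • y 0 - y 1, (2 : ℝ) • y 1 - y 0, -(y 0 + y 1)], ?_, hc⟩
  ext x
  rw [mem_openTriangle_iff_coord hind hL]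
  obtain ⟨h0, h1, h2⟩ := hc x
  rw [Set.mem_ofPred_eq, Fin.forall_fin_succ, Fin.forall_fin_two]
  change _ ↔ 0 < _ + _ ∧ 0 < (-(2 * y 1 P - y 0 P)) + ((2 : ℝ) • y 1 - y 0) x ∧
    0 < (1 + (y 0 P + y 1 P)) + (-(y 0 + y 1)) x
  rw [h1, h2]
  change _ ↔ 0 < (-(2 * y 0 P - y 1 P)) + ((2 : ℝ) • y 0 - y 1) x ∧ _
  rw [h0]
  refine and_congr_right fun _ => and_congr_right fun _ => ?_
  exact sub_pos.symm

lemma isOpen_openTriangle (hind : LinearIndependent ℝ ![a, b]) : IsOpen (openTriangle P a b) := by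
  have hind' := linearIndependent_combination hind (p := 2) (q := -1) (r := -1) (s := 2)
    (by norm_num)
  obtain ⟨L, hL⟩ := exists_equiv_of_linearIndependent hind'
  obtain ⟨c, ℓ, h, -⟩ := setOf_coord_pos (P := P) hind hL
  rw [h, Set.ofPred_forall]
  exact isOpen_iInter_of_finite fun i => isOpen_lt continuous_const
    (continuous_const.add (ℓ i).continuous)

lemma openTriangle_nonempty (P a b : Plane) : (openTriangle P a b).Nonempty :=
  ⟨_, 1 / 3, 1 / 3, by norm_num, by norm_num, by norm_num, rfl⟩

lemma lameFreq_norm (p q : ℤ) (i : Fin 6) : (lameFreq p q i 0 : ℝ) ^ 2 +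
    lameFreq p q i 0 * lameFreq p q i 1 + (lameFreq p q i 1 : ℝ) ^ 2 = p ^ 2 + p * q + q ^ 2 := by
  fin_cases i <;> simp [lameFreq] <;> ring

lemma continuous_gradient_of_contDiff {f : Plane → ℝ} (hf : ContDiff ℝ 1 f) :
    Continuous (gradient f) :=
  (InnerProductSpace.toDual ℝ Plane).symm.continuous.comp (hf.continuous_fderiv (by simp))

lemma integral_inner_gradient_lameFun (hD : 0 < D) (ha : ‖a‖ = D) (hb : ‖b‖ = D)
    (hab : ‖a - b‖ = D)
    (hL : ∀ x, L x = x 0 • ((2 : ℝ) • a + (-1 : ℝ) • b) + x 1 • ((-1 : ℝ) • a + (2 : ℝ) • b))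
    (k : ℕ × ℕ) {Ω : Set Plane} {φ : Plane → ℝ} (hφ : IsTestFunction Ω φ) :
    ∫ x, inner ℝ (gradient (lameFun L P k) x) (gradient φ x) =
      16 * Real.pi ^ 2 / (9 * D ^ 2) * hexNorm k.1 k.2 * ∫ x, lameFun L P k x * φ x := by
  have h1 : ∀ x, inner ℝ (gradient (lameFun L P k) x) (gradient φ x) = ∑ i, lameSign i *
      inner ℝ (gradient (fun x => cas (waveForm L (lameFreq k.1 k.2 i) (x - P))) x)
        (gradient φ x) := by
    intro x
    rw [gradient_lameFun, sum_inner]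
    exact Finset.sum_congr rfl fun i _ => real_inner_smul_left _ _ _
  have h2 : ∀ x, lameFun L P k x * φ x = ∑ i, lameSign i *
      (cas (waveForm L (lameFreq k.1 k.2 i) (x - P)) * φ x) := by
    intro x
    rw [lameFun, Finset.sum_mul]
    exact Finset.sum_congr rfl fun i _ => mul_assoc _ _ _
  have hi1 : ∀ i, Integrable fun x =>
      inner ℝ (gradient (fun x => cas (waveForm L (lameFreq k.1 k.2 i) (x - P))) x)
        (gradient φ x) := by
    intro i
    have hc := (continuous_gradient_of_contDiff
      (contDiff_wave (waveForm L (lameFreq k.1 k.2 i)) P)).inner (𝕜 := ℝ) hφ.continuous_gradient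
    refine hc.integrable_of_hasCompactSupport ?_
    have hcs : HasCompactSupport (gradient φ) :=
      (hφ.hasCompactSupport.fderiv (𝕜 := ℝ)).comp_left (map_zero _)
    refine hcs.mono fun x hx h0 => hx ?_
    simp only
    rw [h0, inner_zero_right]
  have hi2 : ∀ i, Integrable fun x => cas (waveForm L (lameFreq k.1 k.2 i) (x - P)) * φ x :=
    fun i => hφ.integrable_mul_of_continuous (contDiff_wave (n := 0) _ P).continuous
  simp only [h1, h2]
  rw [integral_finsetSum _ fun i _ => (hi1 i).const_mul _,
    integral_finsetSum _ fun i _ => (hi2 i).const_mul _, Finset.mul_sum]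
  refine Finset.sum_congr rfl fun i _ => ?_
  rw [integral_const_mul, integral_const_mul, integral_inner_gradient_wave _ _ hφ,
    norm_sq_waveForm hD ha hb hab hL, lameFreq_norm]
  simp only [hexNorm]
  push_cast
  ring

/-- Lamé's functions solve the Dirichlet problem on the equilateral triangle. -/
lemma isDirichletEigenfunction_lameFun (hD : 0 < D) (ha : ‖a‖ = D) (hb : ‖b‖ = D)
    (hab : ‖a - b‖ = D) (hind : LinearIndependent ℝ ![a, b])
    (hL : ∀ x, L x = x 0 • ((2 : ℝ) • a + (-1 : ℝ) • b) + x 1 • ((-1 : ℝ) • a + (2 : ℝ) • b))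
    {k : ℕ × ℕ} (hk : 1 ≤ k.1) (hm : MemLp (lameFun L P k) 2 (volume.restrict (openTriangle P a b)))
    (h0 : hm.toLp _ ≠ 0) :
    IsDirichletEigenfunction (openTriangle P a b)
      (16 * Real.pi ^ 2 / (9 * D ^ 2) * hexNorm k.1 k.2) (hm.toLp _) := by
  have hbd := isBounded_openTriangle P a b
  have hmeas := (isOpen_openTriangle (P := P) hind).measurableSet
  have hg : MemLp (gradient (lameFun L P k)) 2 (volume.restrict (openTriangle P a b)) :=
    memLp_of_isBounded hbd hmeas (continuous_gradient_of_contDiff (contDiff_lameFun L P k))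
  obtain ⟨c, ℓ, hΩ, hc⟩ := setOf_coord_pos (P := P) hind hL
  refine ⟨h0, hg.toLp _, ?_, fun φ hφ => ?_⟩
  · have hpos : (0 : ℝ) < (k.1 + k.2 : ℕ) := by exact_mod_cast (by omega : 0 < k.1 + k.2)
    refine isH10WithGradient_of_abs_le hΩ hbd (contDiff_lameFun L P k)
      (C := 8 * Real.pi * (k.1 + k.2 : ℕ)) (by positivity) (fun x hx i => ?_) hm hg
    rw [hΩ] at hx
    rw [lameFun_eq, ← abs_of_pos (hx i)]
    obtain ⟨h1, h2, h3⟩ := abs_lameCoord_le k (L.symm (x - P))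
    obtain ⟨e1, e2, e3⟩ := hc x
    rw [← e1] at h1
    rw [← e2] at h2
    rw [← e3] at h3
    match i with
    | 0 => exact h1
    | 1 => exact h2
    | 2 => exact h3
  · have e1 : ∫ x in openTriangle P a b, inner ℝ (hg.toLp (gradient (lameFun L P k)) x)
        (gradient φ x) = ∫ x, inner ℝ (gradient (lameFun L P k) x) (gradient φ x) := by
      have e : ∫ x in openTriangle P a b, inner ℝ (hg.toLp (gradient (lameFun L P k)) x)
          (gradient φ x) =
          ∫ x in openTriangle P a b, inner ℝ (gradient (lameFun L P k) x) (gradient φ x) := by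
        refine integral_congr_ae ?_
        filter_upwards [hg.coeFn_toLp] with x hx
        rw [hx]
      rw [e]
      refine setIntegral_eq_integral_of_forall_compl_eq_zero fun x hx => ?_
      have hz : fderiv ℝ φ x = 0 := image_eq_zero_of_notMem_tsupport fun h =>
        hx (hφ.tsupport_subset (tsupport_fderiv_subset ℝ h))
      have hz' : gradient φ x = 0 := by rw [gradient, hz, map_zero]
      rw [hz', inner_zero_right]
    have e2 : ∫ x in openTriangle P a b, hm.toLp (lameFun L P k) x * φ x =
        ∫ x, lameFun L P k x * φ x := by
      rw [← setIntegral_eq_integral_of_tsupport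
        ((tsupport_mul_subset_right).trans hφ.tsupport_subset)]
      refine integral_congr_ae ?_
      filter_upwards [hm.coeFn_toLp] with x hx
      rw [hx]
    rw [e1, e2]
    exact integral_inner_gradient_lameFun hD ha hb hab hL k hφ

/-- Lamé's functions are linearly independent: by analyticity a relation on the triangle is a
relation on the plane. -/
lemma linearIndependent_lameFun {Ω : Set Plane} (hΩ : IsOpen Ω) (hne : Ω.Nonempty)
    (hm : ∀ k, MemLp (lameFun L P k) 2 (volume.restrict Ω)) {s : Finset (ℕ × ℕ)}
    (hs : ∀ k ∈ s, 1 ≤ k.1 ∧ 1 ≤ k.2) :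
    LinearIndependent ℝ fun k : s => (hm k).toLp (lameFun L P k) := by
  classical
  rw [Fintype.linearIndependent_iff]
  intro g hg k
  set c : ℕ × ℕ → ℝ := fun k => if hk : k ∈ s then g ⟨k, hk⟩ else 0 with hc
  have hcg : ∀ k : s, c k = g k := fun k => by simp [hc]
  set F : Plane → ℝ := fun x => ∑ k ∈ s, c k * lameFun L P k x with hF
  have hFs : ContDiff ℝ (⊤ : WithTop ℕ∞) F :=
    ContDiff.sum fun k _ => contDiff_const.mul (contDiff_lameFun L P k)
  have hae : F =ᵐ[volume.restrict Ω] fun _ => 0 := by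
    have h1 := Lp.coeFn_finsetSum Finset.univ fun k : s => g k • (hm k).toLp (lameFun L P k)
    rw [hg] at h1
    have h2 : ∀ k : s, ⇑(g k • (hm k).toLp (lameFun L P k)) =ᵐ[volume.restrict Ω]
        fun x => g k * lameFun L P k x := fun k => by
      filter_upwards [Lp.coeFn_smul (g k) ((hm k).toLp (lameFun L P k)), (hm k).coeFn_toLp]
        with x hx hx'
      rw [hx, Pi.smul_apply, hx', smul_eq_mul]
    filter_upwards [h1, eventually_all.2 h2, Lp.coeFn_zero ℝ 2 (volume.restrict Ω)]
      with x hx hx' hx0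
    rw [hx0] at hx
    simp only [Finset.sum_apply, hx', Pi.zero_apply] at hx
    simp only [hF]
    rw [hx, ← Finset.sum_coe_sort]
    exact Finset.sum_congr rfl fun k _ => by rw [hcg]
  have hev : Set.EqOn F (fun _ => 0) Ω :=
    Measure.eqOn_open_of_ae_eq hae hΩ hFs.continuous.continuousOn continuousOn_const
  obtain ⟨x₀, hx₀⟩ := hne
  have hF0 : F = fun _ => 0 :=
    (contDiff_omega_iff_analyticOnNhd.1 hFs).eq_of_eventuallyEq (z₀ := x₀)
      analyticOnNhd_const (hev.eventuallyEq_of_mem (hΩ.mem_nhds hx₀))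
  have h0 := eq_zero_of_sum_lameCoord hs (c := c) fun y => by
    have := congrFun hF0 (P + L y)
    simpa only [hF, lameFun_eq, add_sub_cancel_left, L.symm_apply_apply] using this
  rw [← hcg]
  exact h0 k k.2

lemma bddBelow_dirichletEigenvalue (Ω : Set Plane) {j : ℕ} (hj : 1 ≤ j) :
    BddBelow {t : ℝ | ∃ u : Fin j → Lp ℝ 2 (volume.restrict Ω),
      LinearIndependent ℝ u ∧ ∀ i, ∃ μ : ℝ, μ ≤ t ∧ IsDirichletEigenfunction Ω μ (u i)} := by
  refine ⟨0, ?_⟩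
  rintro t ⟨u, -, hu⟩
  obtain ⟨μ, hμ, h⟩ := hu ⟨0, hj⟩
  exact (isDirichletEigenfunction_iff.1 h).nonneg.trans hμ

/-- The eigenvalues of the equilateral triangle are at most those of Lamé's list. -/
theorem dirichletEigenvalue_card_le (hD : 0 < D) (ha : ‖a‖ = D) (hb : ‖b‖ = D)
    (hab : ‖a - b‖ = D) (hind : LinearIndependent ℝ ![a, b]) {s : Finset (ℕ × ℕ)}
    (hs : ∀ k ∈ s, 1 ≤ k.1 ∧ 1 ≤ k.2) (hne : s.Nonempty) {t : ℕ}
    (ht : ∀ k ∈ s, hexNorm k.1 k.2 ≤ t) :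
    dirichletEigenvalue (openTriangle P a b) s.card ≤ 16 * Real.pi ^ 2 / (9 * D ^ 2) * t := by
  have hind' := linearIndependent_combination hind (p := 2) (q := -1) (r := -1) (s := 2)
    (by norm_num)
  obtain ⟨L, hL⟩ := exists_equiv_of_linearIndependent hind'
  have hΩ := isOpen_openTriangle (P := P) hind
  have hm : ∀ k, MemLp (lameFun L P k) 2 (volume.restrict (openTriangle P a b)) := fun k =>
    memLp_of_isBounded (isBounded_openTriangle P a b) hΩ.measurableSet
      (contDiff_lameFun (n := 0) L P k).continuous
  have hli := linearIndependent_lameFun hΩ (openTriangle_nonempty P a b) hm hs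
  refine csInf_le (bddBelow_dirichletEigenvalue _ hne.card_pos)
    ⟨fun i => (hm (s.equivFin.symm i)).toLp _, hli.comp _ s.equivFin.symm.injective, fun i => ?_⟩
  refine ⟨_, ?_, isDirichletEigenfunction_lameFun hD ha hb hab hind hL
    (hs _ (s.equivFin.symm i).2).1 (hm _) (hli.ne_zero (s.equivFin.symm i))⟩
  have := ht _ (s.equivFin.symm i).2
  gcongr

/-- The `n` smallest values of the norm form, and the resulting bound on the sum of the first `n`
eigenvalues of the equilateral triangle. -/
lemma exists_finset_sum_dirichletEigenvalue_le (hD : 0 < D) (ha : ‖a‖ = D) (hb : ‖b‖ = D)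
    (hab : ‖a - b‖ = D) (hind : LinearIndependent ℝ ![a, b]) (n : ℕ) :
    ∃ (s : Finset (ℕ × ℕ)) (t : ℕ), s.card = n ∧ (∀ k ∈ s, 1 ≤ k.1 ∧ 1 ≤ k.2) ∧
      (∀ k ∈ s, hexNorm k.1 k.2 ≤ t) ∧
      (∀ k : ℕ × ℕ, 1 ≤ k.1 → 1 ≤ k.2 → hexNorm k.1 k.2 < t → k ∈ s) ∧
      ∑ j ∈ Finset.Icc 1 n, dirichletEigenvalue (openTriangle P a b) j ≤
        16 * Real.pi ^ 2 / (9 * D ^ 2) * ∑ k ∈ s, (hexNorm k.1 k.2 : ℝ) := by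
  induction n with
  | zero => exact ⟨∅, 0, by simp⟩
  | succ n ih =>
    obtain ⟨s, t, hcard, h1, ht, hlt, hsum⟩ := ih
    have hex : ∃ N : ℕ, ∃ k : ℕ × ℕ, 1 ≤ k.1 ∧ 1 ≤ k.2 ∧ k ∉ s ∧ hexNorm k.1 k.2 = N := by
      obtain ⟨k, hk⟩ := Infinite.exists_notMem_finset
        (s.image fun k : ℕ × ℕ => (k.1 - 1, k.2 - 1))
      refine ⟨_, (k.1 + 1, k.2 + 1), by simp, by simp, fun h => hk ?_, rfl⟩
      exact Finset.mem_image.2 ⟨_, h, by simp⟩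
    classical
    obtain ⟨k, hk1, hk2, hks, hkN⟩ := Nat.find_spec hex
    have hmin := fun m => Nat.find_min hex (m := m)
    rw [← hkN] at hmin
    have htk : t ≤ hexNorm k.1 k.2 := by
      by_contra! h
      exact hks (hlt k hk1 hk2 h)
    have hs' : ∀ k' ∈ insert k s, 1 ≤ k'.1 ∧ 1 ≤ k'.2 := by
      intro k' hk'
      rcases Finset.mem_insert.1 hk' with rfl | h
      · exact ⟨hk1, hk2⟩
      · exact h1 _ h
    have ht' : ∀ k' ∈ insert k s, hexNorm k'.1 k'.2 ≤ hexNorm k.1 k.2 := by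
      intro k' hk'
      rcases Finset.mem_insert.1 hk' with rfl | h
      · exact le_rfl
      · exact (ht _ h).trans htk
    have hcard' : (insert k s).card = n + 1 := by rw [Finset.card_insert_of_notMem hks, hcard]
    refine ⟨insert k s, hexNorm k.1 k.2, hcard', hs', ht', fun k' h1' h2' h3' => ?_, ?_⟩
    · by_contra h
      exact hmin _ h3' ⟨k', h1', h2', fun h' => h (Finset.mem_insert_of_mem h'), rfl⟩
    · rw [Finset.sum_Icc_succ_top (by omega), Finset.sum_insert hks, mul_add, add_comm]
      have := dirichletEigenvalue_card_le (P := P) hD ha hb hab hind hs'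
        (Finset.insert_nonempty _ _) ht'
      rw [hcard'] at this
      exact add_le_add this hsum

theorem sum_dirichletEigenvalue_equilateral_le (hD : 0 < D) (ha : ‖a‖ = D) (hb : ‖b‖ = D)
    (hab : ‖a - b‖ = D) (hind : LinearIndependent ℝ ![a, b]) {n : ℕ} (hn : 1 ≤ n) :
    ∃ t : ℕ, 0 < n * t - rieszFull t t ∧
      (∑ j ∈ Finset.Icc 1 n, dirichletEigenvalue (openTriangle P a b) j) * D ^ 2 ≤
        16 * Real.pi ^ 2 / 9 * (n * t - rieszFull t t) := by
  obtain ⟨s, t, hcard, h1, ht, hlt, hsum⟩ :=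
    exists_finset_sum_dirichletEigenvalue_le (P := P) hD ha hb hab hind n
  have hR : rieszFull t t ≤ ∑ k ∈ s, ((t : ℝ) - hexNorm k.1 k.2) := by
    have h2 : ∀ k ∈ s, max ((t : ℝ) - hexNorm k.1 k.2) 0 = (t : ℝ) - hexNorm k.1 k.2 :=
      fun k hk => max_eq_left (sub_nonneg.2 (by exact_mod_cast ht k hk))
    rw [← Finset.sum_congr rfl h2, rieszFull]
    classical
    refine (Finset.sum_subset Finset.inter_subset_left fun k hk hk' => ?_).symm.le.trans
      (Finset.sum_le_sum_of_subset_of_nonneg (Finset.inter_subset_right (s₁ := latticeBox t))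
        fun _ _ _ => le_max_right _ _)
    refine max_eq_right (sub_nonpos.2 ?_)
    by_contra! h
    have hkb := mem_latticeBox.1 hk
    exact hk' (Finset.mem_inter.2 ⟨hk, hlt k hkb.1.1 hkb.2.1 (by exact_mod_cast h)⟩)
  have hS : ∑ k ∈ s, (hexNorm k.1 k.2 : ℝ) ≤ n * t - rieszFull t t := by
    rw [Finset.sum_sub_distrib, Finset.sum_const, hcard, nsmul_eq_mul] at hR
    linarith
  refine ⟨t, lt_of_lt_of_le ?_ hS, ?_⟩
  · refine Finset.sum_pos (fun k hk => ?_) (Finset.card_pos.1 (by omega))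
    have := h1 k hk
    have : 0 < hexNorm k.1 k.2 := by unfold hexNorm; nlinarith
    exact_mod_cast this
  · calc _ ≤ 16 * Real.pi ^ 2 / (9 * D ^ 2) * (n * t - rieszFull t t) * D ^ 2 := by
          gcongr
          exact hsum.trans (mul_le_mul_of_nonneg_left hS (by positivity))
      _ = _ := by field_simp

end EquilateralSpectrum

/-! ### Comparison of triangles -/

section Triangles

open MeasureTheory

variable {P a b : Plane}

lemma IsTestFunction.mono {Ω Ω' : Set Plane} (h : Ω ⊆ Ω') {φ : Plane → ℝ}
    (hφ : IsTestFunction Ω φ) : IsTestFunction Ω' φ :=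
  ⟨hφ.contDiff, hφ.hasCompactSupport, hφ.tsupport_subset.trans h⟩

lemma diam_openTriangle (hb : ‖b‖ ≤ ‖a‖) (hab : ‖a - b‖ ≤ ‖a‖) :
    Metric.diam (openTriangle P a b) = ‖a‖ := by
  apply le_antisymm
  · have hsub : openTriangle P a b ⊆ convexHull ℝ {P, P + a, P + b} := by
      rintro x ⟨s, r, hs, hr, hsr, rfl⟩
      have e : P + (s • a + r • b) = (1 - s - r) • P + s • (P + a) + r • (P + b) := by module
      rw [e]
      have hc := convex_convexHull ℝ ({P, P + a, P + b} : Set Plane)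
      have m0 : P ∈ convexHull ℝ ({P, P + a, P + b} : Set Plane) :=
        subset_convexHull ℝ _ (by simp)
      have m1 : P + a ∈ convexHull ℝ ({P, P + a, P + b} : Set Plane) :=
        subset_convexHull ℝ _ (by simp)
      have m2 : P + b ∈ convexHull ℝ ({P, P + a, P + b} : Set Plane) :=
        subset_convexHull ℝ _ (by simp)
      have := hc.sum_mem (t := Finset.univ) (w := ![1 - s - r, s, r]) (z := ![P, P + a, P + b])
        (by intro i _; fin_cases i <;> simp <;> linarith)
        (by simp [Fin.sum_univ_three]; ring) (by intro i _; fin_cases i <;> simp [m0, m1, m2])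
      simpa [Fin.sum_univ_three] using this
    have hbd : Bornology.IsBounded (convexHull ℝ ({P, P + a, P + b} : Set Plane)) :=
      isBounded_convexHull.2 (Set.toFinite _).isBounded
    refine (Metric.diam_mono hsub hbd).trans ?_
    rw [convexHull_diam]
    refine Metric.diam_le_of_forall_dist_le (norm_nonneg a) fun x hx y hy => ?_
    have hba : ‖b - a‖ ≤ ‖a‖ := by rwa [norm_sub_rev]
    rcases hx with rfl | rfl | rfl <;> rcases hy with rfl | rfl | rfl <;>
      simp [dist_eq_norm, hb, hab, hba, norm_nonneg]
  · refine le_of_forall_pos_le_add fun ε hε => ?_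
    obtain ⟨δ, hδ0, hδ1, hδ⟩ : ∃ δ : ℝ, 0 < δ ∧ δ < 1 / 3 ∧ 3 * δ * ‖a‖ ≤ ε := by
      refine ⟨min (1 / 4) (ε / (3 * (‖a‖ + 1))), by positivity,
        (min_le_left _ _).trans_lt (by norm_num), ?_⟩
      have h1 := min_le_right (1 / 4) (ε / (3 * (‖a‖ + 1)))
      rw [le_div_iff₀ (by positivity)] at h1
      have h2 : 0 < min (1 / 4) (ε / (3 * (‖a‖ + 1))) := by positivity
      linarith
    have h1 : P + (δ • a + δ • b) ∈ openTriangle P a b := ⟨δ, δ, hδ0, hδ0, by linarith, rfl⟩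
    have h2 : P + ((1 - 2 * δ) • a + δ • b) ∈ openTriangle P a b :=
      ⟨1 - 2 * δ, δ, by linarith, hδ0, by linarith, rfl⟩
    have h3 := Metric.dist_le_diam_of_mem (isBounded_openTriangle P a b) h2 h1
    rw [dist_eq_norm] at h3
    have e : P + ((1 - 2 * δ) • a + δ • b) - (P + (δ • a + δ • b)) = (1 - 3 * δ) • a := by module
    rw [e, norm_smul, Real.norm_of_nonneg (by linarith)] at h3
    linarith

/-- The lower bound for an arbitrary triangle, with `a` the longest side and `a - b` the shortest.
Stretching `b` to the length of `a` embeds the triangle in an isosceles triangle of the same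
diameter. -/
theorem exists_shape_le_sum_dirichletEigenvalue (hind : LinearIndependent ℝ ![a, b])
    (hba : ‖b‖ ≤ ‖a‖) (hab : ‖a - b‖ ≤ ‖b‖) :
    ∃ s : ℝ, 0 < s ∧ s ≤ 1 ∧ (s = 1 → ‖b‖ = ‖a‖ ∧ ‖a - b‖ = ‖a‖) ∧ ∀ n t : ℕ,
      16 * Real.pi ^ 2 / 9 * shapeFactor s * (n * t - rieszFull t t) ≤
        (∑ j ∈ Finset.Icc 1 n, dirichletEigenvalue (openTriangle P a b) j) * ‖a‖ ^ 2 := by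
  have ha0 : 0 < ‖a‖ := norm_pos_iff.2 (hind.ne_zero 0)
  have hb0 : 0 < ‖b‖ := norm_pos_iff.2 (hind.ne_zero 1)
  set D := ‖a‖ with hD
  set q := D / ‖b‖ with hq
  have hq1 : 1 ≤ q := (one_le_div hb0).2 hba
  have hq0 : 0 < q := one_pos.trans_le hq1
  set b' := q • b with hb'
  have hnb' : ‖b'‖ = D := by
    rw [hb', norm_smul, Real.norm_of_nonneg hq0.le, hq]; field_simp
  have hind' : LinearIndependent ℝ ![a, b'] := by
    have := linearIndependent_combination hind (p := 1) (q := 0) (r := 0) (s := q)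
      (by simpa using hq0.ne')
    simpa using this
  have hne : a - b' ≠ 0 := by
    intro h
    rw [LinearIndependent.pair_iff] at hind'
    have := hind' 1 (-1) (by rw [← h]; module)
    norm_num at this
  set s := ‖a - b'‖ ^ 2 / D ^ 2 with hs
  have hsD : ‖a - b'‖ ^ 2 = s * D ^ 2 := by rw [hs]; field_simp
  have hs0 : 0 < s := by
    have := norm_pos_iff.2 hne
    positivity
  have e1 := norm_sub_sq_real a b
  have e2 := norm_sub_sq_real a b'
  rw [hb', real_inner_smul_right, ← hb', hnb', ← hD, hsD] at e2
  rw [← hD] at e1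
  have hab2 : ‖a - b‖ ^ 2 ≤ ‖b‖ ^ 2 := by gcongr
  have hin : D ^ 2 / 2 ≤ inner ℝ a b := by linarith
  have hs1 : s * D ^ 2 ≤ 1 * D ^ 2 := by
    nlinarith [mul_le_mul hq1 hin (by positivity) hq0.le]
  have hs1' : s ≤ 1 := le_of_mul_le_mul_right hs1 (by positivity)
  refine ⟨s, hs0, hs1', fun h1 => ?_, fun n t => ?_⟩
  · rw [h1] at e2
    have h2 : (q - 1) * inner ℝ a b = 0 := by
      have h3 : 0 ≤ (q - 1) * inner ℝ a b :=
        mul_nonneg (by linarith) (le_trans (by positivity) hin)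
      linarith
    have hin0 : inner ℝ a b ≠ 0 := (lt_of_lt_of_le (by positivity) hin).ne'
    have hq1' : q = 1 := by
      have := (mul_eq_zero.1 h2).resolve_right hin0
      linarith
    have hbD : ‖b‖ = D := by
      rw [hq, div_eq_one_iff_eq hb0.ne'] at hq1'
      exact hq1'.symm
    refine ⟨hbD, ?_⟩
    rw [hq1', one_mul] at e2
    have h3 : ‖a - b‖ ^ 2 = D ^ 2 := by rw [hbD] at e1; linarith
    exact (pow_left_inj₀ (norm_nonneg _) ha0.le two_ne_zero).1 h3
  · have hsub : openTriangle P a b ⊆ openTriangle P a b' := by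
      rintro x ⟨σ, ρ, h1, h2, h3, rfl⟩
      refine ⟨σ, ρ / q, h1, by positivity, ?_, ?_⟩
      · have : ρ / q ≤ ρ := div_le_self h2.le hq1
        linarith
      · rw [hb', smul_smul, div_mul_cancel₀ _ hq0.ne']
    have hsf : 0 < shapeFactor s := one_pos.trans_le (one_le_shapeFactor hs0 hs1')
    have key := le_sum_dirichletEigenvalue (Ω := openTriangle P a b)
      (α := 16 * Real.pi ^ 2 / 9 * shapeFactor s / D ^ 2) (R := fun t => rieszFull t t)
      (by positivity) (isOpen_openTriangle hind) (openTriangle_nonempty P a b)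
      (isBounded_openTriangle P a b).measure_lt_top.ne (fun n φ C hφ hC0 hC t => by
        have := le_sum_gradEnergy ha0 rfl hnb' hsD hs0 hs1' hind'
          (fun j => (hφ j).mono hsub) hC0 hC t
        rw [div_mul_eq_mul_div, div_le_iff₀ (by positivity)]
        linarith) n t
    rw [div_mul_eq_mul_div, div_le_iff₀ (by positivity)] at key
    exact key

lemma interior_eq_openTriangle (T : Affine.Triangle ℝ Plane) : T.interior =
    openTriangle (T.points 0) (T.points 1 - T.points 0) (T.points 2 - T.points 0) := by
  ext x
  constructor
  · rintro ⟨w, hw, hI, rfl⟩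
    rw [Finset.affineCombination_eq_linear_combination _ _ _ hw, Fin.sum_univ_three]
    rw [Fin.sum_univ_three] at hw
    refine ⟨w 1, w 2, (hI 1).1, (hI 2).1, by linarith [(hI 0).1], ?_⟩
    rw [← sub_eq_zero]
    have : w 0 = 1 - w 1 - w 2 := by linarith
    rw [this]; module
  · rintro ⟨s, r, hs, hr, hsr, rfl⟩
    have hw : ∑ i, (![1 - s - r, s, r] : Fin 3 → ℝ) i = 1 := by
      simp [Fin.sum_univ_three]; ring
    refine ⟨![1 - s - r, s, r], hw, ?_, ?_⟩
    · intro i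
      fin_cases i <;> simp <;> constructor <;> linarith
    · rw [Finset.affineCombination_eq_linear_combination _ _ _ hw, Fin.sum_univ_three]
      simp only [Matrix.cons_val]
      module

lemma linearIndependent_sides (T : Affine.Triangle ℝ Plane) :
    LinearIndependent ℝ ![T.points 1 - T.points 0, T.points 2 - T.points 0] := by
  have h := (affineIndependent_iff_linearIndependent_vsub ℝ _ (0 : Fin 3)).1 T.independent
  have h2 := h.comp (fun i : Fin 2 => (⟨i.succ, Fin.succ_ne_zero i⟩ : {x : Fin 3 // x ≠ 0}))
    fun i j hij => by simpa using hij
  have e : ![T.points 1 - T.points 0, T.points 2 - T.points 0] =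
      (fun i : {x : Fin 3 // x ≠ 0} => T.points i -ᵥ T.points 0) ∘
        fun i : Fin 2 => ⟨i.succ, Fin.succ_ne_zero i⟩ := by
    funext i
    fin_cases i <;> rfl
  rw [e]
  exact h2

/-- The vertices of a triangle can be listed so that the sides are sorted by length. -/
lemma exists_perm_dist_le (T : Affine.Triangle ℝ Plane) : ∃ e : Equiv.Perm (Fin 3),
    dist (T.points (e 2)) (T.points (e 0)) ≤ dist (T.points (e 1)) (T.points (e 0)) ∧
    dist (T.points (e 1)) (T.points (e 2)) ≤ dist (T.points (e 2)) (T.points (e 0)) := by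
  set f : Fin 3 → ℝ := fun i => dist (T.points (i + 1)) (T.points (i + 2)) with hf
  have hf' : ∀ i j k, i ≠ j → j ≠ k → i ≠ k → f k = dist (T.points i) (T.points j) := by
    intro i j k h1 h2 h3
    have h : (k + 1 = i ∧ k + 2 = j) ∨ (k + 1 = j ∧ k + 2 = i) := by
      clear hf f
      decide +revert
    simp only [hf]
    rcases h with ⟨rfl, rfl⟩ | ⟨rfl, rfl⟩
    · rfl
    · exact dist_comm _ _
  set e := Tuple.sort f with he
  have hm : Monotone (f ∘ e) := Tuple.monotone_sort f
  have h01 : e 0 ≠ e 1 := e.injective.ne (by decide)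
  have h02 : e 0 ≠ e 2 := e.injective.ne (by decide)
  have h12 : e 1 ≠ e 2 := e.injective.ne (by decide)
  have m1 : f (e 0) ≤ f (e 1) := hm (by decide : (0 : Fin 3) ≤ 1)
  have m2 : f (e 1) ≤ f (e 2) := hm (by decide : (1 : Fin 3) ≤ 2)
  rw [hf' _ _ _ h12 h02.symm h01.symm, hf' _ _ _ h02.symm h01 h12.symm] at m1
  rw [hf' _ _ _ h02.symm h01 h12.symm, hf' _ _ _ h01.symm h02 h12] at m2
  exact ⟨e, m2, m1⟩

/-- The lower bound for the eigenvalues of an arbitrary triangle, with a factor that exceeds `1`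
unless the triangle is equilateral. -/
lemma exists_factor_le_eigenvalueSumDiamSq (T : Affine.Triangle ℝ Plane) :
    ∃ F : ℝ, 1 ≤ F ∧ (F ≤ 1 → T.Equilateral) ∧ ∀ n t : ℕ,
      16 * Real.pi ^ 2 / 9 * F * (n * t - rieszFull t t) ≤ eigenvalueSumDiamSq T.interior n := by
  obtain ⟨e, h1, h2⟩ := exists_perm_dist_le T
  set S : Affine.Triangle ℝ Plane := T.reindex e.symm with hS
  have hSp : ∀ i, S.points i = T.points (e i) := fun i => by
    simp [hS, Affine.Simplex.reindex]
  rw [← hSp, ← hSp, ← hSp, dist_eq_norm, dist_eq_norm] at h1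
  rw [← hSp, ← hSp, ← hSp, dist_eq_norm, dist_eq_norm,
    ← sub_sub_sub_cancel_right _ _ (S.points 0)] at h2
  have hint : T.interior = openTriangle (S.points 0) (S.points 1 - S.points 0)
      (S.points 2 - S.points 0) := by
    rw [← interior_eq_openTriangle, hS, Affine.Simplex.interior_reindex]
  obtain ⟨s, hs0, hs1, hseq, hs⟩ :=
    exists_shape_le_sum_dirichletEigenvalue (P := S.points 0) (linearIndependent_sides S) h1 h2
  refine ⟨shapeFactor s, one_le_shapeFactor hs0 hs1, fun hF => ?_, fun n t => ?_⟩
  · have hs1' : s = 1 := by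
      by_contra hne
      exact absurd (one_lt_shapeFactor hs0 (lt_of_le_of_ne hs1 hne)) (not_lt.2 hF)
    obtain ⟨h3, h4⟩ := hseq hs1'
    have hSE : S.Equilateral := by
      rw [Affine.Triangle.equilateral_iff_dist_01_eq_02_and_dist_01_eq_12,
        dist_comm (S.points 0), dist_comm (S.points 0), dist_eq_norm, dist_eq_norm, dist_eq_norm,
        ← sub_sub_sub_cancel_right (S.points 1) (S.points 2) (S.points 0), h3, h4]
      exact ⟨rfl, rfl⟩
    rwa [hS, Affine.Simplex.equilateral_reindex_iff] at hSE
  · rw [hint, eigenvalueSumDiamSq, diam_openTriangle h1 (h2.trans h1)]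
    exact hs n t

lemma eigenvalueSumDiamSq_le_of_equilateral {E : Affine.Triangle ℝ Plane} (hE : E.Equilateral)
    {n : ℕ} (hn : 1 ≤ n) : ∃ t : ℕ, 0 < n * t - rieszFull t t ∧
      eigenvalueSumDiamSq E.interior n ≤ 16 * Real.pi ^ 2 / 9 * (n * t - rieszFull t t) := by
  obtain ⟨h1, h2⟩ := Affine.Triangle.equilateral_iff_dist_01_eq_02_and_dist_01_eq_12.1 hE
  rw [dist_comm (E.points 0), dist_comm (E.points 0), dist_eq_norm, dist_eq_norm] at h1
  rw [dist_comm (E.points 0), dist_eq_norm, dist_eq_norm,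
    ← sub_sub_sub_cancel_right (E.points 1) (E.points 2) (E.points 0)] at h2
  have hind := linearIndependent_sides E
  obtain ⟨t, h0, ht⟩ := sum_dirichletEigenvalue_equilateral_le (P := E.points 0)
    (norm_pos_iff.2 (hind.ne_zero 0)) rfl h1.symm h2.symm hind hn
  refine ⟨t, h0, ?_⟩
  rw [interior_eq_openTriangle, eigenvalueSumDiamSq, diam_openTriangle h1.symm.le h2.symm.le]
  exact ht

end Triangles

theorem theorem1p1 (T E : Affine.Triangle ℝ Plane) (hE : E.Equilateral) (n : ℕ) (hn : 1 ≤ n) :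
    eigenvalueSumDiamSq E.interior n ≤ eigenvalueSumDiamSq T.interior n ∧
      (eigenvalueSumDiamSq T.interior n = eigenvalueSumDiamSq E.interior n ↔
        T.Equilateral) := by
  have key : ∀ T E : Affine.Triangle ℝ Plane, E.Equilateral →
      eigenvalueSumDiamSq E.interior n ≤ eigenvalueSumDiamSq T.interior n ∧
      (eigenvalueSumDiamSq T.interior n = eigenvalueSumDiamSq E.interior n → T.Equilateral) := by
    intro T E hE
    obtain ⟨F, hF1, hFE, hF⟩ := exists_factor_le_eigenvalueSumDiamSq T
    obtain ⟨t, h0, ht⟩ := eigenvalueSumDiamSq_le_of_equilateral hE hn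
    have h1 := hF n t
    have hpos : 0 < 16 * Real.pi ^ 2 / 9 * (n * t - rieszFull t t) := by positivity
    constructor
    · nlinarith
    · intro heq
      refine hFE ?_
      by_contra! hlt
      nlinarith
  -- For equilateral `T` the two triangles can be exchanged in the inequality.
  exact ⟨(key T E hE).1, (key T E hE).2, fun hT => le_antisymm (key E T hT).1 (key T E hE).1⟩
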